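/- Let $F\in\mathbb R[x_0,x_1,x_2]$ be a form of degree $4$ with $F(a)>0$ for all $a\in\mathbb R^3\setminus\{0\}$ and such that the complex plane curve $\mathcal V(F)\subset\mathbb P^2_{\mathbb C}$ is smooth. Let $M=x_0M_0+x_1M_1+x_2M_2$ be a real symmetric linear determinantal representation of $F$: the $M_k$ are real symmetric $4\times4$ matrices and $F=\det M$. The Cayley octad of $M$ is the set of common zeros in $\mathbb P^3(\mathbb C)$ of the three quadrics $u^tM_ku$ ($k=0,1,2$). For row vectors $O_1,\dots,O_4\in\mathbb C^4$ representing points of the Cayley octad put $b_{ij}=O_iMO_j^t$. A positive quadratic representation of a form $G$ is a symmetric matrix $Q$ of real quadratic forms with $\det Q=G$ and $Q(a)$ positive semidefinite for all $a\in\mathbb R^3$. Then there are vectors $O_1,\;O_2=\overline{O_1},\;O_3,\;O_4=\overline{O_3}$ representing four distinct points of the Cayley octad, and for every such choice the following holds. (1) There is a unique $T\in GL_4(\mathbb R)$ with $$T\cdot(O_1^t,O_2^t,O_3^t,O_4^t)=\begin{pmatrix}1&1&0&0\\ i&-i&0&0\\ 0&0&1&1\\ 0&0&i&-i\end{pmatrix},$$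 and the $O_i$ can be chosen such that $\det(T)^2=1$. (2) $b_{12}$ and $b_{34}$ have real coefficients, and $$M'=T^{-t}MT^{-1}=\begin{pmatrix}\tfrac12b_{12}&0&l_{13}&l_{14}\\0&\tfrac12b_{12}&l_{23}&l_{24}\\ l_{13}&l_{23}&\tfrac12b_{34}&0\\ l_{14}&l_{24}&0&\tfrac12b_{34}\end{pmatrix}$$ with the real linear forms $$\begin{aligned}l_{13}&=\tfrac14(b_{13}+b_{24}+(b_{14}+b_{23})),& l_{24}&=-\tfrac14(b_{13}+b_{24}-(b_{14}+b_{23})),\\ l_{23}&=-\tfrac i4(b_{13}-b_{24}+(b_{14}-b_{23})),& l_{14}&=-\tfrac i4(b_{13}-b_{24}-(b_{14}-b_{23})).\end{aligned}$$ (3) Let $$Q=-\begin{pmatrix}\tfrac14b_{12}b_{34}-l_{23}^2-l_{24}^2&l_{13}l_{23}+l_{14}l_{24}\\ l_{13}l_{23}+l_{14}l_{24}&\tfrac14b_{12}b_{34}-l_{13}^2-l_{14}^2\end{pmatrix}.$$ The upper left $2\times2$ block of the adjugate of $M'$ equals $-\tfrac12b_{34}\,Q$. The matrix $Q$ is a positive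 quadratic representation of $\det(T)^{-2}F$; in particular, if $\det(T)^2=1$, then $Q$ is a positive quadratic representation of $F$. Moreover, $Q(a)$ is positive definite for every $a\in\mathbb R^3\setminus\{0\}$. -/

import Mathlib

noncomputable section

/-- A ternary form over `ℝ` that is strictly positive at every nonzero real point. -/
def IsPositiveForm (F : MvPolynomial (Fin 3) ℝ) : Prop :=
  ∀ a : Fin 3 → ℝ, a ≠ 0 → 0 < MvPolynomial.eval a F

/-- The complex projective plane curve `V(F)` is smooth: at no point of the curve do all partial
derivatives of `F` vanish. -/
def IsSmoothCurve (F : MvPolynomial (Fin 3) ℝ) : Prop :=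
  ∀ z : Fin 3 → ℂ, z ≠ 0 → MvPolynomial.aeval z F = 0 →
    ∃ i, MvPolynomial.aeval z (MvPolynomial.pderiv i F) ≠ 0

/-- `M` is a real symmetric linear determinantal representation of `F`. -/
structure IsLinearDetRep {d : ℕ} (F : MvPolynomial (Fin 3) ℝ)
    (M : Matrix (Fin d) (Fin d) (MvPolynomial (Fin 3) ℝ)) : Prop where
  isSymm : M.IsSymm
  linear : ∀ i j, (M i j).IsHomogeneous 1
  det_eq : M.det = F

/-- `Q` is a positive quadratic (determinantal) representation of `F`. -/
structure IsPositiveQuadraticRep {d : ℕ} (F : MvPolynomial (Fin 3) ℝ)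
    (Q : Matrix (Fin d) (Fin d) (MvPolynomial (Fin 3) ℝ)) : Prop where
  isSymm : Q.IsSymm
  quadratic : ∀ i j, (Q i j).IsHomogeneous 2
  det_eq : Q.det = F
  posSemidef : ∀ a : Fin 3 → ℝ, (Q.map (MvPolynomial.eval a)).PosSemidef

/-- The coefficient matrix `M_k` in `M = x₀ M₀ + x₁ M₁ + x₂ M₂`, with complex entries. -/
def coeffMatrix (M : Matrix (Fin 4) (Fin 4) (MvPolynomial (Fin 3) ℝ)) (k : Fin 3) :
    Matrix (Fin 4) (Fin 4) ℂ :=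
  M.map fun p => ((MvPolynomial.coeff (Finsupp.single k 1) p : ℝ) : ℂ)

/-- The Cayley octad of `M`: the common zeros in `ℙ³(ℂ)` of the three quadrics `uᵗ M_k u`. -/
def cayleyOctad (M : Matrix (Fin 4) (Fin 4) (MvPolynomial (Fin 3) ℝ)) :
    Set (Projectivization ℂ (Fin 4 → ℂ)) :=
  {p | ∃ (u : Fin 4 → ℂ) (hu : u ≠ 0), p = Projectivization.mk ℂ u hu ∧
    ∀ k, dotProduct u ((coeffMatrix M k).mulVec u) = 0}

/-- `O 0, O 1, O 2, O 3` represent four distinct points of the Cayley octad of `M` which form two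
complex conjugate pairs. -/
structure IsConjugateQuadruple (M : Matrix (Fin 4) (Fin 4) (MvPolynomial (Fin 3) ℝ))
    (O : Fin 4 → Fin 4 → ℂ) : Prop where
  ne_zero : ∀ i, O i ≠ 0
  mem_octad : ∀ i, Projectivization.mk ℂ (O i) (ne_zero i) ∈ cayleyOctad M
  distinct : Function.Injective fun i => Projectivization.mk ℂ (O i) (ne_zero i)
  conj_first : O 1 = star (O 0)
  conj_second : O 3 = star (O 2)

/-- The real invertible matrix `T` sends the column vectors `O 0, O 1, O 2, O 3` to
`(1, i, 0, 0)`, `(1, -i, 0, 0)`, `(0, 0, 1, i)`, `(0, 0, 1, -i)`. -/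
structure IsOctadBaseChange (O : Fin 4 → Fin 4 → ℂ) (T : Matrix (Fin 4) (Fin 4) ℝ) : Prop where
  isUnit_det : IsUnit T.det
  map_octad : T.map (fun r : ℝ => (r : ℂ)) * (Matrix.of O).transpose =
    !![1, 1, 0, 0;
       Complex.I, -Complex.I, 0, 0;
       0, 0, 1, 1;
       0, 0, Complex.I, -Complex.I]

/-- The transformed matrix `M' = T⁻ᵗ M T⁻¹`. -/
def baseChange (T : Matrix (Fin 4) (Fin 4) ℝ)
    (M : Matrix (Fin 4) (Fin 4) (MvPolynomial (Fin 3) ℝ)) :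
    Matrix (Fin 4) (Fin 4) (MvPolynomial (Fin 3) ℝ) :=
  (T⁻¹.map MvPolynomial.C).transpose * M * T⁻¹.map MvPolynomial.C

/-- The entry `u M vᵗ`, a linear form with complex coefficients, of the bitangent matrix. -/
def bitangentForm (M : Matrix (Fin 4) (Fin 4) (MvPolynomial (Fin 3) ℝ)) (u v : Fin 4 → ℂ) :
    MvPolynomial (Fin 3) ℂ :=
  dotProduct (fun j => MvPolynomial.C (u j))
    ((M.map (MvPolynomial.map (algebraMap ℝ ℂ))).mulVec fun j => MvPolynomial.C (v j))

/-- The symmetric block form of `M'`. -/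
def blockForm (b₁₂ b₃₄ l₁₃ l₁₄ l₂₃ l₂₄ : MvPolynomial (Fin 3) ℝ) :
    Matrix (Fin 4) (Fin 4) (MvPolynomial (Fin 3) ℝ) :=
  !![MvPolynomial.C (1 / 2) * b₁₂, 0, l₁₃, l₁₄;
     0, MvPolynomial.C (1 / 2) * b₁₂, l₂₃, l₂₄;
     l₁₃, l₂₃, MvPolynomial.C (1 / 2) * b₃₄, 0;
     l₁₄, l₂₄, 0, MvPolynomial.C (1 / 2) * b₃₄]

/-- The explicit `2 × 2` matrix `Q`. -/
def quadMatrix (b₁₂ b₃₄ l₁₃ l₁₄ l₂₃ l₂₄ : MvPolynomial (Fin 3) ℝ) :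
    Matrix (Fin 2) (Fin 2) (MvPolynomial (Fin 3) ℝ) :=
  -!![MvPolynomial.C (1 / 4) * b₁₂ * b₃₄ - l₂₃ ^ 2 - l₂₄ ^ 2, l₁₃ * l₂₃ + l₁₄ * l₂₄;
      l₁₃ * l₂₃ + l₁₄ * l₂₄, MvPolynomial.C (1 / 4) * b₁₂ * b₃₄ - l₁₃ ^ 2 - l₁₄ ^ 2]

/-- The real linear forms `b₁₂, b₃₄, l₁₃, l₁₄, l₂₃, l₂₄` are obtained from the entries
`b_{ij} = O_i M O_jᵗ` of the bitangent matrix by the explicit formulas (the points `O₁, …, O₄` are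
`O 0, …, O 3`). -/
structure IsOctadEntries (M : Matrix (Fin 4) (Fin 4) (MvPolynomial (Fin 3) ℝ))
    (O : Fin 4 → Fin 4 → ℂ) (b₁₂ b₃₄ l₁₃ l₁₄ l₂₃ l₂₄ : MvPolynomial (Fin 3) ℝ) : Prop where
  b₁₂_eq : MvPolynomial.map (algebraMap ℝ ℂ) b₁₂ = bitangentForm M (O 0) (O 1)
  b₃₄_eq : MvPolynomial.map (algebraMap ℝ ℂ) b₃₄ = bitangentForm M (O 2) (O 3)
  l₁₃_eq : MvPolynomial.map (algebraMap ℝ ℂ) l₁₃ = MvPolynomial.C (1 / 4) *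
    (bitangentForm M (O 0) (O 2) + bitangentForm M (O 1) (O 3)
      + (bitangentForm M (O 0) (O 3) + bitangentForm M (O 1) (O 2)))
  l₂₄_eq : MvPolynomial.map (algebraMap ℝ ℂ) l₂₄ = MvPolynomial.C (-(1 / 4)) *
    (bitangentForm M (O 0) (O 2) + bitangentForm M (O 1) (O 3)
      - (bitangentForm M (O 0) (O 3) + bitangentForm M (O 1) (O 2)))
  l₂₃_eq : MvPolynomial.map (algebraMap ℝ ℂ) l₂₃ = MvPolynomial.C (-(Complex.I / 4)) *
    (bitangentForm M (O 0) (O 2) - bitangentForm M (O 1) (O 3)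
      + (bitangentForm M (O 0) (O 3) - bitangentForm M (O 1) (O 2)))
  l₁₄_eq : MvPolynomial.map (algebraMap ℝ ℂ) l₁₄ = MvPolynomial.C (-(Complex.I / 4)) *
    (bitangentForm M (O 0) (O 2) - bitangentForm M (O 1) (O 3)
      - (bitangentForm M (O 0) (O 3) - bitangentForm M (O 1) (O 2)))

end

/-! The coefficient matrices $M_0,M_1,M_2$ span a net of quadrics in $\mathbb P^3$ with discriminant
curve $\mathcal V(F)$, and the Cayley octad is the base locus of this net. The curve being smooth at
a singular member means that the kernel vectors of that member are not isotropic for some other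
member (`IsLinearDetRep.isPositiveNet`). Consequently singular members have corank one, the three
quadrics meet transversally at base points, and four distinct base points are never coplanar
(`IsSmoothNet.linearIndependent_basePoints`).

The main work is to find two conjugate pairs of base points. A singular member is a cone over a
conic. Eliminating the position on each ruling leaves an octic on the conic, and transversality then
yields two distinct base points (`IsSmoothNet.exists_two_basePoints`). They cannot both be real: on
the line joining two real base points the net restricts to multiples of one hyperbolic form, and a
suitable real member would have a semidefinite Schur complement, contradicting $F>0$
(`not_isPositiveNet_normalNet_hyperbolic`). So there is a nonreal base point $u$. On the line
through $u$ and $\bar u$ the net restricts to multiples of a definite form. Eliminating the two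
coordinates along this line leaves a real sextic which positivity makes negative at every real
point, so its roots are nonreal and give a second pair
(`IsPositiveNet.exists_nonreal_basePoint_normalNet`).

The rest is linear algebra. $T$ is the inverse of the matrix with columns $\Re O_1,\Im O_1,\Re
O_3,\Im O_3$, and the vanishing of $O_iMO_i^t$ forces the scalar diagonal blocks of $M'$. Writing
$M'=\begin{pmatrix}\beta I&L\\L^t&\gamma I\end{pmatrix}$, one has
$Q=\operatorname{adj}(LL^t-\beta\gamma I)$ and hence $\det Q=\det M'=\det(T)^{-2}F$. Since $\det
Q>0$ off the origin, $Q_{11}$ has no zero there. It is positive somewhere on the line or plane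
$b_{12}=0$, and $\mathbb R^3\setminus\{0\}$ is connected, so $Q$ is positive definite everywhere off
the origin. -/

noncomputable section

/-! ### Smooth nets of quadrics and their base points. -/

open Matrix

/-- The member `∑ zₖ Aₖ` of the net of quadrics spanned by `A 0, A 1, A 2`. -/
def netMember {R : Type*} [CommRing R] (A : Fin 3 → Matrix (Fin 4) (Fin 4) R) (z : Fin 3 → R) :
    Matrix (Fin 4) (Fin 4) R :=
  ∑ k, z k • A k

/-- `u` represents a base point of the net of quadrics `A`. -/
structure IsBasePoint (A : Fin 3 → Matrix (Fin 4) (Fin 4) ℂ) (u : Fin 4 → ℂ) : Prop where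
  ne_zero : u ≠ 0
  isotropic : ∀ k, u ⬝ᵥ A k *ᵥ u = 0

/-- A complex net of quadrics whose discriminant curve is smooth, expressed through the kernels
of the singular members. -/
structure IsSmoothNet (A : Fin 3 → Matrix (Fin 4) (Fin 4) ℂ) : Prop where
  isSymm : ∀ k, (A k).IsSymm
  smooth : ∀ z, z ≠ 0 → ∃ y, ∀ k, k ≠ 0 → netMember A z *ᵥ k = 0 → k ⬝ᵥ netMember A y *ᵥ k ≠ 0

theorem Matrix.IsSymm.dotProduct_mulVec_comm {R n : Type*} [CommRing R] [Fintype n]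
    {A : Matrix n n R} (hA : A.IsSymm) (u v : n → R) : u ⬝ᵥ A *ᵥ v = v ⬝ᵥ A *ᵥ u := by
  conv_lhs => rw [← hA.eq]
  rw [mulVec_transpose, dotProduct_comm, dotProduct_mulVec]

theorem netMember_mulVec {R : Type*} [CommRing R] (A : Fin 3 → Matrix (Fin 4) (Fin 4) R)
    (z : Fin 3 → R) (u : Fin 4 → R) : netMember A z *ᵥ u = ∑ k, z k • (A k *ᵥ u) := by
  simp [netMember, Matrix.sum_mulVec, Matrix.smul_mulVec]

theorem dotProduct_netMember_mulVec {R : Type*} [CommRing R]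
    (A : Fin 3 → Matrix (Fin 4) (Fin 4) R) (z : Fin 3 → R) (u v : Fin 4 → R) :
    u ⬝ᵥ netMember A z *ᵥ v = ∑ k, z k * (u ⬝ᵥ A k *ᵥ v) := by
  simp [netMember_mulVec, dotProduct_sum]

theorem netMember_isSymm {R : Type*} [CommRing R] {A : Fin 3 → Matrix (Fin 4) (Fin 4) R}
    (hA : ∀ k, (A k).IsSymm) (z : Fin 3 → R) : (netMember A z).IsSymm := by
  simp only [netMember, Matrix.IsSymm, Matrix.transpose_sum, Matrix.transpose_smul, fun k => (hA k).eq]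

theorem IsSmoothNet.netMember_mulVec_ne_zero {A : Fin 3 → Matrix (Fin 4) (Fin 4) ℂ}
    (hA : IsSmoothNet A) {u : Fin 4 → ℂ} (hu : IsBasePoint A u) {z : Fin 3 → ℂ} (hz : z ≠ 0) :
    netMember A z *ᵥ u ≠ 0 := by
  intro h
  obtain ⟨y, hy⟩ := hA.smooth z hz
  refine hy u hu.ne_zero h ?_
  simp [dotProduct_netMember_mulVec, hu.isotropic]

/-- The three quadrics of a smooth net meet transversally at a base point. -/
theorem IsSmoothNet.eq_smul_of_tangent {A : Fin 3 → Matrix (Fin 4) (Fin 4) ℂ}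
    (hA : IsSmoothNet A) {u : Fin 4 → ℂ} (hu : IsBasePoint A u) {w : Fin 4 → ℂ}
    (hw : ∀ k, u ⬝ᵥ A k *ᵥ w = 0) : ∃ c : ℂ, w = c • u := by
  let N : Matrix (Fin 3) (Fin 4) ℂ := Matrix.of fun k => A k *ᵥ u
  have hN : ∀ v, (∀ k, u ⬝ᵥ A k *ᵥ v = 0) → v ∈ LinearMap.ker N.mulVecLin := by
    intro v hv
    rw [LinearMap.mem_ker]
    ext k
    have := hv k
    rw [(hA.isSymm k).dotProduct_mulVec_comm, dotProduct_comm] at this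
    exact this
  -- A linear relation among the rows `A k *ᵥ u` would be a nonzero member with the base point `u`
  -- in its kernel.
  have hinj : Function.Injective Nᵀ.mulVecLin := by
    rw [← LinearMap.ker_eq_bot, LinearMap.ker_eq_bot']
    intro z hz
    by_contra hz0
    refine hA.netMember_mulVec_ne_zero hu hz0 ?_
    rw [← hz]
    ext j
    rw [netMember_mulVec, Finset.sum_apply]
    exact Finset.sum_congr rfl fun k _ => mul_comm _ _
  have hrank : N.rank = 3 := by
    rw [← Matrix.rank_transpose, Matrix.rank, LinearMap.finrank_range_of_inj hinj]
    simp
  have hker : Module.finrank ℂ (LinearMap.ker N.mulVecLin) = 1 := by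
    have := LinearMap.finrank_range_add_finrank_ker N.mulVecLin
    rw [Matrix.rank] at hrank
    simp only [Module.finrank_fintype_fun_eq_card, Fintype.card_fin] at this
    omega
  obtain ⟨c, hc⟩ := (finrank_eq_one_iff_of_nonzero' (⟨u, hN u hu.isotropic⟩ :
    LinearMap.ker N.mulVecLin) (by simpa using hu.ne_zero)).1 hker ⟨w, hN w hw⟩
  exact ⟨c, by simpa using (congrArg Subtype.val hc).symm⟩

theorem exists_quadratic_root (a b c : ℂ) (ha : a ≠ 0) : ∃ x, a * (x * x) + b * x + c = 0 := by
  obtain ⟨s, hs⟩ := IsAlgClosed.exists_pow_nat_eq (discrim a b c) (n := 2) (by norm_num)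
  exact exists_quadratic_eq_zero ha ⟨s, by rw [← hs]; ring⟩

/-- The singular members of a smooth net have corank one. -/
theorem IsSmoothNet.not_linearIndependent_ker {A : Fin 3 → Matrix (Fin 4) (Fin 4) ℂ}
    (hA : IsSmoothNet A) {z : Fin 3 → ℂ} (hz : z ≠ 0) {v w : Fin 4 → ℂ}
    (hv : netMember A z *ᵥ v = 0) (hw : netMember A z *ᵥ w = 0) :
    ¬ LinearIndependent ℂ ![v, w] := by
  intro hli
  rw [LinearIndependent.pair_iff] at hli
  obtain ⟨y, hy⟩ := hA.smooth z hz
  have hw0 : w ≠ 0 := fun h => by simpa using hli 0 1 (by simp [h])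
  -- A quadratic form on a two-dimensional kernel has a nontrivial zero. The leading coefficient is
  -- nonzero because `w` is itself a kernel vector.
  obtain ⟨x, hx⟩ := exists_quadratic_root (w ⬝ᵥ netMember A y *ᵥ w)
    (2 * (v ⬝ᵥ netMember A y *ᵥ w)) (v ⬝ᵥ netMember A y *ᵥ v) (hy w hw0 hw)
  refine hy (v + x • w) (fun h => by simpa using hli 1 x (by simpa using h)) ?_ ?_
  · rw [mulVec_add, mulVec_smul, hv, hw]; simp
  · have hs := (netMember_isSymm hA.isSymm y).dotProduct_mulVec_comm w v
    simp only [mulVec_add, mulVec_smul, dotProduct_add, add_dotProduct, smul_dotProduct,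
      dotProduct_smul, smul_eq_mul]
    rw [hs]
    linear_combination hx

/-- The form `uᵗ M(z) v` on the net is not identically zero for two distinct base points. -/
theorem IsSmoothNet.exists_pairing_ne_zero {A : Fin 3 → Matrix (Fin 4) (Fin 4) ℂ}
    (hA : IsSmoothNet A) {u v : Fin 4 → ℂ} (hu : IsBasePoint A u)
    (h : LinearIndependent ℂ ![u, v]) : ∃ k, u ⬝ᵥ A k *ᵥ v ≠ 0 := by
  by_contra! hk
  obtain ⟨c, hc⟩ := hA.eq_smul_of_tangent hu hk
  rw [LinearIndependent.pair_iff] at h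
  simpa using h c (-1) (by simp [hc])

end

/-! ### Algebra for intersecting a net with a quadric cone. -/

noncomputable section

open Matrix

-- Applied to the values `μ` of the net at the vertex of the cone `z`: in the new basis `z, w, e` of
-- the net, `w` vanishes at the vertex and `e` does not. Complex conjugates make the determinant of
-- this basis equal to $-|z|^2|\mu|^2$.
open scoped ComplexOrder in
theorem exists_complementary_members {z μ : Fin 3 → ℂ} (hz : z ≠ 0) (hμ : μ ≠ 0)
    (hzμ : z ⬝ᵥ μ = 0) : ∃ w e : Fin 3 → ℂ, w ⬝ᵥ μ = 0 ∧ e ⬝ᵥ μ ≠ 0 ∧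
      ∀ x : Fin 3 → ℂ, z ⬝ᵥ x = 0 → w ⬝ᵥ x = 0 → e ⬝ᵥ x = 0 → x = 0 := by
  have hz' : z ⬝ᵥ star z ≠ 0 := fun h => hz (dotProduct_self_star_eq_zero.1 h)
  have hμ' : star μ ⬝ᵥ μ ≠ 0 := fun h => hμ (dotProduct_star_self_eq_zero.1 h)
  refine ⟨crossProduct (star z) μ, star μ, ?_, hμ', fun x h1 h2 h3 => ?_⟩
  · rw [dotProduct_comm, dot_cross_self]
  · have hdet : (Matrix.of ![z, crossProduct (star z) μ, star μ]).det =
        -((z ⬝ᵥ star z) * (star μ ⬝ᵥ μ)) := by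
      simp only [dotProduct, Fin.sum_univ_three] at hzμ
      simp [Matrix.det_fin_three, crossProduct, dotProduct, Fin.sum_univ_three]
      linear_combination (starRingEnd ℂ (z 0) * starRingEnd ℂ (μ 0) +
        starRingEnd ℂ (z 1) * starRingEnd ℂ (μ 1) + starRingEnd ℂ (z 2) * starRingEnd ℂ (μ 2)) * hzμ
    refine Matrix.eq_zero_of_mulVec_eq_zero (M := Matrix.of ![z, crossProduct (star z) μ, star μ])
      ?_ ?_
    · rw [hdet]
      exact neg_ne_zero.2 (mul_ne_zero hz' hμ')
    · ext i
      fin_cases i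
      · exact h1
      · exact h2
      · exact h3

theorem exists_root_sum_range (a : ℕ → ℂ) {n : ℕ} (hn : n ≠ 0) (ha : a n ≠ 0) :
    ∃ t : ℂ, ∑ i ∈ Finset.range (n + 1), a i * t ^ i = 0 := by
  let P : Polynomial ℂ := ∑ i ∈ Finset.range (n + 1), Polynomial.C (a i) * Polynomial.X ^ i
  have hc : P.coeff n = a n := by
    simp [P, Polynomial.coeff_X_pow]
  have hd : P.degree ≠ 0 := by
    intro h
    have := Polynomial.coeff_eq_zero_of_degree_lt (p := P) (n := n) (by
      rw [h]; exact_mod_cast Nat.pos_of_ne_zero hn)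
    exact ha (hc ▸ this)
  obtain ⟨t, ht⟩ := IsAlgClosed.exists_root P hd
  refine ⟨t, ?_⟩
  simpa [P, Polynomial.IsRoot, Polynomial.eval_finsetSum] using ht

/-- The resultant, as an octic in `t`, of the quadratic `c r² + 2 B r + C` and the linear
polynomial `2 E r + H` in `r`, where `B`, `E` are quadratic and `C`, `H` are quartic in `t`. -/
theorem exists_octic (c : ℂ) (B E C H : ℕ → ℂ) : ∃ a : ℕ → ℂ,
    (∀ t : ℂ, ∑ i ∈ Finset.range 9, a i * t ^ i =
      c * (∑ i ∈ Finset.range 5, H i * t ^ i) ^ 2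
      - 4 * (∑ i ∈ Finset.range 3, B i * t ^ i) * (∑ i ∈ Finset.range 3, E i * t ^ i)
        * (∑ i ∈ Finset.range 5, H i * t ^ i)
      + 4 * (∑ i ∈ Finset.range 5, C i * t ^ i) * (∑ i ∈ Finset.range 3, E i * t ^ i) ^ 2) ∧
    a 0 = c * H 0 ^ 2 - 4 * B 0 * E 0 * H 0 + 4 * C 0 * E 0 ^ 2 ∧
    a 1 = 2 * c * H 0 * H 1 - 4 * (B 1 * E 0 * H 0 + B 0 * E 1 * H 0 + B 0 * E 0 * H 1)
      + 4 * C 1 * E 0 ^ 2 + 8 * C 0 * E 0 * E 1 ∧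
    a 8 = c * H 4 ^ 2 - 4 * B 2 * E 2 * H 4 + 4 * C 4 * E 2 ^ 2 := by
  let P (a : ℕ → ℂ) (n : ℕ) : Polynomial ℂ :=
    ∑ i ∈ Finset.range n, Polynomial.C (a i) * Polynomial.X ^ i
  let R : Polynomial ℂ := Polynomial.C c * P H 5 ^ 2 - 4 * P B 3 * P E 3 * P H 5
    + 4 * P C 5 * P E 3 ^ 2
  have hR : R.natDegree < 9 := by
    rw [Nat.lt_succ_iff]
    simp only [R, P, Finset.sum_range_succ, Finset.sum_range_zero, zero_add]
    compute_degree
  have hev : ∀ t, R.eval t = c * (∑ i ∈ Finset.range 5, H i * t ^ i) ^ 2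
      - 4 * (∑ i ∈ Finset.range 3, B i * t ^ i) * (∑ i ∈ Finset.range 3, E i * t ^ i)
        * (∑ i ∈ Finset.range 5, H i * t ^ i)
      + 4 * (∑ i ∈ Finset.range 5, C i * t ^ i) * (∑ i ∈ Finset.range 3, E i * t ^ i) ^ 2 := by
    intro t
    simp [R, P, Polynomial.eval_finsetSum]
  -- Coefficients 0 and 8 are the values at $t=0$ and $t=\infty$; coefficient 1 tests whether a root
  -- at $t=0$ is simple.
  refine ⟨R.coeff, fun t => ?_, ?_, ?_, ?_⟩
  · rw [← hev, Polynomial.eval_eq_sum_range' hR]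
  · rw [Polynomial.coeff_zero_eq_eval_zero, hev]
    simp [Finset.sum_range_succ]
  · have : R.coeff 1 = R.derivative.eval 0 := by
      rw [← Polynomial.coeff_zero_eq_eval_zero, Polynomial.coeff_derivative]; simp
    rw [this]
    simp [R, P, Finset.sum_range_succ, Polynomial.derivative_pow]
    ring
  · simp only [R, P, Finset.sum_range_succ, Finset.sum_range_zero, zero_add]
    compute_degree
    all_goals norm_num

end

/-! ### Two base points on the rulings of a cone. -/

noncomputable section

open Matrix

set_option linter.unusedSimpArgs false

/-- A member `B` of the net `A` of corank one with vertex `f`, on which the conic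
`s² p + s t q + t² p'` lies, together with two members `G`, `K` which span the net together
with `B`, where `K` vanishes at the vertex. -/
structure IsConeFrame (A : Fin 3 → Matrix (Fin 4) (Fin 4) ℂ) (B G K : Matrix (Fin 4) (Fin 4) ℂ)
    (p q p' f : Fin 4 → ℂ) : Prop where
  symm_B : B.IsSymm
  symm_G : G.IsSymm
  symm_K : K.IsSymm
  span : ∀ u v, u ⬝ᵥ B *ᵥ v = 0 → u ⬝ᵥ G *ᵥ v = 0 → u ⬝ᵥ K *ᵥ v = 0 → ∀ k, u ⬝ᵥ A k *ᵥ v = 0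
  G_base : ∀ u, IsBasePoint A u → u ⬝ᵥ G *ᵥ u = 0
  K_base : ∀ u, IsBasePoint A u → u ⬝ᵥ K *ᵥ u = 0
  B_f : B *ᵥ f = 0
  G_f : f ⬝ᵥ G *ᵥ f ≠ 0
  K_f : f ⬝ᵥ K *ᵥ f = 0
  p_p : p ⬝ᵥ B *ᵥ p = 0
  p'_p' : p' ⬝ᵥ B *ᵥ p' = 0
  p_q : p ⬝ᵥ B *ᵥ q = 0
  q_p' : q ⬝ᵥ B *ᵥ p' = 0
  q_q : q ⬝ᵥ B *ᵥ q + 2 * (p ⬝ᵥ B *ᵥ p') = 0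
  indep : ∀ a b c d : ℂ, a • p + b • q + c • p' + d • f = 0 → a = 0 ∧ b = 0 ∧ c = 0 ∧ d = 0

/-- The resultant form which decides whether the line joining `φ` to the vertex `f` contains a
base point. -/
def rulingResultant (G K : Matrix (Fin 4) (Fin 4) ℂ) (f φ : Fin 4 → ℂ) : ℂ :=
  (f ⬝ᵥ G *ᵥ f) * (φ ⬝ᵥ K *ᵥ φ) ^ 2 - 4 * (φ ⬝ᵥ G *ᵥ f) * (φ ⬝ᵥ K *ᵥ f) * (φ ⬝ᵥ K *ᵥ φ)
      + 4 * (φ ⬝ᵥ G *ᵥ φ) * (φ ⬝ᵥ K *ᵥ f) ^ 2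

theorem quadratic_expand {S : Matrix (Fin 4) (Fin 4) ℂ} (hS : S.IsSymm) (p q p' : Fin 4 → ℂ) (t : ℂ) :
    (p + t • q + t ^ 2 • p') ⬝ᵥ S *ᵥ (p + t • q + t ^ 2 • p') =
      p ⬝ᵥ S *ᵥ p + 2 * (p ⬝ᵥ S *ᵥ q) * t + (q ⬝ᵥ S *ᵥ q + 2 * (p ⬝ᵥ S *ᵥ p')) * t ^ 2
        + 2 * (q ⬝ᵥ S *ᵥ p') * t ^ 3 + p' ⬝ᵥ S *ᵥ p' * t ^ 4 := by
  simp only [mulVec_add, mulVec_smul, dotProduct_add, add_dotProduct, smul_dotProduct,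
      dotProduct_smul, smul_eq_mul, hS.dotProduct_mulVec_comm q p, hS.dotProduct_mulVec_comm p' p,
      hS.dotProduct_mulVec_comm p' q]
  ring

namespace IsConeFrame

variable {A : Fin 3 → Matrix (Fin 4) (Fin 4) ℂ} {B G K : Matrix (Fin 4) (Fin 4) ℂ}
    {p q p' f : Fin 4 → ℂ}

/-- The reparametrization $t\mapsto 1/t$ of the conic, which carries results at $t=0$ over to
$t=\infty$. -/
theorem swap (h : IsConeFrame A B G K p q p' f) : IsConeFrame A B G K p' q p f where
  symm_B := h.symm_B
  symm_G := h.symm_G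
  symm_K := h.symm_K
  span := h.span
  G_base := h.G_base
  K_base := h.K_base
  B_f := h.B_f
  G_f := h.G_f
  K_f := h.K_f
  p_p := h.p'_p'
  p'_p' := h.p_p
  p_q := by rw [h.symm_B.dotProduct_mulVec_comm]; exact h.q_p'
  q_p' := by rw [h.symm_B.dotProduct_mulVec_comm]; exact h.p_q
  q_q := by rw [h.symm_B.dotProduct_mulVec_comm p' p]; exact h.q_q
  indep a b c d e := by
    obtain ⟨h1, h2, h3, h4⟩ := h.indep c b a d (by rw [← e]; abel)
    exact ⟨h3, h2, h1, h4⟩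

theorem isotropic (h : IsConeFrame A B G K p q p' f) (t : ℂ) :
    (p + t • q + t ^ 2 • p') ⬝ᵥ B *ᵥ (p + t • q + t ^ 2 • p') = 0 := by
  rw [quadratic_expand h.symm_B, h.p_p, h.p'_p', h.p_q, h.q_p', h.q_q]
  ring

/-- A translation of the conic parameter, which moves the ruling at `t` to the ruling at 0. -/
theorem shift (h : IsConeFrame A B G K p q p' f) (t : ℂ) :
    IsConeFrame A B G K (p + t • q + t ^ 2 • p') (q + (2 * t) • p') p' f where
  symm_B := h.symm_B
  symm_G := h.symm_G
  symm_K := h.symm_K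
  span := h.span
  G_base := h.G_base
  K_base := h.K_base
  B_f := h.B_f
  G_f := h.G_f
  K_f := h.K_f
  p_p := h.isotropic t
  p'_p' := h.p'_p'
  p_q := by
    simp only [mulVec_add, mulVec_smul, dotProduct_add, add_dotProduct, smul_dotProduct,
      dotProduct_smul, smul_eq_mul, h.symm_B.dotProduct_mulVec_comm p' q, h.p_p, h.p'_p', h.p_q,
      h.q_p']
    linear_combination t * h.q_q
  q_p' := by
    simp only [mulVec_add, mulVec_smul, dotProduct_add, add_dotProduct, smul_dotProduct,
      dotProduct_smul, smul_eq_mul, h.p'_p', h.q_p']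
    ring
  q_q := by
    simp only [mulVec_add, mulVec_smul, dotProduct_add, add_dotProduct, smul_dotProduct,
      dotProduct_smul, smul_eq_mul, h.symm_B.dotProduct_mulVec_comm p' q, h.p_p, h.p'_p', h.p_q,
      h.q_p']
    linear_combination h.q_q
  indep a b c d e := by
    obtain ⟨h1, h2, h3, h4⟩ := h.indep a (a * t + b) (a * t ^ 2 + b * (2 * t) + c) d (by
      rw [← e]; module)
    subst h1
    have : b = 0 := by linear_combination h2
    subst this
    exact ⟨rfl, rfl, by linear_combination h3, h4⟩

/-- On a ruling `B` vanishes identically, and `K` is only linear in `r` because it vanishes at the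
vertex. -/
theorem isBasePoint_iff (h : IsConeFrame A B G K p q p' f) (r : ℂ) :
    IsBasePoint A (p + r • f) ↔
      (f ⬝ᵥ G *ᵥ f) * (r * r) + 2 * (p ⬝ᵥ G *ᵥ f) * r + p ⬝ᵥ G *ᵥ p = 0 ∧
        2 * (p ⬝ᵥ K *ᵥ f) * r + p ⬝ᵥ K *ᵥ p = 0 := by
  have hfB : f ⬝ᵥ B *ᵥ p = 0 := by
    rw [h.symm_B.dotProduct_mulVec_comm, h.B_f, dotProduct_zero]
  have hG : (p + r • f) ⬝ᵥ G *ᵥ (p + r • f) =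
      (f ⬝ᵥ G *ᵥ f) * (r * r) + 2 * (p ⬝ᵥ G *ᵥ f) * r + p ⬝ᵥ G *ᵥ p := by
    simp only [mulVec_add, mulVec_smul, dotProduct_add, add_dotProduct, smul_dotProduct,
      dotProduct_smul, smul_eq_mul, h.symm_G.dotProduct_mulVec_comm f p]
    ring
  have hK : (p + r • f) ⬝ᵥ K *ᵥ (p + r • f) = 2 * (p ⬝ᵥ K *ᵥ f) * r + p ⬝ᵥ K *ᵥ p := by
    simp only [mulVec_add, mulVec_smul, dotProduct_add, add_dotProduct, smul_dotProduct,
      dotProduct_smul, smul_eq_mul, h.symm_K.dotProduct_mulVec_comm f p, h.K_f]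
    ring
  refine ⟨fun hu => ⟨hG ▸ h.G_base _ hu, hK ▸ h.K_base _ hu⟩, fun ⟨h1, h2⟩ => ⟨fun e => ?_,
    h.span _ _ ?_ (hG.trans h1) (hK.trans h2)⟩⟩
  · simpa using (h.indep 1 0 0 r (by rw [← e]; module)).1
  · simp only [mulVec_add, mulVec_smul, dotProduct_add, add_dotProduct, smul_dotProduct,
      dotProduct_smul, smul_eq_mul, h.B_f, dotProduct_zero, h.p_p, hfB]
    ring

theorem exists_basePoint (h : IsConeFrame A B G K p q p' f)
    (hR : rulingResultant G K f p = 0) : ∃ r : ℂ, IsBasePoint A (p + r • f) := by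
  rw [rulingResultant] at hR
  by_cases hE : p ⬝ᵥ K *ᵥ f = 0
  · have hH : p ⬝ᵥ K *ᵥ p = 0 := by
      have : (f ⬝ᵥ G *ᵥ f) * (p ⬝ᵥ K *ᵥ p) ^ 2 = 0 := by
        rw [hE] at hR
        linear_combination hR
      simpa [h.G_f] using this
    obtain ⟨r, hr⟩ := exists_quadratic_root (f ⬝ᵥ G *ᵥ f) (2 * (p ⬝ᵥ G *ᵥ f)) (p ⬝ᵥ G *ᵥ p) h.G_f
    exact ⟨r, (h.isBasePoint_iff r).2 ⟨hr, by rw [hE, hH]; ring⟩⟩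
  · refine ⟨-(p ⬝ᵥ K *ᵥ p) / (2 * (p ⬝ᵥ K *ᵥ f)), (h.isBasePoint_iff _).2 ⟨?_, ?_⟩⟩
    · field_simp
      linear_combination hR
    · field_simp
      ring

theorem exists_resultant_coeff (h : IsConeFrame A B G K p q p' f) : ∃ a : ℕ → ℂ,
    (∀ t : ℂ, rulingResultant G K f (p + t • q + t ^ 2 • p') = ∑ i ∈ Finset.range 9, a i * t ^ i) ∧
    a 0 = rulingResultant G K f p ∧ a 8 = rulingResultant G K f p' ∧
    a 1 = 4 * (f ⬝ᵥ G *ᵥ f) * (p ⬝ᵥ K *ᵥ p) * (p ⬝ᵥ K *ᵥ q) - 4 * ((q ⬝ᵥ G *ᵥ f) * (p ⬝ᵥ K *ᵥ f)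
      * (p ⬝ᵥ K *ᵥ p) + (p ⬝ᵥ G *ᵥ f) * (q ⬝ᵥ K *ᵥ f) * (p ⬝ᵥ K *ᵥ p)
      + 2 * (p ⬝ᵥ G *ᵥ f) * (p ⬝ᵥ K *ᵥ f) * (p ⬝ᵥ K *ᵥ q))
      + 8 * (p ⬝ᵥ G *ᵥ q) * (p ⬝ᵥ K *ᵥ f) ^ 2
      + 8 * (p ⬝ᵥ G *ᵥ p) * (p ⬝ᵥ K *ᵥ f) * (q ⬝ᵥ K *ᵥ f) := by
  let L (S : Matrix (Fin 4) (Fin 4) ℂ) : ℕ → ℂ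
    | 0 => p ⬝ᵥ S *ᵥ f
    | 1 => q ⬝ᵥ S *ᵥ f
    | _ => p' ⬝ᵥ S *ᵥ f
  let N (S : Matrix (Fin 4) (Fin 4) ℂ) : ℕ → ℂ
    | 0 => p ⬝ᵥ S *ᵥ p
    | 1 => 2 * (p ⬝ᵥ S *ᵥ q)
    | 2 => q ⬝ᵥ S *ᵥ q + 2 * (p ⬝ᵥ S *ᵥ p')
    | 3 => 2 * (q ⬝ᵥ S *ᵥ p')
    | _ => p' ⬝ᵥ S *ᵥ p'
  obtain ⟨a, ha, h0, h1, h8⟩ := exists_octic (f ⬝ᵥ G *ᵥ f) (L G) (L K) (N G) (N K)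
  refine ⟨a, fun t => ?_, ?_, ?_, ?_⟩
  · have hL : ∀ S : Matrix (Fin 4) (Fin 4) ℂ, (p + t • q + t ^ 2 • p') ⬝ᵥ S *ᵥ f =
        ∑ i ∈ Finset.range 3, L S i * t ^ i := by
      intro S
      simp only [add_dotProduct, smul_dotProduct, smul_eq_mul, Finset.sum_range_succ,
        Finset.sum_range_zero, L]
      ring
    have hN : ∀ S : Matrix (Fin 4) (Fin 4) ℂ, S.IsSymm →
        (p + t • q + t ^ 2 • p') ⬝ᵥ S *ᵥ (p + t • q + t ^ 2 • p') =
        ∑ i ∈ Finset.range 5, N S i * t ^ i := by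
      intro S hS
      rw [quadratic_expand hS]
      simp only [Finset.sum_range_succ, Finset.sum_range_zero, N]
      ring
    rw [ha, rulingResultant, hL, hL, hN _ h.symm_G, hN _ h.symm_K]
  · rw [h0]; simp only [L, N, rulingResultant]
  · rw [h8]; simp only [L, N, rulingResultant]
  · rw [h1]; simp only [L, N]; ring

theorem linearIndependent_pair (h : IsConeFrame A B G K p q p' f) {r s a b c : ℂ}
    (hne : b ≠ 0 ∨ c ≠ 0 ∨ s ≠ a * r) :
    LinearIndependent ℂ ![p + r • f, a • p + b • q + c • p' + s • f] := by
  rw [LinearIndependent.pair_iff]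
  intro x y e
  obtain ⟨h1, h2, h3, h4⟩ := h.indep (x + y * a) (y * b) (y * c) (x * r + y * s) (by
    rw [← e]; module)
  have hy : y = 0 := by
    by_contra hy
    have hb0 : b = 0 := by simpa [hy] using h2
    have hc0 : c = 0 := by simpa [hy] using h3
    have : y * (s - a * r) = 0 := by linear_combination h4 - r * h1
    rcases hne with h | h | h
    · exact h hb0
    · exact h hc0
    · exact h (by simpa [hy, sub_eq_zero] using this)
  subst hy
  exact ⟨by simpa using h1, rfl⟩

/-- Either `K` vanishes on the whole ruling, which then carries two base points cut out by `G`, or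
the root $t=0$ of the octic is simple and another root gives a base point on a different ruling.
Transversality supplies distinctness in both cases. -/
theorem exists_two_of_root (h : IsConeFrame A B G K p q p' f) (hA : IsSmoothNet A)
    (hR : rulingResultant G K f p = 0) : ∃ u v, IsBasePoint A u ∧ IsBasePoint A v ∧
      LinearIndependent ℂ ![u, v] := by
  have tangent : ∀ {r b s : ℂ}, IsBasePoint A (p + r • f) → (b ≠ 0 ∨ s ≠ 0) →
      (p + r • f) ⬝ᵥ B *ᵥ (b • q + s • f) = 0 → (p + r • f) ⬝ᵥ G *ᵥ (b • q + s • f) = 0 →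
      (p + r • f) ⬝ᵥ K *ᵥ (b • q + s • f) = 0 → False := by
    intro r b s hu hbs h1 h2 h3
    obtain ⟨c, hc⟩ := hA.eq_smul_of_tangent hu (h.span _ _ h1 h2 h3)
    obtain ⟨e1, e2, e3, e4⟩ := h.indep (-c) b 0 (s - c * r) (by
      have : (-c) • p + b • q + (0 : ℂ) • p' + (s - c * r) • f
        = (b • q + s • f) - c • (p + r • f) := by module
      rw [this, hc, sub_self])
    have hc0 : c = 0 := by simpa using e1
    subst hc0
    rcases hbs with hb | hs
    · exact hb e2
    · exact hs (by simpa using e4)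
  have hfB : ∀ x, f ⬝ᵥ B *ᵥ x = 0 := fun x => by
    rw [h.symm_B.dotProduct_mulVec_comm, h.B_f, dotProduct_zero]
  obtain ⟨r, hu⟩ := h.exists_basePoint hR
  obtain ⟨hGu, hKu⟩ := (h.isBasePoint_iff r).1 hu
  by_cases hE : p ⬝ᵥ K *ᵥ f = 0
  · have hH : p ⬝ᵥ K *ᵥ p = 0 := by rw [hE] at hKu; simpa using hKu
    have hr : f ⬝ᵥ G *ᵥ f * r + p ⬝ᵥ G *ᵥ f ≠ 0 := by
      intro hr
      refine tangent (b := 0) (s := 1) hu (Or.inr one_ne_zero) ?_ ?_ ?_ <;>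
      simp only [mulVec_add, mulVec_smul, dotProduct_add, add_dotProduct, smul_dotProduct,
        dotProduct_smul, smul_eq_mul, h.B_f, dotProduct_zero, h.K_f, hE]
      · simp [hfB]
      · linear_combination hr
      · ring
    have hc := h.G_f
    -- The other root of the quadratic by Vieta. A double root would make the ruling direction `f`
    -- tangent to all three quadrics, contrary to `hr`.
    refine ⟨_, p + (-r - 2 * (p ⬝ᵥ G *ᵥ f) / (f ⬝ᵥ G *ᵥ f)) • f, hu,
      (h.isBasePoint_iff _).2 ⟨?_, ?_⟩, ?_⟩
    · field_simp
      linear_combination (f ⬝ᵥ G *ᵥ f) * hGu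
    · rw [hE, hH]; ring
    · have := h.linearIndependent_pair (r := r) (a := 1) (b := 0) (c := 0)
        (s := -r - 2 * (p ⬝ᵥ G *ᵥ f) / (f ⬝ᵥ G *ᵥ f)) (Or.inr (Or.inr fun e => hr (by
          field_simp at e
          linear_combination (-1 / 2) * e)))
      simpa using this
  · obtain ⟨a, ha, h0, h8, h1⟩ := h.exists_resultant_coeff
    -- If $t=0$ were a multiple root, then `q + ρ • f` would be tangent to all three quadrics at the
    -- base point; `ρ` is chosen to make it tangent to `K`.
    have ha1 : a 1 ≠ 0 := by
      intro h1'
      rw [h1'] at h1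
      obtain ⟨ρ, hρ⟩ : ∃ ρ, (p ⬝ᵥ K *ᵥ f) * ρ + (q ⬝ᵥ K *ᵥ f) * r + p ⬝ᵥ K *ᵥ q = 0 :=
        ⟨-((q ⬝ᵥ K *ᵥ f) * r + p ⬝ᵥ K *ᵥ q) / (p ⬝ᵥ K *ᵥ f), by field_simp; ring⟩
      refine tangent (b := 1) (s := ρ) hu (Or.inl one_ne_zero) ?_ ?_ ?_ <;>
      simp only [mulVec_add, mulVec_smul, dotProduct_add, add_dotProduct, smul_dotProduct,
        dotProduct_smul, smul_eq_mul, h.B_f, dotProduct_zero, h.K_f, h.p_q, hfB,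
        h.symm_G.dotProduct_mulVec_comm f q, h.symm_K.dotProduct_mulVec_comm f q]
      · ring
      · refine (mul_eq_zero.1 (?_ : (8 * (p ⬝ᵥ K *ᵥ f) ^ 2) * _ = 0)).resolve_left
          (mul_ne_zero (by norm_num) (pow_ne_zero 2 hE))
        linear_combination -h1 - (4 * (f ⬝ᵥ G *ᵥ f) * (p ⬝ᵥ K *ᵥ q)
          - 4 * (q ⬝ᵥ G *ᵥ f) * (p ⬝ᵥ K *ᵥ f) - 4 * (p ⬝ᵥ G *ᵥ f) * (q ⬝ᵥ K *ᵥ f)) * hKu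
          + 8 * ((f ⬝ᵥ G *ᵥ f) * (p ⬝ᵥ K *ᵥ f) * r + (p ⬝ᵥ G *ᵥ f) * (p ⬝ᵥ K *ᵥ f)) * hρ
          - 8 * (p ⬝ᵥ K *ᵥ f) * (q ⬝ᵥ K *ᵥ f) * hGu
      · linear_combination hρ
    by_cases ha8 : a 8 = 0
    · obtain ⟨r', hr'⟩ := h.swap.exists_basePoint (h8 ▸ ha8)
      have := h.linearIndependent_pair (r := r) (s := r') (a := 0) (b := 0) (c := 1)
        (Or.inr (Or.inl one_ne_zero))
      exact ⟨_, _, hu, hr', by simpa using this⟩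
    -- The octic divided by $t$ has degree 7 and constant term `a 1`, so its roots are nonzero.
    · obtain ⟨t, ht⟩ := exists_root_sum_range (fun i => a (i + 1)) (n := 7) (by norm_num) ha8
      have ht0 : t ≠ 0 := by
        rintro rfl
        simp [Finset.sum_range_succ] at ht
        exact ha1 ht
      obtain ⟨s, hs⟩ := (h.shift t).exists_basePoint (by
        rw [ha, Finset.sum_range_succ']
        simp only [pow_succ, ← mul_assoc, ← Finset.sum_mul]
        rw [ht, h0, hR]; simp)
      have := h.linearIndependent_pair (r := r) (s := s) (a := 1) (b := t) (c := t ^ 2)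
        (Or.inl ht0)
      exact ⟨_, _, hu, hs, by simpa using this⟩

theorem exists_two (h : IsConeFrame A B G K p q p' f) (hA : IsSmoothNet A) :
    ∃ u v, IsBasePoint A u ∧ IsBasePoint A v ∧ LinearIndependent ℂ ![u, v] := by
  obtain ⟨a, ha, h0, h8, -⟩ := h.exists_resultant_coeff
  by_cases ha8 : a 8 = 0
  · exact h.swap.exists_two_of_root hA (h8 ▸ ha8)
  · obtain ⟨t, ht⟩ := exists_root_sum_range a (n := 8) (by norm_num) ha8
    exact (h.shift t).exists_two_of_root hA (by rw [ha, ht])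

end IsConeFrame

end

/-! ### Diagonalizing a singular member; existence of two base points. -/

noncomputable section

open Matrix

set_option linter.unusedSimpArgs false

theorem Matrix.IsSymm.exists_orthogonal_basis {B : Matrix (Fin 4) (Fin 4) ℂ} (hB : B.IsSymm) :
    ∃ v : Module.Basis (Fin 4) ℂ (Fin 4 → ℂ), ∀ i j, i ≠ j → v i ⬝ᵥ B *ᵥ v j = 0 := by
  have hs : LinearMap.IsSymm (Matrix.toBilin' B) := ⟨fun x y => by
    simp only [Matrix.toBilin'_apply', RingHom.id_apply]
    exact hB.dotProduct_mulVec_comm x y⟩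
  obtain ⟨v, hv⟩ := LinearMap.BilinForm.exists_orthogonal_basis hs
  refine ⟨v.reindex (finCongr (by simp)), fun i j hij => ?_⟩
  have := hv (i := (finCongr (by simp) : Fin _ ≃ Fin 4).symm i)
    (j := (finCongr (by simp) : Fin _ ≃ Fin 4).symm j) (by simpa using hij)
  simpa [Matrix.toBilin'_apply'] using this

/-- A symmetric matrix of corank one has the form `x₀² + x₁² + x₂²` in suitable coordinates. -/
theorem exists_corank_one_frame {B : Matrix (Fin 4) (Fin 4) ℂ} (hB : B.IsSymm) (hdet : B.det = 0)
    (hker : ∀ v w, B *ᵥ v = 0 → B *ᵥ w = 0 → ¬ LinearIndependent ℂ ![v, w]) :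
    ∃ e : Fin 4 → Fin 4 → ℂ, LinearIndependent ℂ e ∧ (∀ i j, i ≠ j → e i ⬝ᵥ B *ᵥ e j = 0) ∧
      e 0 ⬝ᵥ B *ᵥ e 0 = 1 ∧ e 1 ⬝ᵥ B *ᵥ e 1 = 1 ∧ e 2 ⬝ᵥ B *ᵥ e 2 = 1 ∧ B *ᵥ e 3 = 0 := by
  obtain ⟨v, hv⟩ := hB.exists_orthogonal_basis
  have hz : ∀ x, (∀ i, v i ⬝ᵥ x = 0) → x = 0 := by
    intro x hx
    refine dotProduct_eq_zero x fun w => ?_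
    rw [dotProduct_comm, ← v.sum_repr w, sum_dotProduct]
    exact Finset.sum_eq_zero fun i _ => by rw [smul_dotProduct, hx, smul_zero]
  have hd : ∀ i, v i ⬝ᵥ B *ᵥ v i = 0 → B *ᵥ v i = 0 := by
    intro i hi
    refine hz _ fun j => ?_
    by_cases hij : j = i
    · rw [hij, hi]
    · exact hv _ _ hij
  obtain ⟨i₀, hi₀⟩ : ∃ i, v i ⬝ᵥ B *ᵥ v i = 0 := by
    by_contra! hne
    obtain ⟨k, hk, hBk⟩ := Matrix.exists_mulVec_eq_zero_iff.2 hdet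
    refine hk ?_
    rw [← v.sum_repr k]
    refine Finset.sum_eq_zero fun j _ => ?_
    have h1 : v j ⬝ᵥ B *ᵥ k = 0 := by rw [hBk, dotProduct_zero]
    rw [← v.sum_repr k, Matrix.mulVec_sum, dotProduct_sum, Finset.sum_eq_single j] at h1
    · rw [mulVec_smul, dotProduct_smul, smul_eq_mul] at h1
      rw [(mul_eq_zero.1 h1).resolve_right (hne j), zero_smul]
    · intro i _ hij
      rw [mulVec_smul, dotProduct_smul, hv _ _ hij.symm, smul_zero]
    · simp
  have hne : ∀ i, i ≠ i₀ → v i ⬝ᵥ B *ᵥ v i ≠ 0 := by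
    intro i hi h
    refine hker _ _ (hd i h) (hd i₀ hi₀) ?_
    have := v.linearIndependent.comp ![i, i₀] (by
      intro a b; fin_cases a <;> fin_cases b <;> simp [hi, hi.symm])
    convert this using 1
    ext a; fin_cases a <;> rfl
  let σ := Equiv.swap i₀ 3
  have hσ3 : σ 3 = i₀ := Equiv.swap_apply_right _ _
  have hσ : ∀ i, i ≠ 3 → v (σ i) ⬝ᵥ B *ᵥ v (σ i) ≠ 0 := fun i hi => hne _ fun h =>
    hi (σ.injective (h.trans hσ3.symm))
  have hs : ∀ i, ∃ s : ℂˣ, i ≠ 3 → (s : ℂ) ^ 2 * (v (σ i) ⬝ᵥ B *ᵥ v (σ i)) = 1 := by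
    intro i
    by_cases hi : i = 3
    · exact ⟨1, fun h => absurd hi h⟩
    · obtain ⟨s, hs⟩ := IsAlgClosed.exists_pow_nat_eq (v (σ i) ⬝ᵥ B *ᵥ v (σ i))⁻¹
        (n := 2) (by norm_num)
      have hs' := inv_ne_zero (hσ i hi)
      rw [← hs] at hs'
      refine ⟨Units.mk0 s (fun h => hs' (by rw [h]; norm_num)), fun _ => ?_⟩
      rw [Units.val_mk0, hs, inv_mul_cancel₀ (hσ i hi)]
  choose s hs using hs
  have hsq : ∀ i, i ≠ 3 → ((s i : ℂ) • v (σ i)) ⬝ᵥ B *ᵥ ((s i : ℂ) • v (σ i)) = 1 := by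
    intro i hi
    rw [← hs i hi, mulVec_smul, smul_dotProduct, dotProduct_smul, smul_eq_mul, smul_eq_mul]
    ring
  refine ⟨fun i => (s i : ℂ) • v (σ i), ?_, ?_, hsq 0 (by decide), hsq 1 (by decide),
    hsq 2 (by decide), ?_⟩
  · exact (v.linearIndependent.comp σ σ.injective).units_smul s
  · intro i j hij
    rw [mulVec_smul, smul_dotProduct, dotProduct_smul, hv _ _ (fun h => hij (σ.injective h))]
    simp
  · rw [mulVec_smul, hσ3, hd _ hi₀, smul_zero]

theorem IsSmoothNet.exists_two_basePoints {A : Fin 3 → Matrix (Fin 4) (Fin 4) ℂ}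
    (hA : IsSmoothNet A) {z : Fin 3 → ℂ} (hz : z ≠ 0) (hdet : (netMember A z).det = 0) :
    ∃ u v, IsBasePoint A u ∧ IsBasePoint A v ∧ LinearIndependent ℂ ![u, v] := by
  obtain ⟨e, hli, hort, h0, h1, h2, h3⟩ := exists_corank_one_frame
    (netMember_isSymm hA.isSymm z) hdet fun v w => hA.not_linearIndependent_ker hz
  obtain ⟨y, hy⟩ := hA.smooth z hz
  have hye := hy (e 3) (hli.ne_zero 3) h3
  obtain ⟨w, g, hw, hg, hspan⟩ := exists_complementary_members (μ := fun k => e 3 ⬝ᵥ A k *ᵥ e 3) hz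
    (fun h => hye (by
      rw [dotProduct_netMember_mulVec]
      exact Finset.sum_eq_zero fun k _ => by rw [congrFun h k]; simp))
    (by
      have : e 3 ⬝ᵥ netMember A z *ᵥ e 3 = 0 := by rw [h3, dotProduct_zero]
      rwa [dotProduct_netMember_mulVec] at this)
  -- The conic is $(1-t^2)e_0+2te_1+i(1+t^2)e_2$, the rational parametrization of
  -- $x_0^2+x_1^2+x_2^2=0$.
  have hf : IsConeFrame A (netMember A z) (netMember A g) (netMember A w)
      (e 0 + Complex.I • e 2) ((2 : ℂ) • e 1) (-e 0 + Complex.I • e 2) (e 3) := by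
    constructor
    · exact netMember_isSymm hA.isSymm z
    · exact netMember_isSymm hA.isSymm g
    · exact netMember_isSymm hA.isSymm w
    · intro u v h1 h2 h3 k
      rw [dotProduct_netMember_mulVec] at h1 h2 h3
      exact congrFun (hspan (fun k => u ⬝ᵥ A k *ᵥ v) h1 h3 h2) k
    · intro u hu
      simp [dotProduct_netMember_mulVec, hu.isotropic]
    · intro u hu
      simp [dotProduct_netMember_mulVec, hu.isotropic]
    · exact h3
    · rwa [dotProduct_netMember_mulVec]
    · rwa [dotProduct_netMember_mulVec]
    iterate 5
      simp only [mulVec_add, mulVec_smul, mulVec_neg, dotProduct_add, add_dotProduct,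
        smul_dotProduct, neg_dotProduct, dotProduct_neg, dotProduct_smul, smul_eq_mul, h0, h1, h2,
        hort 0 1 (by decide), hort 0 2 (by decide), hort 1 0 (by decide), hort 1 2 (by decide),
        hort 2 0 (by decide), hort 2 1 (by decide)]
      ring_nf
      try simp
    · intro a b c d h
      rw [Fintype.linearIndependent_iff] at hli
      have hc := hli ![a - c, 2 * b, (a + c) * Complex.I, d] (by
        rw [← h, Fin.sum_univ_four]
        simp only [cons_val]
        module)
      have c0 : a - c = 0 := hc 0
      have c1 : 2 * b = 0 := hc 1
      have c2 : (a + c) * Complex.I = 0 := hc 2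
      have c3 : d = 0 := hc 3
      have c2' : a + c = 0 := by simpa using c2
      refine ⟨?_, by simpa using c1, ?_, c3⟩
      · linear_combination (c0 + c2') / 2
      · linear_combination (c2' - c0) / 2
  exact hf.exists_two hA

end

/-! ### Four distinct base points are linearly independent. -/

noncomputable section

open Matrix

set_option linter.unusedSimpArgs false

theorem exists_dotProduct_pair_eq_zero {K : Type*} [Field K] (a b : Fin 3 → K) :
    ∃ z : Fin 3 → K, z ≠ 0 ∧ a ⬝ᵥ z = 0 ∧ b ⬝ᵥ z = 0 := by
  obtain ⟨z, hz, h⟩ := Matrix.exists_mulVec_eq_zero_iff.2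
    (Matrix.det_eq_zero_of_row_eq_zero (A := Matrix.of ![a, b, 0]) 2 fun j => rfl)
  exact ⟨z, hz, congrFun h 0, congrFun h 1⟩

/-- No nonzero member of a smooth net vanishes identically on the span of three independent
vectors. -/
theorem IsSmoothNet.false_of_isotropic_three {A : Fin 3 → Matrix (Fin 4) (Fin 4) ℂ}
    (hA : IsSmoothNet A) {z : Fin 3 → ℂ} (hz : z ≠ 0) {u : Fin 3 → Fin 4 → ℂ}
    (hu : LinearIndependent ℂ u) (h : ∀ i j, u i ⬝ᵥ netMember A z *ᵥ u j = 0) : False := by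
  let U : Matrix (Fin 3) (Fin 4) ℂ := Matrix.of u
  have hrank : U.rank = 3 := by
    have : LinearIndependent ℂ U.row := hu
    simpa using this.rank_matrix
  have hker : Module.finrank ℂ (LinearMap.ker U.mulVecLin) ≤ 1 := by
    have := LinearMap.finrank_range_add_finrank_ker U.mulVecLin
    rw [Matrix.rank] at hrank
    simp only [Module.finrank_fintype_fun_eq_card, Fintype.card_fin] at this
    omega
  obtain ⟨y, hy⟩ := finrank_le_one_iff.1 hker
  -- The member maps the span of `u` into its orthogonal complement, which is a line. Its kernel on
  -- the span therefore has dimension at least two, against corank one.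
  have hs : ∀ j, ∃ s : ℂ, netMember A z *ᵥ u j = s • (y : Fin 4 → ℂ) := by
    intro j
    obtain ⟨s, hs⟩ := hy ⟨netMember A z *ᵥ u j, by
      rw [LinearMap.mem_ker]
      ext i
      exact h i j⟩
    exact ⟨s, (congrArg Subtype.val hs).symm⟩
  choose s hs using hs
  rw [Fintype.linearIndependent_iff] at hu
  have hu' : ∀ a b c : ℂ, a • u 0 + b • u 1 + c • u 2 = 0 → a = 0 ∧ b = 0 ∧ c = 0 := by
    intro a b c e
    have := hu ![a, b, c] (by rw [← e, Fin.sum_univ_three]; rfl)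
    exact ⟨this 0, this 1, this 2⟩
  have hk : ∀ a b c : ℂ, a * s 0 + b * s 1 + c * s 2 = 0 →
      netMember A z *ᵥ (a • u 0 + b • u 1 + c • u 2) = 0 := by
    intro a b c e
    simp only [mulVec_add, mulVec_smul, hs]
    rw [← zero_smul ℂ (y : Fin 4 → ℂ), ← e]
    module
  by_cases h0 : s 0 = 0
  · by_cases h1 : s 1 = 0
    · refine hA.not_linearIndependent_ker hz (hk 1 0 0 (by simp [h0])) (hk 0 1 0 (by simp [h1])) ?_
      rw [LinearIndependent.pair_iff]
      intro x y e
      obtain ⟨e0, e1, -⟩ := hu' x y 0 (by rw [← e]; module)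
      exact ⟨e0, e1⟩
    · refine hA.not_linearIndependent_ker hz (hk 1 0 0 (by simp [h0]))
        (hk 0 (s 2) (-s 1) (by ring)) ?_
      rw [LinearIndependent.pair_iff]
      intro x y e
      obtain ⟨e0, -, e2⟩ := hu' x (y * s 2) (y * -s 1) (by rw [← e]; module)
      exact ⟨e0, by simpa [h1] using e2⟩
  · refine hA.not_linearIndependent_ker hz (hk (s 1) (-s 0) 0 (by ring))
      (hk (s 2) 0 (-s 0) (by ring)) ?_
    rw [LinearIndependent.pair_iff]
    intro x y e
    obtain ⟨-, e1, e2⟩ := hu' (x * s 1 + y * s 2) (x * -s 0) (y * -s 0) (by rw [← e]; module)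
    exact ⟨by simpa [h0] using e1, by simpa [h0] using e2⟩

/-- Four distinct base points of a smooth net are not coplanar. -/
theorem IsSmoothNet.linearIndependent_basePoints {A : Fin 3 → Matrix (Fin 4) (Fin 4) ℂ}
    (hA : IsSmoothNet A) {O : Fin 4 → Fin 4 → ℂ} (hO : ∀ i, IsBasePoint A (O i))
    (hpair : ∀ i j, i ≠ j → LinearIndependent ℂ ![O i, O j]) : LinearIndependent ℂ O := by
  have hrel : ∀ c : Fin 4 → ℂ, ∑ i, c i • O i = 0 → ∀ j k, ∑ i, c j * c i * (O j ⬝ᵥ A k *ᵥ O i) = 0 := by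
    intro c hc j k
    have : O j ⬝ᵥ A k *ᵥ ∑ i, c i • O i = 0 := by rw [hc, mulVec_zero, dotProduct_zero]
    rw [mulVec_sum, dotProduct_sum] at this
    rw [← mul_zero (c j), ← this, Finset.mul_sum]
    refine Finset.sum_congr rfl fun i _ => ?_
    rw [mulVec_smul, dotProduct_smul, smul_eq_mul, mul_assoc]
  -- The four equations from `hrel`, solved for the six products: those attached to complementary
  -- pairs of indices agree.
  have hsix : ∀ c : Fin 4 → ℂ, ∑ i, c i • O i = 0 → ∀ k,
      c 0 * c 1 * (O 0 ⬝ᵥ A k *ᵥ O 1) = c 2 * c 3 * (O 2 ⬝ᵥ A k *ᵥ O 3) ∧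
      c 0 * c 2 * (O 0 ⬝ᵥ A k *ᵥ O 2) = c 1 * c 3 * (O 1 ⬝ᵥ A k *ᵥ O 3) ∧
      c 0 * c 3 * (O 0 ⬝ᵥ A k *ᵥ O 3) = c 1 * c 2 * (O 1 ⬝ᵥ A k *ᵥ O 2) ∧
      c 0 * c 1 * (O 0 ⬝ᵥ A k *ᵥ O 1) + c 0 * c 2 * (O 0 ⬝ᵥ A k *ᵥ O 2)
        + c 0 * c 3 * (O 0 ⬝ᵥ A k *ᵥ O 3) = 0 := by
    intro c hc k
    have h0 := hrel c hc 0 k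
    have h1 := hrel c hc 1 k
    have h2 := hrel c hc 2 k
    have h3 := hrel c hc 3 k
    simp only [Fin.sum_univ_four, (hO _).isotropic k,
      (hA.isSymm k).dotProduct_mulVec_comm (O 1) (O 0),
      (hA.isSymm k).dotProduct_mulVec_comm (O 2) (O 0),
      (hA.isSymm k).dotProduct_mulVec_comm (O 2) (O 1),
      (hA.isSymm k).dotProduct_mulVec_comm (O 3) (O 0),
      (hA.isSymm k).dotProduct_mulVec_comm (O 3) (O 1),
      (hA.isSymm k).dotProduct_mulVec_comm (O 3) (O 2)] at h0 h1 h2 h3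
    refine ⟨?_, ?_, ?_, ?_⟩
    · linear_combination (h0 + h1 - h2 - h3) / 2
    · linear_combination (h0 + h2 - h1 - h3) / 2
    · linear_combination (h0 + h3 - h1 - h2) / 2
    · linear_combination h0
  have hdeg : ∀ c : Fin 4 → ℂ, ∑ i, c i • O i = 0 → ∀ i, c i = 0 → c = 0 := by
    intro c hc i hi
    -- Each splitting of the four indices into two pairs has a pair containing `i`, so $c_i=0$ kills
    -- all six products. Then at most one coefficient is nonzero, hence none.
    have hall : ∀ k, c 0 * c 1 * (O 0 ⬝ᵥ A k *ᵥ O 1) = 0 ∧ c 0 * c 2 * (O 0 ⬝ᵥ A k *ᵥ O 2) = 0 ∧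
        c 0 * c 3 * (O 0 ⬝ᵥ A k *ᵥ O 3) = 0 := by
      intro k
      obtain ⟨h1, h2, h3, h4⟩ := hsix c hc k
      fin_cases i <;> simp only [Fin.zero_eta, Fin.mk_one, Fin.reduceFinMk, Fin.isValue] at hi <;>
        rw [hi] at h1 h2 h3 h4 ⊢ <;> clear hi
      · refine ⟨?_, ?_, ?_⟩ <;> ring
      all_goals
        exact ⟨by first | ring1 | linear_combination h1, by first | ring1 | linear_combination h2,
          by first | ring1 | linear_combination h3⟩
    have hprod : ∀ i j, i ≠ j → (∀ k, c i * c j * (O i ⬝ᵥ A k *ᵥ O j) = 0) → c i * c j = 0 := by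
      intro i j hij h
      obtain ⟨k, hk⟩ := hA.exists_pairing_ne_zero (hO i) (hpair i j hij)
      exact (mul_eq_zero.1 (h k)).resolve_right hk
    have p01 := hprod 0 1 (by decide) fun k => (hall k).1
    have p02 := hprod 0 2 (by decide) fun k => (hall k).2.1
    have p03 := hprod 0 3 (by decide) fun k => (hall k).2.2
    have p23 := hprod 2 3 (by decide) fun k => (hsix c hc k).1 ▸ (hall k).1
    have p13 := hprod 1 3 (by decide) fun k => (hsix c hc k).2.1 ▸ (hall k).2.1
    have p12 := hprod 1 2 (by decide) fun k => (hsix c hc k).2.2.1 ▸ (hall k).2.2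
    by_contra hne
    obtain ⟨j, hj⟩ := Function.ne_iff.1 hne
    have hp : ∀ i j, i ≠ j → c i * c j = 0 := by
      intro i j hij
      fin_cases i <;> fin_cases j <;>
        first | exact absurd rfl hij | assumption | (rw [mul_comm]; assumption)
    have hother : ∀ i, i ≠ j → c i = 0 := fun i hij =>
      (mul_eq_zero.1 (hp i j hij)).resolve_right hj
    rw [Finset.sum_eq_single j (fun i _ hij => by rw [hother i hij, zero_smul]) (by simp)] at hc
    exact (hO j).ne_zero ((smul_eq_zero.1 hc).resolve_left hj)
  rw [Fintype.linearIndependent_iff]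
  intro c hc
  by_contra! hne
  have hc0 : ∀ i, c i ≠ 0 := fun i hi => by
    obtain ⟨j, hj⟩ := hne
    exact hj (congrFun (hdeg c hc i hi) j)
  -- Two linear conditions leave a nonzero `z`. The relation makes the pairing of `O 1` and `O 2`
  -- vanish as well, so this member vanishes on the span of three base points.
  obtain ⟨z, hz, h01, h02⟩ := exists_dotProduct_pair_eq_zero
    (fun k => O 0 ⬝ᵥ A k *ᵥ O 1) (fun k => O 0 ⬝ᵥ A k *ᵥ O 2)
  have h12 : ∑ k, z k * (O 1 ⬝ᵥ A k *ᵥ O 2) = 0 := by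
    refine (mul_eq_zero.1 (?_ : (c 1 * c 2) * _ = 0)).resolve_left (mul_ne_zero (hc0 1) (hc0 2))
    have hk : ∀ k, c 1 * c 2 * (O 1 ⬝ᵥ A k *ᵥ O 2) =
        -(c 0 * c 1 * (O 0 ⬝ᵥ A k *ᵥ O 1)) - c 0 * c 2 * (O 0 ⬝ᵥ A k *ᵥ O 2) := by
      intro k
      obtain ⟨-, -, h3, h4⟩ := hsix c hc k
      linear_combination h4 - h3
    rw [dotProduct, Fin.sum_univ_three] at h01 h02
    rw [Fin.sum_univ_three]
    linear_combination z 0 * hk 0 + z 1 * hk 1 + z 2 * hk 2 - c 0 * c 1 * h01 - c 0 * c 2 * h02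
  refine hA.false_of_isotropic_three hz (u := ![O 0, O 1, O 2]) ?_ ?_
  · rw [Fintype.linearIndependent_iff]
    intro d hd
    have := hdeg ![d 0, d 1, d 2, 0] (by
      rw [← hd, Fin.sum_univ_three, Fin.sum_univ_four]; simp) 3 rfl
    intro i
    fin_cases i
    · exact congrFun this 0
    · exact congrFun this 1
    · exact congrFun this 2
  · have g01 : O 0 ⬝ᵥ netMember A z *ᵥ O 1 = 0 := by
      rw [dotProduct_netMember_mulVec, ← h01, dotProduct]
      exact Finset.sum_congr rfl fun _ _ => mul_comm _ _
    have g02 : O 0 ⬝ᵥ netMember A z *ᵥ O 2 = 0 := by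
      rw [dotProduct_netMember_mulVec, ← h02, dotProduct]
      exact Finset.sum_congr rfl fun _ _ => mul_comm _ _
    have g12 : O 1 ⬝ᵥ netMember A z *ᵥ O 2 = 0 := by
      rw [dotProduct_netMember_mulVec, h12]
    have gii : ∀ i, O i ⬝ᵥ netMember A z *ᵥ O i = 0 := fun i => by
      simp [dotProduct_netMember_mulVec, (hO i).isotropic]
    have hs := netMember_isSymm hA.isSymm z
    intro i j
    fin_cases i <;> fin_cases j <;>
      simp only [Fin.zero_eta, Fin.mk_one, Fin.reduceFinMk, cons_val, gii, g01, g02, g12]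
    · rw [hs.dotProduct_mulVec_comm, g01]
    · rw [hs.dotProduct_mulVec_comm, g02]
    · rw [hs.dotProduct_mulVec_comm, g12]

end

/-! ### Intersecting two lines with a circle. -/

noncomputable section

/-- The resultant of the system `2 (x₁ p₁ + x₂ p₂) + n₁ = 0`, `2 (x₁ q₁ + x₂ q₂) + n₂ = 0`,
`x₁² + x₂² + n₀ = 0`. -/
def circleResultant {K : Type*} [CommRing K] (p₁ p₂ q₁ q₂ n₀ n₁ n₂ : K) : K :=
  (n₂ * p₂ - n₁ * q₂) ^ 2 + (n₁ * q₁ - n₂ * p₁) ^ 2 + 4 * n₀ * (p₁ * q₂ - p₂ * q₁) ^ 2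

/-- The solution is the multiple of $p$ lying on the line plus $s$ times the perpendicular vector
$(-p_2,p_1)$; the circle prescribes $s^2$. -/
theorem exists_line_inter_circle {p₁ p₂ : ℂ} (n₀ n₁ : ℂ) (h : p₁ ^ 2 + p₂ ^ 2 ≠ 0) :
    ∃ x₁ x₂ : ℂ, 2 * (x₁ * p₁ + x₂ * p₂) + n₁ = 0 ∧ x₁ ^ 2 + x₂ ^ 2 + n₀ = 0 := by
  obtain ⟨s, hs⟩ := IsAlgClosed.exists_pow_nat_eq
    ((-n₀ - n₁ ^ 2 / (4 * (p₁ ^ 2 + p₂ ^ 2))) / (p₁ ^ 2 + p₂ ^ 2)) (n := 2) (by norm_num)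
  refine ⟨-n₁ / (2 * (p₁ ^ 2 + p₂ ^ 2)) * p₁ - s * p₂, -n₁ / (2 * (p₁ ^ 2 + p₂ ^ 2)) * p₂ + s * p₁,
    ?_, ?_⟩
  · field_simp
    ring
  · have : s ^ 2 * (p₁ ^ 2 + p₂ ^ 2) + n₁ ^ 2 / (4 * (p₁ ^ 2 + p₂ ^ 2)) + n₀ = 0 := by
      rw [hs]
      field_simp
      ring
    rw [← this]
    field_simp
    ring

/-- With $q=\kappa p$ the resultant is $(n_2-\kappa n_1)^2(p_1^2+p_2^2)$, and `htr` excludes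
isotropic $p$. So the second equation is a multiple of the first. -/
theorem exists_common_zero_of_degenerate {p₁ p₂ q₁ q₂ n₀ n₁ n₂ : ℂ} (hp : p₁ ≠ 0 ∨ p₂ ≠ 0)
    (hD : p₁ * q₂ - p₂ * q₁ = 0) (hR : circleResultant p₁ p₂ q₁ q₂ n₀ n₁ n₂ = 0)
    (htr : ∀ ε : ℂ, ε ^ 2 = -1 → p₁ + ε * p₂ = 0 → q₁ + ε * q₂ = 0 → False) :
    ∃ x₁ x₂ : ℂ, 2 * (x₁ * p₁ + x₂ * p₂) + n₁ = 0 ∧ 2 * (x₁ * q₁ + x₂ * q₂) + n₂ = 0 ∧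
      x₁ ^ 2 + x₂ ^ 2 + n₀ = 0 := by
  obtain ⟨κ, h1, h2⟩ : ∃ κ, q₁ = κ * p₁ ∧ q₂ = κ * p₂ := by
    rcases hp with h | h
    · exact ⟨q₁ / p₁, by field_simp, by field_simp; linear_combination hD⟩
    · exact ⟨q₂ / p₂, by field_simp; linear_combination -hD, by field_simp⟩
  subst h1 h2
  have hpp : p₁ ^ 2 + p₂ ^ 2 ≠ 0 := by
    intro h
    have : (p₁ + Complex.I * p₂) * (p₁ + -Complex.I * p₂) = 0 := by
      linear_combination h - p₂ ^ 2 * Complex.I_sq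
    rcases mul_eq_zero.1 this with h | h
    · exact htr Complex.I (by simp) h (by linear_combination κ * h)
    · exact htr (-Complex.I) (by simp) h (by linear_combination κ * h)
  have hn : n₂ = κ * n₁ := by
    have : (n₂ - κ * n₁) ^ 2 * (p₁ ^ 2 + p₂ ^ 2) = 0 := by
      rw [← hR, circleResultant]; ring
    have := (mul_eq_zero.1 this).resolve_right hpp
    exact sub_eq_zero.1 (pow_eq_zero_iff two_ne_zero |>.1 this)
  obtain ⟨x₁, x₂, e1, e2⟩ := exists_line_inter_circle n₀ n₁ hpp
  exact ⟨x₁, x₂, e1, by rw [hn]; linear_combination κ * e1, e2⟩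

theorem exists_common_zero_of_circleResultant {p₁ p₂ q₁ q₂ n₀ n₁ n₂ : ℂ}
    (hR : circleResultant p₁ p₂ q₁ q₂ n₀ n₁ n₂ = 0)
    (htr : ∀ ε : ℂ, ε ^ 2 = -1 → p₁ + ε * p₂ = 0 → q₁ + ε * q₂ = 0 → False) :
    ∃ x₁ x₂ : ℂ, 2 * (x₁ * p₁ + x₂ * p₂) + n₁ = 0 ∧ 2 * (x₁ * q₁ + x₂ * q₂) + n₂ = 0 ∧
      x₁ ^ 2 + x₂ ^ 2 + n₀ = 0 := by
  by_cases hD : p₁ * q₂ - p₂ * q₁ = 0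
  · by_cases hp : p₁ ≠ 0 ∨ p₂ ≠ 0
    · exact exists_common_zero_of_degenerate hp hD hR htr
    · push Not at hp
      by_cases hq : q₁ ≠ 0 ∨ q₂ ≠ 0
      · obtain ⟨x₁, x₂, e1, e2, e3⟩ := exists_common_zero_of_degenerate (q₁ := p₁) (q₂ := p₂)
          (n₀ := n₀) (n₁ := n₂) (n₂ := n₁) hq (by linear_combination -hD)
          (by rw [← hR, circleResultant, circleResultant]; ring)
          (fun ε h1 h2 h3 => htr ε h1 h3 h2)
        exact ⟨x₁, x₂, e2, e1, e3⟩
      · push Not at hq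
        exact (htr Complex.I (by simp) (by simp [hp]) (by simp [hq])).elim
  · rw [circleResultant] at hR
    obtain ⟨D, hD'⟩ : ∃ D, D = p₁ * q₂ - p₂ * q₁ := ⟨_, rfl⟩
    rw [← hD'] at hD hR
    refine ⟨(n₂ * p₂ - n₁ * q₂) / (2 * D), (n₁ * q₁ - n₂ * p₁) / (2 * D), ?_, ?_, ?_⟩
    · field_simp
      rw [hD']; ring
    · field_simp
      rw [hD']; ring
    · field_simp
      linear_combination hR

/-- The resultant is $4D^2$ times the maximum over $(x,y)$ of the concave function in `hneg`. -/
theorem circleResultant_neg {p₁ p₂ q₁ q₂ n₀ n₁ n₂ : ℝ} (hD : p₁ * q₂ - p₂ * q₁ ≠ 0)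
    (hneg : ∀ x y : ℝ, n₀ + x * n₁ + y * n₂ - (x * p₁ + y * q₁) ^ 2 - (x * p₂ + y * q₂) ^ 2 < 0) :
    circleResultant p₁ p₂ q₁ q₂ n₀ n₁ n₂ < 0 := by
  set D := p₁ * q₂ - p₂ * q₁ with hDdef
  set X₁ := n₂ * p₂ - n₁ * q₂ with hX₁
  set X₂ := n₁ * q₁ - n₂ * p₁ with hX₂
  -- The critical point, where $xp+yq=-X/(2D)$.
  have h := hneg ((-X₁ * q₂ + X₂ * q₁) / (2 * D ^ 2)) ((X₁ * p₂ - X₂ * p₁) / (2 * D ^ 2))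
  have e1 : (-X₁ * q₂ + X₂ * q₁) / (2 * D ^ 2) * p₁ + (X₁ * p₂ - X₂ * p₁) / (2 * D ^ 2) * q₁
      = -X₁ / (2 * D) := by
    field_simp
    rw [hDdef]; ring
  have e2 : (-X₁ * q₂ + X₂ * q₁) / (2 * D ^ 2) * p₂ + (X₁ * p₂ - X₂ * p₁) / (2 * D ^ 2) * q₂
      = -X₂ / (2 * D) := by
    field_simp
    rw [hDdef]; ring
  have e3 : (-X₁ * q₂ + X₂ * q₁) / (2 * D ^ 2) * n₁ + (X₁ * p₂ - X₂ * p₁) / (2 * D ^ 2) * n₂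
      = (X₁ ^ 2 + X₂ ^ 2) / (2 * D ^ 2) := by
    field_simp
    rw [hX₁, hX₂]; ring
  rw [e1, e2] at h
  have h' : n₀ + (X₁ ^ 2 + X₂ ^ 2) / (2 * D ^ 2) - (-X₁ / (2 * D)) ^ 2 - (-X₂ / (2 * D)) ^ 2 < 0 := by
    linarith
  have hD2 : 0 < 4 * D ^ 2 := by positivity
  have : circleResultant p₁ p₂ q₁ q₂ n₀ n₁ n₂ = (4 * D ^ 2) *
      (n₀ + (X₁ ^ 2 + X₂ ^ 2) / (2 * D ^ 2) - (-X₁ / (2 * D)) ^ 2 - (-X₂ / (2 * D)) ^ 2) := by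
    rw [circleResultant, ← hDdef, ← hX₁, ← hX₂]
    field_simp
    ring
  rw [this]
  exact mul_neg_of_pos_of_neg hD2 h'

/-- If $Pv$ and $P'v$ were dependent for $v=(s,t)\neq0$, some nonzero real combination $xP+yP'$
would kill $v$ and be singular. -/
theorem pairing_det_ne_zero {a b c d a' b' c' d' s t : ℝ}
    (hdet : ∀ x y : ℝ, (x ≠ 0 ∨ y ≠ 0) →
      (x * a + y * a') * (x * d + y * d') - (x * b + y * b') * (x * c + y * c') ≠ 0)
    (hst : s ≠ 0 ∨ t ≠ 0) :
    (a * s + b * t) * (c' * s + d' * t) - (c * s + d * t) * (a' * s + b' * t) ≠ 0 := by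
  intro h
  have key : ∀ x y : ℝ, (x ≠ 0 ∨ y ≠ 0) → x * (a * s + b * t) + y * (a' * s + b' * t) = 0 →
      x * (c * s + d * t) + y * (c' * s + d' * t) = 0 → False := by
    intro x y hxy h1 h2
    refine hdet x y hxy ?_
    rcases hst with hs | ht
    · refine (mul_eq_zero.1 (?_ : s * _ = 0)).resolve_left hs
      linear_combination (x * d + y * d') * h1 - (x * b + y * b') * h2
    · refine (mul_eq_zero.1 (?_ : t * _ = 0)).resolve_left ht
      linear_combination (x * a + y * a') * h2 - (x * c + y * c') * h1
  by_cases h1 : a * s + b * t ≠ 0 ∨ a' * s + b' * t ≠ 0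
  · exact key (a' * s + b' * t) (-(a * s + b * t)) (by
      rcases h1 with h1 | h1
      · exact Or.inr (neg_ne_zero.2 h1)
      · exact Or.inl h1) (by ring) (by linear_combination -h)
  · push Not at h1
    by_cases h2 : c * s + d * t ≠ 0 ∨ c' * s + d' * t ≠ 0
    · exact key (c' * s + d' * t) (-(c * s + d * t)) (by
        rcases h2 with h2 | h2
        · exact Or.inr (neg_ne_zero.2 h2)
        · exact Or.inl h2) (by linear_combination h) (by ring)
    · push Not at h2
      exact key 1 0 (Or.inl one_ne_zero) (by simp [h1]) (by simp [h2])

/-- The circle resultant of a pencil of lines through a point is a sextic binary form. -/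
theorem exists_circleResultant_poly (a b c d a' b' c' d' n₀ m₀ r₀ n₁ m₁ r₁ n₂ m₂ r₂ : ℂ) :
    ∃ P : Polynomial ℂ, (∀ t, P.eval t = circleResultant (a + b * t) (c + d * t) (a' + b' * t)
      (c' + d' * t) (n₀ + 2 * m₀ * t + r₀ * t ^ 2) (n₁ + 2 * m₁ * t + r₁ * t ^ 2)
      (n₂ + 2 * m₂ * t + r₂ * t ^ 2)) ∧ P.coeff 6 = circleResultant b d b' d' r₀ r₁ r₂ := by
  let l (a b : ℂ) : Polynomial ℂ := Polynomial.C a + Polynomial.C b * Polynomial.X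
  let q (n m r : ℂ) : Polynomial ℂ := Polynomial.C n + Polynomial.C (2 * m) * Polynomial.X
    + Polynomial.C r * Polynomial.X ^ 2
  refine ⟨circleResultant (l a b) (l c d) (l a' b') (l c' d') (q n₀ m₀ r₀) (q n₁ m₁ r₁)
    (q n₂ m₂ r₂), fun t => ?_, ?_⟩
  · simp [circleResultant, l, q]
  · simp only [circleResultant, l, q]
    compute_degree
    all_goals norm_num

end

/-! ### Coordinate changes and nets with positive discriminant. -/

noncomputable section

open Matrix

set_option linter.unusedSimpArgs false

/-- The net in the coordinates given by the columns of `g`, with the basis of members given by the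
rows of `h`. -/
def transformNet {R : Type*} [CommRing R] (g : Matrix (Fin 4) (Fin 4) R)
    (h : Matrix (Fin 3) (Fin 3) R) (A : Fin 3 → Matrix (Fin 4) (Fin 4) R) :
    Fin 3 → Matrix (Fin 4) (Fin 4) R :=
  fun k => gᵀ * netMember A (h k) * g

theorem netMember_transformNet {R : Type*} [CommRing R] (g : Matrix (Fin 4) (Fin 4) R)
    (h : Matrix (Fin 3) (Fin 3) R) (A : Fin 3 → Matrix (Fin 4) (Fin 4) R) (z : Fin 3 → R) :
    netMember (transformNet g h A) z = gᵀ * netMember A (z ᵥ* h) * g := by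
  have : netMember A (z ᵥ* h) = ∑ k, z k • netMember A (h k) := by
    simp only [netMember, Finset.smul_sum, Matrix.vecMul, dotProduct, Finset.sum_smul, smul_smul]
    exact Finset.sum_comm
  rw [this, Matrix.mul_sum, Matrix.sum_mul]
  simp [netMember, transformNet]

theorem dotProduct_congruence_mulVec {R : Type*} [CommRing R] (g B : Matrix (Fin 4) (Fin 4) R)
    (u v : Fin 4 → R) : u ⬝ᵥ (gᵀ * B * g) *ᵥ v = (g *ᵥ u) ⬝ᵥ B *ᵥ (g *ᵥ v) := by
  rw [← mulVec_mulVec, ← mulVec_mulVec, mulVec_transpose, dotProduct_comm, ← dotProduct_mulVec,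
    dotProduct_comm]

theorem netMember_eq_sum_mulVec {R : Type*} [CommRing R] (A : Fin 3 → Matrix (Fin 4) (Fin 4) R)
    (h : Matrix (Fin 3) (Fin 3) R) (k : Fin 3) (u v : Fin 4 → R) :
    u ⬝ᵥ netMember A (h k) *ᵥ v = (h *ᵥ fun j => u ⬝ᵥ A j *ᵥ v) k := by
  rw [dotProduct_netMember_mulVec]; rfl

theorem IsBasePoint.of_transformNet {A : Fin 3 → Matrix (Fin 4) (Fin 4) ℂ}
    {g : Matrix (Fin 4) (Fin 4) ℂ} {h : Matrix (Fin 3) (Fin 3) ℂ} (hg : g.det ≠ 0) (hh : h.det ≠ 0)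
    {u : Fin 4 → ℂ} (hu : IsBasePoint (transformNet g h A) u) : IsBasePoint A (g *ᵥ u) := by
  refine ⟨fun h0 => hu.ne_zero (Matrix.eq_zero_of_mulVec_eq_zero hg h0), fun k => ?_⟩
  have : (fun j => (g *ᵥ u) ⬝ᵥ A j *ᵥ (g *ᵥ u)) = 0 := by
    refine Matrix.eq_zero_of_mulVec_eq_zero hh ?_
    ext k
    rw [← netMember_eq_sum_mulVec, ← dotProduct_congruence_mulVec]
    exact hu.isotropic k
  exact congrFun this k

theorem IsSmoothNet.transformNet {A : Fin 3 → Matrix (Fin 4) (Fin 4) ℂ} (hA : IsSmoothNet A)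
    {g : Matrix (Fin 4) (Fin 4) ℂ} {h : Matrix (Fin 3) (Fin 3) ℂ} (hg : g.det ≠ 0)
    (hh : h.det ≠ 0) : IsSmoothNet (transformNet g h A) := by
  refine ⟨fun k => ?_, fun z hz => ?_⟩
  · rw [_root_.transformNet, Matrix.IsSymm, transpose_mul, transpose_mul, transpose_transpose,
      (netMember_isSymm hA.isSymm _).eq, Matrix.mul_assoc]
  · obtain ⟨y, hy⟩ := hA.smooth (z ᵥ* h) fun h0 => hz (Matrix.eq_zero_of_vecMul_eq_zero hh h0)
    refine ⟨y ᵥ* h⁻¹, fun k hk hz => ?_⟩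
    rw [netMember_transformNet, dotProduct_congruence_mulVec, Matrix.vecMul_vecMul,
      Matrix.nonsing_inv_mul _ (isUnit_iff_ne_zero.2 hh), Matrix.vecMul_one]
    refine hy _ (fun h0 => hk (Matrix.eq_zero_of_mulVec_eq_zero hg h0)) ?_
    rw [netMember_transformNet, ← mulVec_mulVec, ← mulVec_mulVec] at hz
    exact Matrix.eq_zero_of_mulVec_eq_zero (by rwa [det_transpose]) hz

/-- The complexification of a real net. -/
def complexNet (A : Fin 3 → Matrix (Fin 4) (Fin 4) ℝ) : Fin 3 → Matrix (Fin 4) (Fin 4) ℂ :=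
  fun k => (A k).map Complex.ofRealHom

/-- A real net of quadrics with positive discriminant whose complexification is smooth. -/
structure IsPositiveNet (A : Fin 3 → Matrix (Fin 4) (Fin 4) ℝ) : Prop where
  isSymm : ∀ k, (A k).IsSymm
  smooth : IsSmoothNet (complexNet A)
  pos : ∀ a, a ≠ 0 → 0 < (netMember A a).det

theorem netMember_map {R S : Type*} [CommRing R] [CommRing S] (φ : R →+* S)
    (A : Fin 3 → Matrix (Fin 4) (Fin 4) R) (z : Fin 3 → R) :
    (netMember A z).map φ = netMember (fun k => (A k).map φ) (φ ∘ z) := by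
  ext i j
  simp [netMember, Matrix.sum_apply]

theorem complexNet_transformNet (g : Matrix (Fin 4) (Fin 4) ℝ) (h : Matrix (Fin 3) (Fin 3) ℝ)
    (A : Fin 3 → Matrix (Fin 4) (Fin 4) ℝ) : complexNet (transformNet g h A) =
      transformNet (g.map Complex.ofRealHom) (h.map Complex.ofRealHom) (complexNet A) := by
  funext k
  simp only [complexNet, transformNet, Matrix.map_mul, netMember_map, transpose_map]
  rfl

theorem det_map_ofReal_ne_zero {n : ℕ} {g : Matrix (Fin n) (Fin n) ℝ} (hg : g.det ≠ 0) :
    (g.map Complex.ofRealHom).det ≠ 0 := by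
  have := RingHom.map_det Complex.ofRealHom g
  rw [RingHom.mapMatrix_apply] at this
  rw [← this]
  exact Complex.ofReal_ne_zero.2 hg

theorem IsPositiveNet.transformNet {A : Fin 3 → Matrix (Fin 4) (Fin 4) ℝ} (hA : IsPositiveNet A)
    {g : Matrix (Fin 4) (Fin 4) ℝ} {h : Matrix (Fin 3) (Fin 3) ℝ} (hg : g.det ≠ 0)
    (hh : h.det ≠ 0) : IsPositiveNet (transformNet g h A) where
  isSymm k := by
    rw [_root_.transformNet, Matrix.IsSymm, transpose_mul, transpose_mul, transpose_transpose,
      (netMember_isSymm hA.isSymm _).eq, Matrix.mul_assoc]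
  smooth := by
    rw [complexNet_transformNet]
    exact hA.smooth.transformNet (det_map_ofReal_ne_zero hg) (det_map_ofReal_ne_zero hh)
  pos a ha := by
    rw [netMember_transformNet, det_mul, det_mul, det_transpose]
    have := hA.pos (a ᵥ* h) fun h0 => ha (Matrix.eq_zero_of_vecMul_eq_zero hh h0)
    have hg2 : 0 < g.det ^ 2 := by positivity
    nlinarith

open scoped MatrixOrder Matrix.Norms.L2Operator in
/-- A real symmetric matrix has a real eigenvalue relative to a positive definite one. -/
theorem Matrix.PosDef.exists_det_sub_smul_eq_zero {P S : Matrix (Fin 4) (Fin 4) ℝ} (hP : P.PosDef)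
    (hS : S.IsSymm) : ∃ s : ℝ, (S - s • P).det = 0 := by
  obtain ⟨B, hB, rfl⟩ := CStarAlgebra.isStrictlyPositive_iff_eq_star_mul_self.1 hP.isStrictlyPositive
  have hBd := (Matrix.isUnit_iff_isUnit_det _).1 hB
  -- Congruence by $B^{-1}$ turns `P` into the identity, so any eigenvalue of the transformed `S`
  -- serves.
  have hH : ((B⁻¹)ᵀ * S * B⁻¹).IsHermitian := by
    rw [Matrix.IsHermitian, conjTranspose_eq_transpose_of_trivial, transpose_mul, transpose_mul,
      transpose_transpose, hS.eq, Matrix.mul_assoc]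
  refine ⟨hH.eigenvalues 0, ?_⟩
  have h1 := hH.mulVec_eigenvectorBasis 0
  have h0 : (⇑(hH.eigenvectorBasis 0) : Fin 4 → ℝ) ≠ 0 := fun h =>
    hH.eigenvectorBasis.orthonormal.ne_zero 0 (by ext i; exact congrFun h i)
  have h2 : ((B⁻¹)ᵀ * (S - hH.eigenvalues 0 • (star B * B)) * B⁻¹).det = 0 := by
    refine Matrix.exists_mulVec_eq_zero_iff.1 ⟨_, h0, ?_⟩
    have : (B⁻¹)ᵀ * (star B * B) * B⁻¹ = 1 := by
      rw [Matrix.star_eq_conjTranspose, conjTranspose_eq_transpose_of_trivial, Matrix.mul_assoc,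
        Matrix.mul_assoc, Matrix.mul_nonsing_inv _ hBd, Matrix.mul_one, ← transpose_mul,
        Matrix.mul_nonsing_inv _ hBd, transpose_one]
    rw [Matrix.mul_sub, Matrix.sub_mul, Matrix.mul_smul, Matrix.smul_mul, this, sub_mulVec, h1,
      smul_mulVec, one_mulVec, sub_self]
  have hd := (Matrix.isUnit_nonsing_inv_det B hBd).ne_zero
  rw [det_mul, det_mul, det_transpose] at h2
  simpa [hBd.ne_zero] using h2

/-- A member of a net with positive discriminant is indefinite. -/
theorem IsPositiveNet.not_posDef {A : Fin 3 → Matrix (Fin 4) (Fin 4) ℝ} (hA : IsPositiveNet A)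
    (a : Fin 3 → ℝ) : ¬ (netMember A a).PosDef := by
  intro hP
  -- For `b` off the line of `a`, a relative eigenvalue gives a singular real member with nonzero
  -- parameter.
  obtain ⟨b, hb⟩ : ∃ b : Fin 3 → ℝ, ∀ s : ℝ, b - s • a ≠ 0 := by
    by_cases h0 : a 0 = 0
    · exact ⟨![1, 0, 0], fun s h => by simpa [h0] using congrFun h 0⟩
    · refine ⟨![0, 1, 0], fun s h => ?_⟩
      have h1 : s = 0 := by simpa [h0] using congrFun h 0
      simpa [h1] using congrFun h 1
  obtain ⟨s, hs⟩ := hP.exists_det_sub_smul_eq_zero (netMember_isSymm hA.isSymm b)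
  have : netMember A (b - s • a) = netMember A b - s • netMember A a := by
    simp [netMember, sub_smul, Finset.sum_sub_distrib, Finset.smul_sum, smul_smul]
  exact (hA.pos _ (hb s)).ne' (this ▸ hs)

theorem exists_linearIndependent_four {K : Type*} [Field K] {x y : Fin 4 → K}
    (h : LinearIndependent K ![x, y]) : ∃ v w, LinearIndependent K ![x, y, v, w] := by
  obtain ⟨v, hv⟩ := exists_linearIndependent_snoc_of_lt_finrank h (by simp)
  obtain ⟨w, hw⟩ := exists_linearIndependent_snoc_of_lt_finrank hv (by simp)
  have : ![x, y, v, w] = Fin.snoc (Fin.snoc ![x, y] v : Fin 3 → Fin 4 → K) w := by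
    ext i j
    fin_cases i <;> rfl
  exact ⟨v, w, this ▸ hw⟩

theorem exists_det_ne_zero_mulVec_eq_single {K : Type*} [Field K] {β : Fin 3 → K} (hβ : β ≠ 0) :
    ∃ h : Matrix (Fin 3) (Fin 3) K, h.det ≠ 0 ∧ h *ᵥ β = Pi.single 0 1 := by
  have h1 : LinearIndependent K ![β] := linearIndependent_unique_iff.2 hβ
  obtain ⟨v, hv⟩ := exists_linearIndependent_snoc_of_lt_finrank h1 (by simp)
  obtain ⟨w, hw⟩ := exists_linearIndependent_snoc_of_lt_finrank hv (by simp)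
  let P : Matrix (Fin 3) (Fin 3) K := (Matrix.of (Fin.snoc (Fin.snoc ![β] v : Fin 2 → _) w : Fin 3 → Fin 3 → K))ᵀ
  have hP : IsUnit P := linearIndependent_cols_iff_isUnit.1 hw
  have hPd := (Matrix.isUnit_iff_isUnit_det _).1 hP
  have hPβ : P *ᵥ Pi.single 0 1 = β := by
    rw [Matrix.mulVec_single_one]
    rfl
  refine ⟨P⁻¹, (Matrix.isUnit_nonsing_inv_det P hPd).ne_zero, ?_⟩
  rw [← hPβ, mulVec_mulVec, Matrix.nonsing_inv_mul _ hPd, one_mulVec]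

end

/-! ### Normal form of a net along a line. -/

noncomputable section

open Matrix

set_option linter.unusedSimpArgs false

/-- Coordinates adapted to a line on which all members of the net are proportional to a fixed
nondegenerate form. -/
theorem exists_normal_form {A : Fin 3 → Matrix (Fin 4) (Fin 4) ℝ} (hA : ∀ k, (A k).IsSymm)
    {x y : Fin 4 → ℝ} (hli : LinearIndependent ℝ ![x, y]) {β : Fin 3 → ℝ} (hβ : β ≠ 0)
    {i₀ i₁ i₂ : ℝ} (hi₀ : i₀ ^ 2 + i₁ ^ 2 = 1) (hi₁ : i₁ * (i₀ + i₂) = 0)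
    (hi₂ : i₂ ^ 2 + i₁ ^ 2 = 1) (hxx : ∀ k, x ⬝ᵥ A k *ᵥ x = i₀ * β k)
    (hxy : ∀ k, x ⬝ᵥ A k *ᵥ y = i₁ * β k) (hyy : ∀ k, y ⬝ᵥ A k *ᵥ y = i₂ * β k) :
    ∃ (g : Matrix (Fin 4) (Fin 4) ℝ) (h : Matrix (Fin 3) (Fin 3) ℝ)
      (a b c d a' b' c' d' n₀ m₀ r₀ n₁ m₁ r₁ n₂ m₂ r₂ : ℝ), g.det ≠ 0 ∧ h.det ≠ 0 ∧
      g.col 0 = x ∧ g.col 1 = y ∧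
      transformNet g h A = ![!![i₀, i₁, 0, 0; i₁, i₂, 0, 0; 0, 0, n₀, m₀; 0, 0, m₀, r₀],
        !![0, 0, a, b; 0, 0, c, d; a, c, n₁, m₁; b, d, m₁, r₁],
        !![0, 0, a', b'; 0, 0, c', d'; a', c', n₂, m₂; b', d', m₂, r₂]] := by
  obtain ⟨h, hh, hhβ⟩ := exists_det_ne_zero_mulVec_eq_single hβ
  obtain ⟨v, w, hli4⟩ := exists_linearIndependent_four hli
  let S := netMember A (h 0)
  have hS : S.IsSymm := netMember_isSymm hA _
  have hblock : ∀ u v : Fin 4 → ℝ, ∀ i : ℝ, (∀ k, u ⬝ᵥ A k *ᵥ v = i * β k) →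
      ∀ k, u ⬝ᵥ netMember A (h k) *ᵥ v = i * (Pi.single 0 1 : Fin 3 → ℝ) k := by
    intro u v i huv k
    rw [netMember_eq_sum_mulVec]
    have : (fun j => u ⬝ᵥ A j *ᵥ v) = i • β := funext huv
    rw [this, mulVec_smul, hhβ]
    rfl
  have hbxx := hblock x x i₀ hxx
  have hbxy := hblock x y i₁ hxy
  have hbyy := hblock y y i₂ hyy
  have hSxx : x ⬝ᵥ S *ᵥ x = i₀ := by simpa using hbxx 0
  have hSxy : x ⬝ᵥ S *ᵥ y = i₁ := by simpa using hbxy 0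
  have hSyy : y ⬝ᵥ S *ᵥ y = i₂ := by simpa using hbyy 0
  -- The conditions on `i₀ i₁ i₂` say that their symmetric $2\times2$ matrix is its own inverse, so
  -- `p v` and `q v` are the coefficients of the `S`-orthogonal projection of `v` to the line.
  let p (v : Fin 4 → ℝ) : ℝ := i₀ * (x ⬝ᵥ S *ᵥ v) + i₁ * (y ⬝ᵥ S *ᵥ v)
  let q (v : Fin 4 → ℝ) : ℝ := i₁ * (x ⬝ᵥ S *ᵥ v) + i₂ * (y ⬝ᵥ S *ᵥ v)
  have hxv : ∀ v, x ⬝ᵥ S *ᵥ (v - p v • x - q v • y) = 0 := by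
    intro v
    simp only [mulVec_sub, mulVec_smul, dotProduct_sub, dotProduct_smul, smul_eq_mul, hSxx, hSxy, p, q]
    linear_combination -(x ⬝ᵥ S *ᵥ v) * hi₀ - (y ⬝ᵥ S *ᵥ v) * hi₁
  have hyv : ∀ v, y ⬝ᵥ S *ᵥ (v - p v • x - q v • y) = 0 := by
    intro v
    simp only [mulVec_sub, mulVec_smul, dotProduct_sub, dotProduct_smul, smul_eq_mul, hSyy,
      hS.dotProduct_mulVec_comm y x, hSxy, p, q]
    linear_combination -(y ⬝ᵥ S *ᵥ v) * hi₂ - (x ⬝ᵥ S *ᵥ v) * hi₁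
  let E : Fin 4 → Fin 4 → ℝ := ![x, y, v - p v • x - q v • y, w - p w • x - q w • y]
  have hE : LinearIndependent ℝ E := by
    rw [Fintype.linearIndependent_iff] at hli4 ⊢
    intro c hc
    have := hli4 ![c 0 - c 2 * p v - c 3 * p w, c 1 - c 2 * q v - c 3 * q w, c 2, c 3] (by
      rw [← hc, Fin.sum_univ_four, Fin.sum_univ_four]
      simp only [E, cons_val]
      module)
    have e0 : c 0 - c 2 * p v - c 3 * p w = 0 := this 0
    have e1 : c 1 - c 2 * q v - c 3 * q w = 0 := this 1
    have e2 : c 2 = 0 := this 2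
    have e3 : c 3 = 0 := this 3
    rw [e2, e3] at e0 e1
    intro i
    fin_cases i
    · simpa using e0
    · simpa using e1
    · exact e2
    · exact e3
  let g : Matrix (Fin 4) (Fin 4) ℝ := (Matrix.of E)ᵀ
  have hg : g.det ≠ 0 := by
    have : IsUnit g := linearIndependent_cols_iff_isUnit.1 hE
    exact ((Matrix.isUnit_iff_isUnit_det _).1 this).ne_zero
  have hent : ∀ k i j, transformNet g h A k i j = E i ⬝ᵥ netMember A (h k) *ᵥ E j := by
    intro k i j
    have := dotProduct_congruence_mulVec g (netMember A (h k)) (Pi.single i 1) (Pi.single j 1)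
    rw [mulVec_single_one, mulVec_single_one, mulVec_single_one, single_one_dotProduct] at this
    exact this
  have hsymm : ∀ k i j, E i ⬝ᵥ netMember A (h k) *ᵥ E j = E j ⬝ᵥ netMember A (h k) *ᵥ E i :=
    fun k i j => (netMember_isSymm hA _).dotProduct_mulVec_comm _ _
  refine ⟨g, h, E 0 ⬝ᵥ netMember A (h 1) *ᵥ E 2, E 0 ⬝ᵥ netMember A (h 1) *ᵥ E 3,
    E 1 ⬝ᵥ netMember A (h 1) *ᵥ E 2, E 1 ⬝ᵥ netMember A (h 1) *ᵥ E 3,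
    E 0 ⬝ᵥ netMember A (h 2) *ᵥ E 2, E 0 ⬝ᵥ netMember A (h 2) *ᵥ E 3,
    E 1 ⬝ᵥ netMember A (h 2) *ᵥ E 2, E 1 ⬝ᵥ netMember A (h 2) *ᵥ E 3,
    E 2 ⬝ᵥ netMember A (h 0) *ᵥ E 2, E 2 ⬝ᵥ netMember A (h 0) *ᵥ E 3,
    E 3 ⬝ᵥ netMember A (h 0) *ᵥ E 3,
    E 2 ⬝ᵥ netMember A (h 1) *ᵥ E 2, E 2 ⬝ᵥ netMember A (h 1) *ᵥ E 3,
    E 3 ⬝ᵥ netMember A (h 1) *ᵥ E 3,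
    E 2 ⬝ᵥ netMember A (h 2) *ᵥ E 2, E 2 ⬝ᵥ netMember A (h 2) *ᵥ E 3,
    E 3 ⬝ᵥ netMember A (h 2) *ᵥ E 3, hg, hh, rfl, rfl, ?_⟩
  have t00 : ∀ k, E 0 ⬝ᵥ netMember A (h k) *ᵥ E 0 = i₀ * (Pi.single 0 1 : Fin 3 → ℝ) k := hbxx
  have t01 : ∀ k, E 0 ⬝ᵥ netMember A (h k) *ᵥ E 1 = i₁ * (Pi.single 0 1 : Fin 3 → ℝ) k := hbxy
  have t11 : ∀ k, E 1 ⬝ᵥ netMember A (h k) *ᵥ E 1 = i₂ * (Pi.single 0 1 : Fin 3 → ℝ) k := hbyy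
  have t02 : E 0 ⬝ᵥ netMember A (h 0) *ᵥ E 2 = 0 := hxv v
  have t03 : E 0 ⬝ᵥ netMember A (h 0) *ᵥ E 3 = 0 := hxv w
  have t12 : E 1 ⬝ᵥ netMember A (h 0) *ᵥ E 2 = 0 := hyv v
  have t13 : E 1 ⬝ᵥ netMember A (h 0) *ᵥ E 3 = 0 := hyv w
  funext k
  ext i j
  rw [hent]
  clear_value E
  fin_cases k <;> fin_cases i <;> fin_cases j <;>
    simp [t00, t01, t11, t02, t03, t12, t13, hsymm _ 1 0, hsymm _ 2 0, hsymm _ 2 1, hsymm _ 3 0,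
      hsymm _ 3 1, hsymm _ 3 2]

end

/-! ### Elliptic lines: a further nonreal base point. -/

noncomputable section

open Matrix

set_option linter.unusedSimpArgs false

/-- A net in the coordinates adapted to a line on which all members are proportional to the form
with matrix `!![i₀, i₁; i₁, i₂]`. -/
def normalNet {R : Type*} [Zero R] (i₀ i₁ i₂ a b c d a' b' c' d' n₀ m₀ r₀ n₁ m₁ r₁ n₂ m₂ r₂ : R) :
    Fin 3 → Matrix (Fin 4) (Fin 4) R :=
  ![!![i₀, i₁, 0, 0; i₁, i₂, 0, 0; 0, 0, n₀, m₀; 0, 0, m₀, r₀],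
    !![0, 0, a, b; 0, 0, c, d; a, c, n₁, m₁; b, d, m₁, r₁],
    !![0, 0, a', b'; 0, 0, c', d'; a', c', n₂, m₂; b', d', m₂, r₂]]

variable {i₀ i₁ i₂ a b c d a' b' c' d' n₀ m₀ r₀ n₁ m₁ r₁ n₂ m₂ r₂ : ℝ}

theorem netMember_normalNet (x y z : ℝ) :
    netMember (normalNet i₀ i₁ i₂ a b c d a' b' c' d' n₀ m₀ r₀ n₁ m₁ r₁ n₂ m₂ r₂) ![z, x, y] =
      !![z * i₀, z * i₁, x * a + y * a', x * b + y * b';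
         z * i₁, z * i₂, x * c + y * c', x * d + y * d';
         x * a + y * a', x * c + y * c', z * n₀ + x * n₁ + y * n₂, z * m₀ + x * m₁ + y * m₂;
         x * b + y * b', x * d + y * d', z * m₀ + x * m₁ + y * m₂, z * r₀ + x * r₁ + y * r₂] := by
  ext i j
  fin_cases i <;> fin_cases j <;> simp [netMember, normalNet, Fin.sum_univ_three]

theorem complexNet_normalNet :
    complexNet (normalNet i₀ i₁ i₂ a b c d a' b' c' d' n₀ m₀ r₀ n₁ m₁ r₁ n₂ m₂ r₂) =
      normalNet (i₀ : ℂ) i₁ i₂ a b c d a' b' c' d' n₀ m₀ r₀ n₁ m₁ r₁ n₂ m₂ r₂ := by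
  funext k
  ext i j
  fin_cases k <;> fin_cases i <;> fin_cases j <;> simp [complexNet, normalNet]

theorem det_bordered_fin_four {R : Type*} [CommRing R] (i₀ i₁ i₂ a b c d n m r : R) :
    (!![i₀, i₁, a, b; i₁, i₂, c, d; a, c, n, m; b, d, m, r]).det =
      (i₀ * i₂ - i₁ ^ 2) * (n * r - m ^ 2) + (a * d - b * c) ^ 2
      - n * (i₂ * b ^ 2 - 2 * i₁ * b * d + i₀ * d ^ 2)
      - r * (i₂ * a ^ 2 - 2 * i₁ * a * c + i₀ * c ^ 2)
      + 2 * m * (i₂ * a * b - i₁ * (a * d + b * c) + i₀ * c * d) := by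
  rw [det_succ_row_zero]
  simp [Fin.sum_univ_succ, det_fin_three, Fin.succAbove]
  ring

theorem posDef_bordered {a b c d n m r : ℝ} (h1 : 0 < n - a ^ 2 - c ^ 2)
    (h2 : 0 < (n - a ^ 2 - c ^ 2) * (r - b ^ 2 - d ^ 2) - (m - a * b - c * d) ^ 2) :
    (!![1, 0, a, b; 0, 1, c, d; a, c, n, m; b, d, m, r]).PosDef := by
  refine PosDef.of_dotProduct_mulVec_pos ?_ fun x hx => ?_
  · ext i j
    fin_cases i <;> fin_cases j <;> simp
  · set α := n - a ^ 2 - c ^ 2 with hα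
    set β := m - a * b - c * d with hβ
    set γ := r - b ^ 2 - d ^ 2 with hγ
    have e : star x ⬝ᵥ (!![1, 0, a, b; 0, 1, c, d; a, c, n, m; b, d, m, r]) *ᵥ x =
        (x 0 + a * x 2 + b * x 3) ^ 2 + (x 1 + c * x 2 + d * x 3) ^ 2 +
          ((α * x 2 + β * x 3) ^ 2 + (α * γ - β ^ 2) * x 3 ^ 2) / α := by
      have : ((α * x 2 + β * x 3) ^ 2 + (α * γ - β ^ 2) * x 3 ^ 2) / α =
          α * x 2 ^ 2 + 2 * β * x 2 * x 3 + γ * x 3 ^ 2 := by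
        field_simp
        ring
      rw [this]
      simp [dotProduct, mulVec, Fin.sum_univ_four]
      rw [hα, hβ, hγ]
      ring
    rw [e]
    by_contra hle
    have p1 : 0 ≤ ((α * x 2 + β * x 3) ^ 2 + (α * γ - β ^ 2) * x 3 ^ 2) / α := by positivity
    have p2 := sq_nonneg (x 0 + a * x 2 + b * x 3)
    have p3 := sq_nonneg (x 1 + c * x 2 + d * x 3)
    have z1 : ((α * x 2 + β * x 3) ^ 2 + (α * γ - β ^ 2) * x 3 ^ 2) / α = 0 := by linarith
    have z2 : x 0 + a * x 2 + b * x 3 = 0 := by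
      rw [← sq_eq_zero_iff]; linarith
    have z3 : x 1 + c * x 2 + d * x 3 = 0 := by
      rw [← sq_eq_zero_iff]; linarith
    rw [div_eq_zero_iff] at z1
    have z1 := z1.resolve_right h1.ne'
    have p4 := sq_nonneg (α * x 2 + β * x 3)
    have p5 : 0 ≤ (α * γ - β ^ 2) * x 3 ^ 2 := by positivity
    have z4 : (α * γ - β ^ 2) * x 3 ^ 2 = 0 := by linarith
    have x3 : x 3 = 0 := by simpa [h2.ne'] using z4
    have z5 : (α * x 2 + β * x 3) ^ 2 = 0 := by linarith
    have x2 : x 2 = 0 := by simpa [x3, h1.ne'] using z5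
    refine hx ?_
    ext i
    fin_cases i
    · simpa [x2, x3] using z2
    · simpa [x2, x3] using z3
    · exact x2
    · exact x3

/-- A member with zero upper left block has as determinant the square of this expression. -/
theorem IsPositiveNet.normalNet_pairing_det_ne_zero
    (h : IsPositiveNet (normalNet i₀ i₁ i₂ a b c d a' b' c' d' n₀ m₀ r₀ n₁ m₁ r₁ n₂ m₂ r₂)) (x y : ℝ)
    (hxy : x ≠ 0 ∨ y ≠ 0) :
    (x * a + y * a') * (x * d + y * d') - (x * b + y * b') * (x * c + y * c') ≠ 0 := by
  intro h0
  have := h.pos ![0, x, y] fun e => by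
    rcases hxy with hx | hy
    · exact hx (congrFun e 1)
    · exact hy (congrFun e 2)
  rw [netMember_normalNet, det_bordered_fin_four, h0] at this
  simp at this

/-- The left side is the Schur complement of the identity block in the member $(1,x,y)$. Its
determinant is positive, and it is not positive definite since the member would be too, so it is
negative definite. -/
theorem IsPositiveNet.normalNet_schur_neg
    (h : IsPositiveNet (normalNet 1 0 1 a b c d a' b' c' d' n₀ m₀ r₀ n₁ m₁ r₁ n₂ m₂ r₂))
    {s t : ℝ} (hst : s ≠ 0 ∨ t ≠ 0) (x y : ℝ) :
    (n₀ * s ^ 2 + 2 * m₀ * s * t + r₀ * t ^ 2) + x * (n₁ * s ^ 2 + 2 * m₁ * s * t + r₁ * t ^ 2)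
      + y * (n₂ * s ^ 2 + 2 * m₂ * s * t + r₂ * t ^ 2)
      - (x * (a * s + b * t) + y * (a' * s + b' * t)) ^ 2
      - (x * (c * s + d * t) + y * (c' * s + d' * t)) ^ 2 < 0 := by
  have hd := h.pos ![1, x, y] fun e => one_ne_zero (congrFun e 0)
  have hn := h.not_posDef ![1, x, y]
  rw [netMember_normalNet] at hd hn
  rw [det_bordered_fin_four] at hd
  simp only [one_mul, mul_one, mul_zero] at hd hn
  set α := (n₀ + x * n₁ + y * n₂) - (x * a + y * a') ^ 2 - (x * c + y * c') ^ 2 with hα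
  set γ := (r₀ + x * r₁ + y * r₂) - (x * b + y * b') ^ 2 - (x * d + y * d') ^ 2 with hγ
  set β := (m₀ + x * m₁ + y * m₂) - (x * a + y * a') * (x * b + y * b')
    - (x * c + y * c') * (x * d + y * d') with hβ
  have hdet : 0 < α * γ - β ^ 2 := by
    rw [hα, hβ, hγ]
    convert hd using 1
    ring
  have hα0 : α < 0 := by
    rcases lt_trichotomy α 0 with h0 | h0 | h0
    · exact h0
    · rw [h0] at hdet
      nlinarith [sq_nonneg β]
    · exact absurd (posDef_bordered h0 hdet) hn
  have e : (n₀ * s ^ 2 + 2 * m₀ * s * t + r₀ * t ^ 2)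
      + x * (n₁ * s ^ 2 + 2 * m₁ * s * t + r₁ * t ^ 2)
      + y * (n₂ * s ^ 2 + 2 * m₂ * s * t + r₂ * t ^ 2)
      - (x * (a * s + b * t) + y * (a' * s + b' * t)) ^ 2
      - (x * (c * s + d * t) + y * (c' * s + d' * t)) ^ 2
      = α * s ^ 2 + 2 * β * s * t + γ * t ^ 2 := by
    rw [hα, hβ, hγ]; ring
  rw [e]
  have e2 : α * (α * s ^ 2 + 2 * β * s * t + γ * t ^ 2) =
      (α * s + β * t) ^ 2 + (α * γ - β ^ 2) * t ^ 2 := by ring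
  have hpos : 0 < α * (α * s ^ 2 + 2 * β * s * t + γ * t ^ 2) := by
    rw [e2]
    by_cases ht : t = 0
    · subst ht
      have hs : s ≠ 0 := by simpa using hst
      have : α * s ≠ 0 := mul_ne_zero hα0.ne hs
      simp only [mul_zero, add_zero]
      positivity
    · positivity
  exact neg_of_mul_pos_right hpos hα0.le

/-- $(x,y,0,0)$ is a base point and $(0,0,s,t)$ is tangent there to all three quadrics. -/
theorem IsSmoothNet.eq_zero_of_normalNet_tangent {i₀ i₁ i₂ a b c d a' b' c' d' n₀ m₀ r₀ n₁ m₁ r₁ n₂ m₂ r₂ : ℂ}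
    (h : IsSmoothNet (normalNet i₀ i₁ i₂ a b c d a' b' c' d' n₀ m₀ r₀ n₁ m₁ r₁ n₂ m₂ r₂))
    {x y s t : ℂ} (hxy : x ≠ 0 ∨ y ≠ 0) (hi : i₀ * x ^ 2 + 2 * i₁ * x * y + i₂ * y ^ 2 = 0)
    (h1 : x * (a * s + b * t) + y * (c * s + d * t) = 0)
    (h2 : x * (a' * s + b' * t) + y * (c' * s + d' * t) = 0) : s = 0 ∧ t = 0 := by
  have hu : IsBasePoint (normalNet i₀ i₁ i₂ a b c d a' b' c' d' n₀ m₀ r₀ n₁ m₁ r₁ n₂ m₂ r₂)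
      ![x, y, 0, 0] := by
    refine ⟨fun e => ?_, fun k => ?_⟩
    · rcases hxy with hx | hy
      · exact hx (congrFun e 0)
      · exact hy (congrFun e 1)
    · fin_cases k
      · simp [normalNet, dotProduct, mulVec, Fin.sum_univ_four]
        linear_combination hi
      all_goals simp [normalNet, dotProduct, mulVec, Fin.sum_univ_four]
  obtain ⟨κ, hκ⟩ := h.eq_smul_of_tangent hu (w := ![0, 0, s, t]) fun k => by
    fin_cases k <;> simp [normalNet, dotProduct, mulVec, Fin.sum_univ_four]
    · linear_combination h1
    · linear_combination h2
  exact ⟨by simpa using congrFun hκ 2, by simpa using congrFun hκ 3⟩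

/-- For fixed $(s:t)$ the equations in $x_1,x_2$ are a circle and two lines. Their resultant, a
sextic in $(s:t)$, is negative at all real points, including $(0:1)$, which gives the leading
coefficient. -/
theorem IsPositiveNet.exists_nonreal_basePoint_normalNet
    (h : IsPositiveNet (normalNet 1 0 1 a b c d a' b' c' d' n₀ m₀ r₀ n₁ m₁ r₁ n₂ m₂ r₂)) :
    ∃ x₁ x₂ t : ℂ, t.im ≠ 0 ∧ IsBasePoint
      (complexNet (normalNet 1 0 1 a b c d a' b' c' d' n₀ m₀ r₀ n₁ m₁ r₁ n₂ m₂ r₂))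
      ![x₁, x₂, 1, t] := by
  have hR : ∀ s t : ℝ, (s ≠ 0 ∨ t ≠ 0) → circleResultant (a * s + b * t) (c * s + d * t)
      (a' * s + b' * t) (c' * s + d' * t) (n₀ * s ^ 2 + 2 * m₀ * s * t + r₀ * t ^ 2)
      (n₁ * s ^ 2 + 2 * m₁ * s * t + r₁ * t ^ 2) (n₂ * s ^ 2 + 2 * m₂ * s * t + r₂ * t ^ 2) < 0 :=
    fun s t hst => circleResultant_neg (pairing_det_ne_zero h.normalNet_pairing_det_ne_zero hst)
      (h.normalNet_schur_neg hst)
  obtain ⟨P, hP, hP6⟩ := exists_circleResultant_poly a b c d a' b' c' d' n₀ m₀ r₀ n₁ m₁ r₁ n₂ m₂ r₂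
  have hP6' : P.coeff 6 ≠ 0 := by
    have := (hR 0 1 (Or.inr one_ne_zero)).ne
    rw [hP6]
    intro h0
    apply this
    simp only [circleResultant] at h0 ⊢
    norm_num
    exact_mod_cast h0
  obtain ⟨t, ht⟩ := IsAlgClosed.exists_root P (by
    intro hd
    exact hP6' (Polynomial.coeff_eq_zero_of_degree_lt (by rw [hd]; norm_num)))
  rw [Polynomial.IsRoot, hP] at ht
  have hs := h.smooth
  rw [complexNet_normalNet] at hs ⊢
  have him : t.im ≠ 0 := by
    intro him
    obtain ⟨τ, rfl⟩ : ∃ τ : ℝ, t = τ := ⟨t.re, by apply Complex.ext <;> simp [him]⟩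
    have := (hR 1 τ (Or.inl one_ne_zero)).ne
    apply this
    simp only [circleResultant] at ht ⊢
    norm_num
    exact_mod_cast ht
  obtain ⟨x₁, x₂, e1, e2, e3⟩ := exists_common_zero_of_circleResultant ht (by
    intro ε hε h1 h2
    have := hs.eq_zero_of_normalNet_tangent (x := 1) (y := ε) (s := 1) (t := t)
      (Or.inl one_ne_zero) (by push_cast; linear_combination hε) (by linear_combination h1)
      (by linear_combination h2)
    exact one_ne_zero this.1)
  refine ⟨x₁, x₂, t, him, fun e => one_ne_zero (congrFun e 2), fun k => ?_⟩
  fin_cases k <;> simp [normalNet, dotProduct, mulVec, Fin.sum_univ_four]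
  · linear_combination e3
  · linear_combination e1
  · linear_combination e2

end

/-! ### Hyperbolic lines are impossible for a positive net. -/

noncomputable section

open Matrix ComplexConjugate

set_option linter.unusedSimpArgs false

theorem exists_real_solution_sq_eq_conj {b : ℝ} (hb : 0 ≤ b) (g₁ g₂ : ℝ) :
    ∃ x y : ℝ, x ^ 2 - y ^ 2 = b * x + g₁ ∧ 2 * x * y = -b * y + g₂ := by
  by_cases hg : g₂ = 0
  · subst hg
    by_cases hd : 0 ≤ b ^ 2 + 4 * g₁
    · refine ⟨(b + √(b ^ 2 + 4 * g₁)) / 2, 0, ?_, by simp⟩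
      linear_combination (Real.sq_sqrt hd) / 4
    · have hy : 0 ≤ 3 * b ^ 2 / 4 - g₁ := by nlinarith [sq_nonneg b]
      refine ⟨-b / 2, √(3 * b ^ 2 / 4 - g₁), ?_, by ring⟩
      linear_combination -(Real.sq_sqrt hy)
  -- The second equation gives $y=g_2/(2x+b)$; `f` is the first with denominators cleared. It
  -- changes sign between the pole $-b/2$ and a large `X`.
  · let f : ℝ → ℝ := fun x => (x ^ 2 - b * x - g₁) * (2 * x + b) ^ 2 - g₂ ^ 2
    let X := b + |g₁| + |g₂| + 1
    have h1 := abs_nonneg g₁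
    have h2 := abs_nonneg g₂
    have hle : -b / 2 ≤ X := by simp only [X]; linarith
    have hlow : f (-b / 2) ≤ 0 := by
      simp only [f]
      have : 2 * (-b / 2) + b = 0 := by ring
      rw [this]
      nlinarith [sq_nonneg g₂]
    have hhigh : 0 ≤ f X := by
      simp only [f]
      have e1 : 1 ≤ X ^ 2 - b * X - g₁ := by
        have hX : 1 ≤ X := by simp only [X]; linarith
        have hXb : 1 + |g₁| ≤ X - b := by simp only [X]; linarith
        nlinarith [le_abs_self g₁]
      have e2 : |g₂| ≤ 2 * X + b := by simp only [X]; linarith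
      have e3 : g₂ ^ 2 ≤ (2 * X + b) ^ 2 := by
        rw [← sq_abs g₂]
        gcongr
      nlinarith [sq_nonneg (2 * X + b)]
    obtain ⟨x, -, hx⟩ := intermediate_value_Icc hle (f := f) (by fun_prop) ⟨hlow, hhigh⟩
    have hx0 : 2 * x + b ≠ 0 := by
      intro h0
      simp only [f, h0] at hx
      exact hg (by simpa using hx)
    refine ⟨x, g₂ / (2 * x + b), ?_, ?_⟩
    · simp only [f] at hx
      have : x ^ 2 - b * x - g₁ = (g₂ / (2 * x + b)) ^ 2 := by
        rw [div_pow, eq_div_iff (pow_ne_zero 2 hx0)]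
        linear_combination hx
      linear_combination this
    · field_simp
      ring

theorem exists_sq_eq_conj_of_nonneg {b : ℝ} (hb : 0 ≤ b) (γ : ℂ) :
    ∃ z : ℂ, z ^ 2 = b * conj z + γ := by
  obtain ⟨x, y, h1, h2⟩ := exists_real_solution_sq_eq_conj hb γ.re γ.im
  refine ⟨⟨x, y⟩, ?_⟩
  apply Complex.ext
  · simp [pow_two]; linear_combination h1
  · simp [pow_two]; linear_combination h2

/-- Completing the square removes $\alpha z$, and a rotation by $\omega$ with
$\beta=|\beta|\omega^3$ makes the coefficient of $\bar z$ real and nonnegative. -/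
theorem exists_sq_eq_linear_conj (α β γ : ℂ) : ∃ z : ℂ, z ^ 2 = α * z + β * conj z + γ := by
  obtain ⟨ω, hω, hω3⟩ : ∃ ω : ℂ, ω * conj ω = 1 ∧ β = ‖β‖ * ω ^ 3 := by
    by_cases hβ : β = 0
    · exact ⟨1, by simp, by simp [hβ]⟩
    · obtain ⟨ω, hω⟩ := IsAlgClosed.exists_pow_nat_eq (β / ‖β‖) (n := 3) (by norm_num)
      have hn : (‖β‖ : ℂ) ≠ 0 := by simpa using hβ
      refine ⟨ω, ?_, by rw [hω]; field_simp⟩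
      have : ‖ω‖ ^ 3 = 1 := by
        rw [← norm_pow, hω, norm_div]
        simp [hβ]
      have h1 : ‖ω‖ = 1 := (pow_eq_one_iff_of_nonneg (norm_nonneg _) (by norm_num)).1 this
      rw [Complex.mul_conj, Complex.normSq_eq_norm_sq, h1]
      simp
  obtain ⟨u, hu⟩ := exists_sq_eq_conj_of_nonneg (norm_nonneg β)
    ((α ^ 2 / 4 + β * conj α / 2 + γ) * conj ω ^ 2)
  refine ⟨ω * u + α / 2, ?_⟩
  simp only [map_add, map_mul, map_div₀, map_ofNat]
  have e1 : ω ^ 2 * conj ω ^ 2 = 1 := by rw [← mul_pow, hω, one_pow]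
  linear_combination ω ^ 2 * hu + (α ^ 2 / 4 + β * conj α / 2 + γ) * e1
    - (‖β‖ : ℂ) * ω ^ 2 * conj u * hω - conj ω * conj u * hω3

theorem discrim_nonneg_of_nonreal_root {n m r : ℝ} {t : ℂ} (ht : t.im ≠ 0)
    (h : (n : ℂ) + 2 * m * t + r * t ^ 2 = 0) : 0 ≤ n * r - m ^ 2 := by
  have hre := congrArg Complex.re h
  have him := congrArg Complex.im h
  simp [pow_two] at hre him
  have h1 : m = -r * t.re := by
    refine mul_left_cancel₀ ht ?_
    linear_combination him / 2
  have h2 : n = r * (t.re ^ 2 + t.im ^ 2) := by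
    rw [h1] at hre
    linear_combination hre
  rw [h1, h2]
  have : r * (t.re ^ 2 + t.im ^ 2) * r - (-r * t.re) ^ 2 = (r * t.im) ^ 2 := by ring
  rw [this]
  positivity

variable {a b c d a' b' c' d' n₀ m₀ r₀ n₁ m₁ r₁ n₂ m₂ r₂ : ℝ}

/-- A net with positive discriminant has no line joining two real base points. -/
theorem not_isPositiveNet_normalNet_hyperbolic :
    ¬ IsPositiveNet (normalNet 0 1 0 a b c d a' b' c' d' n₀ m₀ r₀ n₁ m₁ r₁ n₂ m₂ r₂) := by
  intro h
  have hs := h.smooth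
  rw [complexNet_normalNet] at hs
  have hD := fun {s t : ℝ} => pairing_det_ne_zero (s := s) (t := t) h.normalNet_pairing_det_ne_zero
  have hdet := h.normalNet_pairing_det_ne_zero
  -- At this `t`, which cannot be real, the vectors $p$ and $q$ become proportional.
  obtain ⟨t, ht⟩ := exists_quadratic_root (b * d' - d * b') (a * d' + b * c' - c * b' - d * a')
    (a * c' - c * a') (by
      have := hD (s := 0) (t := 1) (Or.inr one_ne_zero)
      norm_num at this
      exact_mod_cast this)
  have him : t.im ≠ 0 := by
    intro him
    obtain ⟨τ, rfl⟩ : ∃ τ : ℝ, t = τ := ⟨t.re, by apply Complex.ext <;> simp [him]⟩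
    refine hD (s := 1) (t := τ) (Or.inl one_ne_zero) ?_
    have ht' : (b * d' - d * b') * (τ * τ) + (a * d' + b * c' - c * b' - d * a') * τ
      + (a * c' - c * a') = 0 := by exact_mod_cast ht
    linear_combination ht'
  obtain ⟨p₁, hp₁⟩ : ∃ p₁ : ℂ, p₁ = a + b * t := ⟨_, rfl⟩
  obtain ⟨p₂, hp₂⟩ : ∃ p₂ : ℂ, p₂ = c + d * t := ⟨_, rfl⟩
  obtain ⟨q₁, hq₁⟩ : ∃ q₁ : ℂ, q₁ = a' + b' * t := ⟨_, rfl⟩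
  obtain ⟨q₂, hq₂⟩ : ∃ q₂ : ℂ, q₂ = c' + d' * t := ⟨_, rfl⟩
  have hpq : p₁ * q₂ - p₂ * q₁ = 0 := by
    rw [hp₁, hp₂, hq₁, hq₂]; linear_combination ht
  have hreal : ∀ x y : ℝ, (x ≠ 0 ∨ y ≠ 0) → x * p₁ + y * q₁ = 0 → x * p₂ + y * q₂ = 0 → False := by
    intro x y hxy e1 e2
    refine hdet x y hxy ?_
    rw [hp₁, hq₁] at e1
    rw [hp₂, hq₂] at e2
    have : (((x * a + y * a') * (x * d + y * d') - (x * b + y * b') * (x * c + y * c') : ℝ) : ℂ)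
        = 0 := by
      push_cast
      linear_combination (x * d + y * d') * e1 - (x * b + y * b') * e2
    exact_mod_cast this
  have htr1 : ¬ (p₁ = 0 ∧ q₁ = 0) := by
    rintro ⟨e1, e2⟩
    rw [hp₁] at e1
    rw [hq₁] at e2
    exact one_ne_zero (hs.eq_zero_of_normalNet_tangent (x := 1) (y := 0) (s := 1) (t := t)
      (Or.inl one_ne_zero) (by simp) (by linear_combination e1) (by linear_combination e2)).1
  have htr2 : ¬ (p₂ = 0 ∧ q₂ = 0) := by
    rintro ⟨e1, e2⟩
    rw [hp₂] at e1
    rw [hq₂] at e2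
    exact one_ne_zero (hs.eq_zero_of_normalNet_tangent (x := 0) (y := 1) (s := 1) (t := t)
      (Or.inr one_ne_zero) (by simp) (by linear_combination e1) (by linear_combination e2)).1
  obtain ⟨η, e1, e2⟩ : ∃ η : ℂ, p₁ = -η * q₁ ∧ p₂ = -η * q₂ := by
    by_cases h1 : q₁ = 0
    · have h2 : q₂ ≠ 0 := fun h2 => hreal 0 1 (Or.inr one_ne_zero) (by simp [h1]) (by simp [h2])
      exact ⟨-p₂ / q₂, by field_simp; linear_combination hpq, by field_simp⟩
    · exact ⟨-p₁ / q₁, by field_simp, by field_simp; linear_combination -hpq⟩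
  have hq₁0 : q₁ ≠ 0 := fun h0 => htr1 ⟨by rw [e1, h0, mul_zero], h0⟩
  have hq₂0 : q₂ ≠ 0 := fun h0 => htr2 ⟨by rw [e2, h0, mul_zero], h0⟩
  have hη : conj η - η ≠ 0 := by
    intro h0
    obtain ⟨y, hy⟩ := Complex.conj_eq_iff_real.1 (sub_eq_zero.1 h0)
    refine hreal 1 y (Or.inl one_ne_zero) ?_ ?_
    · rw [e1, hy]; push_cast; ring
    · rw [e2, hy]; push_cast; ring
  let N (n m r : ℝ) : ℂ := n + 2 * m * t + r * t ^ 2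
  have hκ : 2 * (conj η - η) ^ 2 * q₁ * q₂ ≠ 0 := by
    simp [hη, hq₁0, hq₂0]
  -- Real $x,y$ are sought for which the Schur complement of the member $(1,x,y)$ vanishes at
  -- $(1,t)$: one complex equation in two real unknowns. With $x=z+\bar z$, $y=z\bar\eta+\bar z\eta$
  -- it becomes quadratic in $z$ and linear in $\bar z$, because $-\eta x+y=z(\bar\eta-\eta)$.
  obtain ⟨z, hz⟩ := exists_sq_eq_linear_conj
    ((N n₁ m₁ r₁ + conj η * N n₂ m₂ r₂) / (2 * (conj η - η) ^ 2 * q₁ * q₂))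
    ((N n₁ m₁ r₁ + η * N n₂ m₂ r₂) / (2 * (conj η - η) ^ 2 * q₁ * q₂))
    (N n₀ m₀ r₀ / (2 * (conj η - η) ^ 2 * q₁ * q₂))
  have hz' : N n₀ m₀ r₀ + (z + conj z) * N n₁ m₁ r₁ + (z * conj η + conj z * η) * N n₂ m₂ r₂
      - 2 * (z * (conj η - η) * q₁) * (z * (conj η - η) * q₂) = 0 := by
    field_simp at hz
    linear_combination -hz
  obtain ⟨x, hx⟩ : ∃ x : ℝ, z + conj z = x := ⟨2 * z.re, by rw [Complex.add_conj]⟩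
  obtain ⟨y, hy⟩ : ∃ y : ℝ, z * conj η + conj z * η = y := ⟨2 * (z * conj η).re, by
    rw [← Complex.add_conj]; simp⟩
  have f1 : z * (conj η - η) * q₁ = x * p₁ + y * q₁ := by
    rw [← hx, ← hy, e1]; ring
  have f2 : z * (conj η - η) * q₂ = x * p₂ + y * q₂ := by
    rw [← hx, ← hy, e2]; ring
  rw [f1, f2, hx, hy] at hz'
  -- A nonreal root makes the Schur complement semidefinite. The hyperbolic block has determinant
  -- $-1$, so the member has determinant at most 0.
  have hsemi := discrim_nonneg_of_nonreal_root (t := t)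
    (n := n₀ + x * n₁ + y * n₂ - 2 * (x * a + y * a') * (x * c + y * c'))
    (m := m₀ + x * m₁ + y * m₂ - ((x * a + y * a') * (x * d + y * d')
      + (x * b + y * b') * (x * c + y * c')))
    (r := r₀ + x * r₁ + y * r₂ - 2 * (x * b + y * b') * (x * d + y * d')) him (by
      push_cast
      rw [← hz', hp₁, hp₂, hq₁, hq₂]
      simp only [N]
      ring)
  have hpos := h.pos ![1, x, y] fun e => one_ne_zero (congrFun e 0)
  rw [netMember_normalNet, det_bordered_fin_four] at hpos
  nlinarith

end

/-! ### Real structure: two conjugate pairs of base points. -/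

noncomputable section

open Matrix

set_option linter.unusedSimpArgs false

/-- The complexification of a real vector. -/
def complexVec {n : ℕ} (x : Fin n → ℝ) : Fin n → ℂ := fun i => (x i : ℂ)

theorem dotProduct_complexNet (A : Fin 3 → Matrix (Fin 4) (Fin 4) ℝ) (x y : Fin 4 → ℝ) (k : Fin 3) :
    complexVec x ⬝ᵥ complexNet A k *ᵥ complexVec y = ((x ⬝ᵥ A k *ᵥ y : ℝ) : ℂ) := by
  simp [complexVec, complexNet, dotProduct, mulVec]

theorem eq_complexVec_add (u : Fin 4 → ℂ) : u = complexVec (fun i => (u i).re) +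
    Complex.I • complexVec (fun i => (u i).im) := by
  ext i
  simp [complexVec, mul_comm Complex.I, Complex.re_add_im]

theorem star_complexVec (x : Fin 4 → ℝ) : star (complexVec x) = complexVec x := by
  ext i
  simp [complexVec]

theorem star_eq_complexVec_sub (u : Fin 4 → ℂ) : star u = complexVec (fun i => (u i).re) -
    Complex.I • complexVec (fun i => (u i).im) := by
  conv_lhs => rw [eq_complexVec_add u]
  rw [star_add, star_smul, star_complexVec, star_complexVec]
  simp [sub_eq_add_neg]

theorem LinearIndependent.of_complexVec {x y : Fin 4 → ℝ}
    (h : LinearIndependent ℂ ![complexVec x, complexVec y]) : LinearIndependent ℝ ![x, y] := by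
  rw [LinearIndependent.pair_iff] at h ⊢
  intro s t hst
  have := h s t (by
    ext i
    have := congrFun hst i
    simp only [Pi.add_apply, Pi.smul_apply, smul_eq_mul, Pi.zero_apply, complexVec] at this ⊢
    exact_mod_cast this)
  exact_mod_cast this

theorem map_star_mulVec (g : Matrix (Fin 4) (Fin 4) ℝ) (u : Fin 4 → ℂ) :
    g.map Complex.ofRealHom *ᵥ star u = star (g.map Complex.ofRealHom *ᵥ u) := by
  ext i
  simp [dotProduct, mulVec]

theorem IsBasePoint.star {A : Fin 3 → Matrix (Fin 4) (Fin 4) ℝ} {u : Fin 4 → ℂ}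
    (hu : IsBasePoint (complexNet A) u) : IsBasePoint (complexNet A) (star u) := by
  refine ⟨fun h => hu.ne_zero (star_eq_zero.1 h), fun k => ?_⟩
  have := congrArg (starRingEnd ℂ) (hu.isotropic k)
  rw [map_zero] at this
  rw [← this, complexNet, map_star_mulVec]
  simp [dotProduct]

theorem IsBasePoint.of_smul {A : Fin 3 → Matrix (Fin 4) (Fin 4) ℂ} {u : Fin 4 → ℂ} {c : ℂ}
    (hu : IsBasePoint A (c • u)) : IsBasePoint A u := by
  have hc : c ≠ 0 := fun h => hu.ne_zero (by rw [h, zero_smul])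
  refine ⟨fun h => hu.ne_zero (by rw [h, smul_zero]), fun k => ?_⟩
  have := hu.isotropic k
  rw [mulVec_smul, dotProduct_smul, smul_dotProduct, smul_eq_mul, smul_eq_mul] at this
  simpa [hc] using this

theorem linearIndependent_pair_mulVec {g : Matrix (Fin 4) (Fin 4) ℂ} (hg : g.det ≠ 0)
    {u v : Fin 4 → ℂ} (h : LinearIndependent ℂ ![u, v]) :
    LinearIndependent ℂ ![g *ᵥ u, g *ᵥ v] := by
  rw [LinearIndependent.pair_iff] at h ⊢
  intro s t hst
  refine h s t (Matrix.eq_zero_of_mulVec_eq_zero hg ?_)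
  rw [mulVec_add, mulVec_smul, mulVec_smul, hst]

theorem exists_smul_eq_complexVec {u : Fin 4 → ℂ} (hu : u ≠ 0)
    (h : ¬ LinearIndependent ℂ ![u, star u]) : ∃ (c : ℂ) (x : Fin 4 → ℝ), c ≠ 0 ∧ u = c • complexVec x := by
  have hre : ∃ (c : ℂ) (κ : ℂ), c ≠ 0 ∧ c • u = κ • u + star (κ • u) := by
    rw [LinearIndependent.pair_iff] at h
    push Not at h
    obtain ⟨s, t, hst, hne⟩ := h
    have ht : t ≠ 0 := by
      intro h0
      rw [h0, zero_smul, add_zero] at hst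
      exact hne ((smul_eq_zero.1 hst).resolve_right hu) h0
    have hstar : star u = (-s / t) • u := by
      have : t • star u = (-s) • u := by
        rw [neg_smul, eq_neg_iff_add_eq_zero, add_comm]; exact hst
      rw [div_eq_inv_mul, mul_smul, ← this, smul_smul, inv_mul_cancel₀ ht, one_smul]
    -- If $\bar u=\lambda u$ then $(1+\lambda)u=u+\bar u$ is real; for $\lambda=-1$ the real vector
    -- is $2iu$.
    by_cases h1 : 1 + -s / t = 0
    · refine ⟨2 * Complex.I, Complex.I, by simp, ?_⟩
      rw [star_smul, hstar, eq_neg_of_add_eq_zero_right h1]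
      simp
      module
    · refine ⟨1 + -s / t, 1, h1, ?_⟩
      rw [one_smul, hstar]
      module
  obtain ⟨c, κ, hc, hcu⟩ := hre
  refine ⟨c⁻¹, fun i => 2 * (κ * u i).re, inv_ne_zero hc, ?_⟩
  rw [eq_inv_smul_iff₀ hc, hcu]
  ext i
  simp only [complexVec, Pi.add_apply, Pi.star_apply, Pi.smul_apply, smul_eq_mul]
  exact Complex.add_conj _

theorem IsPositiveNet.exists_singular_member {A : Fin 3 → Matrix (Fin 4) (Fin 4) ℝ}
    (hA : IsPositiveNet A) : ∃ z, z ≠ 0 ∧ (netMember (complexNet A) z).det = 0 := by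
  have hd : (complexNet A 1).det ≠ 0 := by
    refine det_map_ofReal_ne_zero ?_
    have := hA.pos (Pi.single 1 1) (by simp)
    have e : netMember A (Pi.single 1 1) = A 1 := by
      simp [netMember, Pi.single_apply]
    rw [e] at this
    exact this.ne'
  obtain ⟨s, hs⟩ := Module.End.exists_eigenvalue
    (Matrix.toLin' ((complexNet A 1)⁻¹ * complexNet A 0))
  obtain ⟨v, hv⟩ := hs.exists_hasEigenvector
  refine ⟨![1, -s, 0], fun h => one_ne_zero (congrFun h 0), ?_⟩
  refine Matrix.exists_mulVec_eq_zero_iff.1 ⟨v, hv.2, ?_⟩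
  have h1 := hv.apply_eq_smul
  rw [Matrix.toLin'_apply, ← mulVec_mulVec] at h1
  have h2 : complexNet A 0 *ᵥ v = s • (complexNet A 1 *ᵥ v) := by
    rw [← mulVec_smul, ← h1, mulVec_mulVec, Matrix.mul_nonsing_inv _ (isUnit_iff_ne_zero.2 hd),
      one_mulVec]
  simp [netMember_mulVec, Fin.sum_univ_three, h2]

theorem IsPositiveNet.false_of_two_real_basePoints {A : Fin 3 → Matrix (Fin 4) (Fin 4) ℝ}
    (hA : IsPositiveNet A) {x y : Fin 4 → ℝ} (hx : IsBasePoint (complexNet A) (complexVec x))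
    (hy : IsBasePoint (complexNet A) (complexVec y))
    (hli : LinearIndependent ℂ ![complexVec x, complexVec y]) : False := by
  obtain ⟨k, hk⟩ := hA.smooth.exists_pairing_ne_zero hx hli
  rw [dotProduct_complexNet] at hk
  have hxx : ∀ k, x ⬝ᵥ A k *ᵥ x = 0 := fun k => by
    have := hx.isotropic k
    rw [dotProduct_complexNet] at this
    exact_mod_cast this
  have hyy : ∀ k, y ⬝ᵥ A k *ᵥ y = 0 := fun k => by
    have := hy.isotropic k
    rw [dotProduct_complexNet] at this
    exact_mod_cast this
  obtain ⟨g, h, a, b, c, d, a', b', c', d', n₀, m₀, r₀, n₁, m₁, r₁, n₂, m₂, r₂, hg, hh, -, -, hN⟩ :=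
    exists_normal_form hA.isSymm hli.of_complexVec (β := fun k => x ⬝ᵥ A k *ᵥ y)
    (i₀ := 0) (i₁ := 1) (i₂ := 0) (fun h0 => hk (by simpa using congrFun h0 k))
    (by norm_num) (by norm_num) (by norm_num) (by simpa using hxx) (by simp) (by simpa using hyy)
  have := hA.transformNet hg hh
  rw [hN] at this
  exact not_isPositiveNet_normalNet_hyperbolic this

/-- On the span of $\Re u,\Im u$ isotropy of $u$ makes every member a multiple of the identity form,
so the elliptic normal form applies. The new point has third coordinate 1 and so lies off the line
through $u$ and $\bar u$; its fourth coordinate is nonreal. -/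
theorem IsPositiveNet.exists_second_pair {A : Fin 3 → Matrix (Fin 4) (Fin 4) ℝ}
    (hA : IsPositiveNet A) {u : Fin 4 → ℂ} (hu : IsBasePoint (complexNet A) u)
    (hli : LinearIndependent ℂ ![u, star u]) : ∃ w, IsBasePoint (complexNet A) w ∧
      LinearIndependent ℂ ![w, star w] ∧ LinearIndependent ℂ ![u, w] ∧
      LinearIndependent ℂ ![u, star w] := by
  let x : Fin 4 → ℝ := fun i => (u i).re
  let y : Fin 4 → ℝ := fun i => (u i).im
  have hux : u = complexVec x + Complex.I • complexVec y := eq_complexVec_add u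
  have hsx : star u = complexVec x - Complex.I • complexVec y := star_eq_complexVec_sub u
  have hxy : LinearIndependent ℂ ![complexVec x, complexVec y] := by
    rw [LinearIndependent.pair_iff] at hli ⊢
    intro s t hst
    obtain ⟨h1, h2⟩ := hli (s - Complex.I * t) (s + Complex.I * t) (by
      rw [hsx, hux]
      have : (s - Complex.I * t) • (complexVec x + Complex.I • complexVec y)
        + (s + Complex.I * t) • (complexVec x - Complex.I • complexVec y)
        = (2 : ℂ) • (s • complexVec x + (-(Complex.I * Complex.I) * t) • complexVec y) := by module
      rw [this, Complex.I_mul_I]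
      simp [hst])
    have ht : Complex.I * t = 0 := by linear_combination (h2 - h1) / 2
    exact ⟨by linear_combination (h1 + h2) / 2, by simpa using ht⟩
  have hre : ∀ k, x ⬝ᵥ A k *ᵥ x = y ⬝ᵥ A k *ᵥ y ∧ x ⬝ᵥ A k *ᵥ y = 0 := by
    intro k
    have h := hu.isotropic k
    rw [hux] at h
    simp only [mulVec_add, mulVec_smul, dotProduct_add, add_dotProduct, smul_dotProduct,
      dotProduct_smul, smul_eq_mul, dotProduct_complexNet,
      (hA.isSymm k).dotProduct_mulVec_comm y x] at h
    have h1 := congrArg Complex.re h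
    have h2 := congrArg Complex.im h
    simp at h1 h2
    exact ⟨by linear_combination h1, h2⟩
  obtain ⟨k, hk⟩ := hA.smooth.exists_pairing_ne_zero hu hli
  have hβ : x ⬝ᵥ A k *ᵥ x ≠ 0 := by
    intro h0
    apply hk
    rw [hsx, hux]
    simp only [mulVec_add, mulVec_sub, mulVec_smul, dotProduct_add, dotProduct_sub, add_dotProduct,
      smul_dotProduct, dotProduct_smul, smul_eq_mul, dotProduct_complexNet,
      (hA.isSymm k).dotProduct_mulVec_comm y x, (hre k).2, ← (hre k).1, h0]
    simp
  obtain ⟨g, h, a, b, c, d, a', b', c', d', n₀, m₀, r₀, n₁, m₁, r₁, n₂, m₂, r₂, hg, hh, hgx, hgy,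
    hN⟩ := exists_normal_form hA.isSymm hxy.of_complexVec (β := fun k => x ⬝ᵥ A k *ᵥ x)
    (i₀ := 1) (i₁ := 0) (i₂ := 1) (fun h0 => hβ (by simpa using congrFun h0 k))
    (by norm_num) (by norm_num) (by norm_num) (by simp) (by simpa using fun k => (hre k).2)
    (by simpa using fun k => (hre k).1.symm)
  have hA' := hA.transformNet hg hh
  rw [hN] at hA'
  obtain ⟨x₁, x₂, t, ht, hw⟩ := hA'.exists_nonreal_basePoint_normalNet
  have hw' : IsBasePoint (complexNet (_root_.transformNet g h A)) ![x₁, x₂, 1, t] := by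
    rw [hN]; exact hw
  rw [complexNet_transformNet] at hw'
  have hgc := det_map_ofReal_ne_zero hg
  have hgu : g.map Complex.ofRealHom *ᵥ ![1, Complex.I, 0, 0] = u := by
    rw [hux, ← hgx, ← hgy]
    ext i
    simp [mulVec, dotProduct, Fin.sum_univ_four, complexVec, mul_comm]
  refine ⟨_, hw'.of_transformNet hgc (det_map_ofReal_ne_zero hh), ?_, ?_, ?_⟩
  · rw [← map_star_mulVec]
    refine linearIndependent_pair_mulVec hgc ?_
    rw [LinearIndependent.pair_iff]
    intro p q hpq
    have h2 := congrFun hpq 2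
    have h3 := congrFun hpq 3
    simp at h2 h3
    have hne : t - (starRingEnd ℂ) t ≠ 0 := by
      rw [Complex.sub_conj]
      simp [ht]
    have hp : p * (t - (starRingEnd ℂ) t) = 0 := by
      linear_combination h3 - (starRingEnd ℂ) t * h2
    have hp0 := (mul_eq_zero.1 hp).resolve_right hne
    exact ⟨hp0, by simpa [hp0] using h2⟩
  · rw [← hgu]
    refine linearIndependent_pair_mulVec hgc ?_
    rw [LinearIndependent.pair_iff]
    intro p q hpq
    have h2 := congrFun hpq 2
    have h0 := congrFun hpq 0
    simp at h2 h0
    exact ⟨by simpa [h2] using h0, h2⟩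
  · rw [← hgu, ← map_star_mulVec]
    refine linearIndependent_pair_mulVec hgc ?_
    rw [LinearIndependent.pair_iff]
    intro p q hpq
    have h2 := congrFun hpq 2
    have h0 := congrFun hpq 0
    simp at h2 h0
    exact ⟨by simpa [h2] using h0, h2⟩

/-- The base locus of a positive net contains two distinct pairs of complex conjugate points. -/
theorem IsPositiveNet.exists_two_pairs {A : Fin 3 → Matrix (Fin 4) (Fin 4) ℝ}
    (hA : IsPositiveNet A) : ∃ u w, IsBasePoint (complexNet A) u ∧ IsBasePoint (complexNet A) w ∧
      LinearIndependent ℂ ![u, star u] ∧ LinearIndependent ℂ ![w, star w] ∧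
      LinearIndependent ℂ ![u, w] ∧ LinearIndependent ℂ ![u, star w] := by
  have key : ∃ u, IsBasePoint (complexNet A) u ∧ LinearIndependent ℂ ![u, star u] := by
    obtain ⟨z, hz, hdet⟩ := hA.exists_singular_member
    obtain ⟨u, v, hu, hv, hli⟩ := hA.smooth.exists_two_basePoints hz hdet
    by_cases h1 : LinearIndependent ℂ ![u, star u]
    · exact ⟨u, hu, h1⟩
    by_cases h2 : LinearIndependent ℂ ![v, star v]
    · exact ⟨v, hv, h2⟩
    exfalso
    obtain ⟨c, x, hc, rfl⟩ := exists_smul_eq_complexVec hu.ne_zero h1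
    obtain ⟨d, y, hd, rfl⟩ := exists_smul_eq_complexVec hv.ne_zero h2
    refine hA.false_of_two_real_basePoints hu.of_smul hv.of_smul ?_
    rw [LinearIndependent.pair_iff] at hli ⊢
    intro s t hst
    have := hli (s * c⁻¹) (t * d⁻¹) (by
      rw [← hst, smul_smul, smul_smul, mul_assoc, mul_assoc, inv_mul_cancel₀ hc,
        inv_mul_cancel₀ hd, mul_one, mul_one])
    simpa [hc, hd] using this
  obtain ⟨u, hu, hli⟩ := key
  obtain ⟨w, hw, h1, h2, h3⟩ := hA.exists_second_pair hu hli
  exact ⟨u, w, hu, hw, hli, h1, h2, h3⟩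

end

/-! ### From determinantal representations to nets. -/

noncomputable section

open Matrix

set_option linter.unusedSimpArgs false

theorem MvPolynomial.IsHomogeneous.eq_sum_coeff_single {R : Type*} [CommRing R]
    {p : MvPolynomial (Fin 3) R} (hp : p.IsHomogeneous 1) :
    p = ∑ k, MvPolynomial.C (MvPolynomial.coeff (Finsupp.single k 1) p) * MvPolynomial.X k := by
  ext m
  rw [MvPolynomial.coeff_sum]
  simp only [MvPolynomial.coeff_C_mul, MvPolynomial.coeff_X]
  by_cases hm : m.degree = 1
  · obtain ⟨k, rfl⟩ : ∃ k, m = Finsupp.single k 1 := by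
      rw [Finsupp.degree_eq_sum, Fin.sum_univ_three] at hm
      rcases (by omega : (m 0 = 1 ∧ m 1 = 0 ∧ m 2 = 0) ∨ (m 0 = 0 ∧ m 1 = 1 ∧ m 2 = 0) ∨
        (m 0 = 0 ∧ m 1 = 0 ∧ m 2 = 1)) with ⟨h0, h1, h2⟩ | ⟨h0, h1, h2⟩ | ⟨h0, h1, h2⟩
      · exact ⟨0, by ext i; fin_cases i <;> simp [h0, h1, h2]⟩
      · exact ⟨1, by ext i; fin_cases i <;> simp [h0, h1, h2]⟩
      · exact ⟨2, by ext i; fin_cases i <;> simp [h0, h1, h2]⟩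
    rw [Finset.sum_eq_single k]
    · simp
    · intro j _ hj
      rw [if_neg, mul_zero]
      intro h
      exact hj (Finsupp.single_left_injective one_ne_zero h)
    · simp
  · rw [hp.coeff_eq_zero hm]
    symm
    refine Finset.sum_eq_zero fun k _ => ?_
    rw [if_neg, mul_zero]
    rintro rfl
    simp at hm

/-- The net of real quadrics `M₀, M₁, M₂` of a linear matrix `x₀ M₀ + x₁ M₁ + x₂ M₂`. -/
def coeffNet (M : Matrix (Fin 4) (Fin 4) (MvPolynomial (Fin 3) ℝ)) :
    Fin 3 → Matrix (Fin 4) (Fin 4) ℝ :=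
  fun k => M.map fun p => MvPolynomial.coeff (Finsupp.single k 1) p

theorem coeffMatrix_eq_complexNet (M : Matrix (Fin 4) (Fin 4) (MvPolynomial (Fin 3) ℝ)) :
    coeffMatrix M = complexNet (coeffNet M) := rfl

variable {F : MvPolynomial (Fin 3) ℝ} {M : Matrix (Fin 4) (Fin 4) (MvPolynomial (Fin 3) ℝ)}

theorem IsLinearDetRep.map_aeval (hM : IsLinearDetRep F M) {S : Type*} [CommRing S] [Algebra ℝ S]
    (z : Fin 3 → S) : M.map (MvPolynomial.aeval z) =
      netMember (fun k => (coeffNet M k).map (algebraMap ℝ S)) z := by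
  ext i j
  conv_lhs => rw [Matrix.map_apply, (hM.linear i j).eq_sum_coeff_single]
  simp [netMember, Matrix.sum_apply, coeffNet, mul_comm]

theorem IsLinearDetRep.aeval_eq_det (hM : IsLinearDetRep F M) {S : Type*} [CommRing S]
    [Algebra ℝ S] (z : Fin 3 → S) : MvPolynomial.aeval z F =
      (netMember (fun k => (coeffNet M k).map (algebraMap ℝ S)) z).det := by
  rw [← hM.map_aeval, ← hM.det_eq, AlgHom.map_det]
  rfl

theorem MvPolynomial.eval_derivative_aeval_line (F : MvPolynomial (Fin 3) ℝ) (z : Fin 3 → ℂ)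
    (i : Fin 3) : (MvPolynomial.aeval (fun j => Polynomial.C (z j) +
      Polynomial.C ((Pi.single i 1 : Fin 3 → ℂ) j) * Polynomial.X) F).derivative.eval 0 =
        MvPolynomial.aeval z (MvPolynomial.pderiv i F) := by
  have h0 : ∀ p : MvPolynomial (Fin 3) ℝ, (MvPolynomial.aeval (fun j => Polynomial.C (z j) +
      Polynomial.C ((Pi.single i 1 : Fin 3 → ℂ) j) * Polynomial.X) p).eval 0 =
        MvPolynomial.aeval z p := by
    intro p
    induction p using MvPolynomial.induction_on with
    | C r => simp [Polynomial.algebraMap_apply]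
    | add p q hp hq => simp [hp, hq]
    | mul_X p j hp => simp [hp]
  induction F using MvPolynomial.induction_on with
  | C r => simp [Polynomial.algebraMap_apply]
  | add p q hp hq => simp [hp, hq]
  | mul_X p j hp =>
    rw [map_mul, Polynomial.derivative_mul, Polynomial.eval_add, Polynomial.eval_mul,
      Polynomial.eval_mul, hp, h0 p, Derivation.leibniz, MvPolynomial.pderiv_X]
    simp only [MvPolynomial.aeval_X, smul_eq_mul, map_add, map_mul]
    by_cases hij : j = i
    · subst hij; simp; ring
    · simp [Pi.single_apply, hij, Ne.symm hij]; ring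

/-- The determinant of `S + t B` vanishes to second order at `t = 0` if the symmetric matrix `S`
has a kernel vector which is isotropic for `B`. -/
theorem Matrix.IsSymm.eval_derivative_det_add_smul {S B : Matrix (Fin 4) (Fin 4) ℂ} (hS : S.IsSymm)
    {k : Fin 4 → ℂ} (hk : k ≠ 0) (hSk : S *ᵥ k = 0) (hB : k ⬝ᵥ B *ᵥ k = 0) :
    (S.map Polynomial.C + (Polynomial.X : Polynomial ℂ) • B.map Polynomial.C).det.derivative.eval 0
      = 0 := by
  obtain ⟨j, hj⟩ := Function.ne_iff.1 hk
  set N := S.map Polynomial.C + (Polynomial.X : Polynomial ℂ) • B.map Polynomial.C with hN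
  -- Replacing column `j` by `N k`, which is $X\cdot Bk$, shows $k_j\det N=X\det N'$. At $X=0$ the
  -- row vector `k` annihilates every column of $N'$, so a second factor $X$ appears.
  have h1 := Matrix.det_updateCol_sum N j (fun i => Polynomial.C (k i))
  have h2 : (fun l => ∑ i, Polynomial.C (k i) • N l i) =
      (Polynomial.X : Polynomial ℂ) • fun l => Polynomial.C ((B *ᵥ k) l) := by
    ext1 l
    have h3 : ∑ i, Polynomial.C (k i) * Polynomial.C (S l i) = (0 : Polynomial ℂ) := by
      have := congrArg Polynomial.C (congrFun hSk l)
      simp only [mulVec, dotProduct, map_sum, map_mul, Pi.zero_apply, map_zero] at this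
      rw [← this]
      exact Finset.sum_congr rfl fun _ _ => mul_comm _ _
    simp only [hN, Matrix.add_apply, Matrix.smul_apply, Matrix.map_apply, smul_eq_mul, mul_add,
      Finset.sum_add_distrib, h3, zero_add, Pi.smul_apply, mulVec, dotProduct, map_sum, map_mul,
      Finset.mul_sum]
    exact Finset.sum_congr rfl fun _ _ => by ring
  rw [h2, Matrix.det_updateCol_smul] at h1
  have h3 : (N.updateCol j fun l => Polynomial.C ((B *ᵥ k) l)).det.eval 0 = 0 := by
    rw [← Polynomial.coe_evalRingHom, RingHom.map_det]
    refine Matrix.exists_vecMul_eq_zero_iff.1 ⟨k, hk, ?_⟩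
    ext l
    by_cases hl : l = j
    · subst hl
      simpa [vecMul, dotProduct] using hB
    · have := congrFun hSk l
      rw [← hS.eq, mulVec_transpose] at this
      simpa [vecMul, dotProduct, hl, hN] using this
  have h4 := congrArg (fun p => (Polynomial.derivative p).eval 0) h1
  simp [Polynomial.derivative_mul, h3] at h4
  exact h4.resolve_left hj

theorem netMember_line (A : Fin 3 → Matrix (Fin 4) (Fin 4) ℝ) (z e : Fin 3 → ℂ) :
    netMember (fun k => (A k).map (algebraMap ℝ (Polynomial ℂ)))
      (fun j => Polynomial.C (z j) + Polynomial.C (e j) * Polynomial.X) =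
    (netMember (complexNet A) z).map Polynomial.C +
      (Polynomial.X : Polynomial ℂ) • (netMember (complexNet A) e).map Polynomial.C := by
  ext1 a b
  simp only [netMember, Matrix.sum_apply, Matrix.add_apply, Matrix.smul_apply, Matrix.map_apply,
    Fin.sum_univ_three, complexNet, smul_eq_mul, map_add, map_mul, Polynomial.algebraMap_apply,
    Complex.coe_algebraMap, Complex.ofRealHom_eq_coe]
  ring

theorem IsLinearDetRep.isPositiveNet (hM : IsLinearDetRep F M) (hpos : IsPositiveForm F)
    (hsmooth : IsSmoothCurve F) : IsPositiveNet (coeffNet M) := by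
  have hsymm : ∀ k, (coeffNet M k).IsSymm := fun k => by
    ext i j
    simp only [coeffNet, transpose_apply, map_apply]
    rw [← hM.isSymm.apply i j]
  have hsymmC : ∀ k, (complexNet (coeffNet M) k).IsSymm := fun k => (hsymm k).map _
  refine ⟨hsymm, ⟨hsymmC, fun z hz => ?_⟩, fun a ha => ?_⟩
  · by_cases hF : MvPolynomial.aeval z F = 0
    · obtain ⟨i, hi⟩ := hsmooth z hz hF
      -- An isotropic kernel vector would make the derivative of the determinant in direction $e_i$
      -- vanish, that is $\partial_iF(z)=0$.
      refine ⟨Pi.single i 1, fun k hk hzk hik => hi ?_⟩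
      have h1 := (netMember_isSymm hsymmC z).eval_derivative_det_add_smul hk hzk hik
      rw [← MvPolynomial.eval_derivative_aeval_line, hM.aeval_eq_det, netMember_line]
      exact h1
    · refine ⟨0, fun k hk hzk => ?_⟩
      rw [hM.aeval_eq_det] at hF
      exact absurd (Matrix.eq_zero_of_mulVec_eq_zero hF hzk) hk
  · have h1 := hM.aeval_eq_det a
    have h2 := hpos a ha
    rw [← MvPolynomial.coe_aeval_eq_eval] at h2
    have h3 : (fun k => (coeffNet M k).map (algebraMap ℝ ℝ)) = coeffNet M := by
      ext; simp
    rw [h3] at h1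
    exact h1 ▸ h2

theorem mk_mem_cayleyOctad_iff {u : Fin 4 → ℂ} (hu : u ≠ 0) :
    Projectivization.mk ℂ u hu ∈ cayleyOctad M ↔ IsBasePoint (complexNet (coeffNet M)) u := by
  constructor
  · rintro ⟨v, hv, he, h⟩
    obtain ⟨c, hc⟩ := (Projectivization.mk_eq_mk_iff' ℂ _ _ hu hv).1 he
    refine ⟨hu, fun k => ?_⟩
    rw [← hc, mulVec_smul, dotProduct_smul, smul_dotProduct]
    have := h k
    rw [coeffMatrix_eq_complexNet] at this
    rw [this, smul_zero, smul_zero]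
  · exact fun h => ⟨u, hu, rfl, h.isotropic⟩

theorem linearIndependent_pair_iff_mk_ne {u v : Fin 4 → ℂ} (hu : u ≠ 0) (hv : v ≠ 0) :
    LinearIndependent ℂ ![u, v] ↔ Projectivization.mk ℂ u hu ≠ Projectivization.mk ℂ v hv := by
  rw [LinearIndependent.pair_iff' hu, ne_comm, Ne, Projectivization.mk_eq_mk_iff', not_exists]

end

/-! ### The normalizing base change. -/

noncomputable section

open Matrix

set_option linter.unusedSimpArgs false

variable {F : MvPolynomial (Fin 3) ℝ} {M : Matrix (Fin 4) (Fin 4) (MvPolynomial (Fin 3) ℝ)}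
  {O : Fin 4 → Fin 4 → ℂ}

/-- The images of the octad points under the normalizing base change, as columns. -/
def octadNormal : Matrix (Fin 4) (Fin 4) ℂ :=
  !![1, 1, 0, 0;
     Complex.I, -Complex.I, 0, 0;
     0, 0, 1, 1;
     0, 0, Complex.I, -Complex.I]

theorem isUnit_det_octadNormal : IsUnit octadNormal.det := by
  have : octadNormal.det = -4 := by
    rw [octadNormal, det_succ_row_zero]
    simp [Fin.sum_univ_succ, det_fin_three, Fin.succAbove]
    ring
  rw [this]
  norm_num

/-- The real matrix whose columns are the real and imaginary parts of `O 0` and `O 2`. -/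
def realFrame (O : Fin 4 → Fin 4 → ℂ) : Matrix (Fin 4) (Fin 4) ℝ :=
  (Matrix.of ![fun i => (O 0 i).re, fun i => (O 0 i).im, fun i => (O 2 i).re, fun i => (O 2 i).im])ᵀ

theorem transpose_of_eq_realFrame_mul (h1 : O 1 = star (O 0)) (h3 : O 3 = star (O 2)) :
    (Matrix.of O)ᵀ = (realFrame O).map Complex.ofRealHom * octadNormal := by
  ext i j
  rw [transpose_apply, of_apply, mul_apply, Fin.sum_univ_four]
  fin_cases j
  · simp [octadNormal, realFrame]
  · simp [octadNormal, realFrame, h1, Complex.ext_iff]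
  · simp [octadNormal, realFrame]
  · simp [octadNormal, realFrame, h3, Complex.ext_iff]

theorem IsConjugateQuadruple.linearIndependent (h : IsConjugateQuadruple M O)
    (hA : IsSmoothNet (complexNet (coeffNet M))) : LinearIndependent ℂ O :=
  hA.linearIndependent_basePoints (fun i => (mk_mem_cayleyOctad_iff (h.ne_zero i)).1 (h.mem_octad i))
    fun i j hij => (linearIndependent_pair_iff_mk_ne (h.ne_zero i) (h.ne_zero j)).2 fun e =>
      hij (h.distinct e)

theorem isUnit_det_realFrame (h1 : O 1 = star (O 0)) (h3 : O 3 = star (O 2))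
    (hli : LinearIndependent ℂ O) : IsUnit (realFrame O).det := by
  have hO : IsUnit (Matrix.of O)ᵀ := linearIndependent_cols_iff_isUnit.1 hli
  rw [Matrix.isUnit_iff_isUnit_det, transpose_of_eq_realFrame_mul h1 h3, det_mul,
    isUnit_iff_ne_zero] at hO
  have hd := left_ne_zero_of_mul hO
  rw [isUnit_iff_ne_zero]
  intro h0
  apply hd
  rw [← RingHom.mapMatrix_apply, ← RingHom.map_det, h0, map_zero]

/-- The octad columns are `realFrame O` times the invertible `octadNormal`; cancelling the latter
leaves `T * realFrame O = 1`. -/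
theorem isOctadBaseChange_iff (h1 : O 1 = star (O 0)) (h3 : O 3 = star (O 2))
    (hli : LinearIndependent ℂ O) (T : Matrix (Fin 4) (Fin 4) ℝ) :
    IsOctadBaseChange O T ↔ T = (realFrame O)⁻¹ := by
  have hV := isUnit_det_realFrame h1 h3 hli
  have key : T.map (fun r : ℝ => (r : ℂ)) * (Matrix.of O)ᵀ = octadNormal ↔ T * realFrame O = 1 := by
    rw [transpose_of_eq_realFrame_mul h1 h3, ← Matrix.mul_assoc]
    have e : T.map (fun r : ℝ => (r : ℂ)) * (realFrame O).map Complex.ofRealHom =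
      (T * realFrame O).map Complex.ofRealHom := by rw [Matrix.map_mul]; rfl
    rw [e]
    constructor
    · intro h
      have h2 := congrArg (· * octadNormal⁻¹) h
      simp only [Matrix.mul_assoc, Matrix.mul_nonsing_inv _ isUnit_det_octadNormal,
        Matrix.mul_one] at h2
      refine Matrix.map_injective Complex.ofReal_injective ?_
      change (T * realFrame O).map Complex.ofRealHom = (1 : Matrix _ _ ℝ).map Complex.ofRealHom
      rw [h2, Matrix.map_one _ (by simp) (by simp)]
    · intro h
      rw [h, Matrix.map_one _ (by simp) (by simp), Matrix.one_mul]
  constructor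
  · intro h
    exact (Matrix.inv_eq_left_inv (key.1 h.map_octad)).symm
  · rintro rfl
    exact ⟨Matrix.isUnit_nonsing_inv_det _ hV, key.2 (Matrix.nonsing_inv_mul _ hV)⟩

theorem IsPositiveNet.exists_conjugateQuadruple (hA : IsPositiveNet (coeffNet M)) :
    ∃ (O : Fin 4 → Fin 4 → ℂ) (T : Matrix (Fin 4) (Fin 4) ℝ),
      IsConjugateQuadruple M O ∧ IsOctadBaseChange O T ∧ T.det ^ 2 = 1 := by
  obtain ⟨u, w, hu, hw, huu, hww, huw, huw'⟩ := hA.exists_two_pairs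
  have swap : ∀ {a b : Fin 4 → ℂ}, LinearIndependent ℂ ![a, b] → LinearIndependent ℂ ![b, a] :=
    fun h => LinearIndependent.pair_symm_iff.1 h
  have conj : ∀ {a b : Fin 4 → ℂ}, LinearIndependent ℂ ![a, b] →
      LinearIndependent ℂ ![star a, star b] := by
    intro a b h
    rw [LinearIndependent.pair_iff] at h ⊢
    intro s t hst
    have := h (star s) (star t) (by
      have := congrArg star hst
      simpa using this)
    simpa using this
  have quad : ∀ c : ℝ, c ≠ 0 → IsConjugateQuadruple M
      ![(c : ℂ) • u, star ((c : ℂ) • u), w, star w] := by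
    intro c hc
    have hcc : (c : ℂ) ≠ 0 := Complex.ofReal_ne_zero.2 hc
    have hcu : IsBasePoint (complexNet (coeffNet M)) ((c : ℂ) • u) :=
      ⟨smul_ne_zero hcc hu.ne_zero, fun k => by
        rw [mulVec_smul, dotProduct_smul, smul_dotProduct, hu.isotropic, smul_zero, smul_zero]⟩
    have hscale : ∀ {d : ℂ} {a b : Fin 4 → ℂ}, d ≠ 0 → LinearIndependent ℂ ![a, b] →
        LinearIndependent ℂ ![d • a, b] := by
      intro d a b hd h
      rw [LinearIndependent.pair_iff] at h ⊢
      intro s t hst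
      have := h (s * d) t (by rw [← hst, smul_smul])
      simpa [hd] using this
    have hbase : ∀ i, IsBasePoint (complexNet (coeffNet M))
        ((![(c : ℂ) • u, star ((c : ℂ) • u), w, star w] : Fin 4 → Fin 4 → ℂ) i) := by
      intro i
      fin_cases i
      · exact hcu
      · exact hcu.star
      · exact hw
      · exact hw.star
    have e : star ((c : ℂ) • u) = (c : ℂ) • star u := by
      rw [star_smul]; simp
    have l01 : LinearIndependent ℂ ![(c : ℂ) • u, star ((c : ℂ) • u)] := by
      rw [e]
      exact hscale hcc (swap (hscale hcc (swap huu)))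
    have l02 := hscale hcc huw
    have l03 := hscale hcc huw'
    have l12 : LinearIndependent ℂ ![star ((c : ℂ) • u), w] := by
      have := conj huw'
      rw [star_star] at this
      rw [e]
      exact hscale hcc this
    have l13 : LinearIndependent ℂ ![star ((c : ℂ) • u), star w] := by
      rw [e]
      exact hscale hcc (conj huw)
    have hpair : ∀ i j, i ≠ j → LinearIndependent ℂ
        ![(![(c : ℂ) • u, star ((c : ℂ) • u), w, star w] : Fin 4 → Fin 4 → ℂ) i,
          (![(c : ℂ) • u, star ((c : ℂ) • u), w, star w] : Fin 4 → Fin 4 → ℂ) j] := by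
      intro i j hij
      fin_cases i <;> fin_cases j <;>
        first
        | exact absurd rfl hij
        | exact l01 | exact l02 | exact l03 | exact l12 | exact l13 | exact hww
        | exact swap l01 | exact swap l02 | exact swap l03 | exact swap l12 | exact swap l13
        | exact swap hww
    refine ⟨fun i => (hbase i).ne_zero, fun i => (mk_mem_cayleyOctad_iff _).2 (hbase i), ?_, rfl, rfl⟩
    intro i j he
    by_contra hij
    exact (linearIndependent_pair_iff_mk_ne (hbase i).ne_zero (hbase j).ne_zero).1 (hpair i j hij) he
  have hδ := (isUnit_det_realFrame rfl rfl ((quad 1 one_ne_zero).linearIndependent hA.smooth)).ne_zero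
  set δ := (realFrame ![((1 : ℝ) : ℂ) • u, star (((1 : ℝ) : ℂ) • u), w, star w]).det with hδ'
  -- Scaling the first pair by a real $c$ multiplies the frame determinant `δ` by $c^2$, so this $c$
  -- makes it $\pm1$.
  have hc : √(|δ|⁻¹) ≠ 0 := by
    rw [Real.sqrt_ne_zero'] 
    positivity
  have hq := quad _ hc
  have hli := hq.linearIndependent hA.smooth
  refine ⟨_, _, hq, (isOctadBaseChange_iff rfl rfl hli _).2 rfl, ?_⟩
  have hframe : ∀ c : ℝ, realFrame ![(c : ℂ) • u, star ((c : ℂ) • u), w, star w] =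
      realFrame ![((1 : ℝ) : ℂ) • u, star (((1 : ℝ) : ℂ) • u), w, star w] *
        Matrix.diagonal ![c, c, 1, 1] := by
    intro c
    ext i j
    rw [Matrix.mul_diagonal]
    fin_cases j <;> simp [realFrame, mul_comm]
  rw [hframe, Matrix.det_nonsing_inv, det_mul, ← hδ', det_diagonal, Fin.prod_univ_four]
  simp only [cons_val, Ring.inverse_eq_inv', mul_one]
  rw [Real.mul_self_sqrt (by positivity), inv_pow, mul_pow, inv_pow, sq_abs]
  field_simp

end

/-! ### Block form of the transformed matrix and positivity of the quadratic representation. -/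

noncomputable section

open Matrix

set_option linter.unusedSimpArgs false

variable {F : MvPolynomial (Fin 3) ℝ} {M : Matrix (Fin 4) (Fin 4) (MvPolynomial (Fin 3) ℝ)}
  {O : Fin 4 → Fin 4 → ℂ} {T : Matrix (Fin 4) (Fin 4) ℝ}

theorem IsOctadBaseChange.transpose_of_eq (hT : IsOctadBaseChange O T) :
    (Matrix.of O)ᵀ = T⁻¹.map Complex.ofRealHom * octadNormal := by
  have h : T.map Complex.ofRealHom * (Matrix.of O)ᵀ = octadNormal := hT.map_octad
  rw [← h, ← Matrix.mul_assoc, ← Matrix.map_mul, Matrix.nonsing_inv_mul _ hT.isUnit_det,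
    Matrix.map_one _ (by simp) (by simp), Matrix.one_mul]

theorem IsOctadBaseChange.bitangentForm_eq (hT : IsOctadBaseChange O T) (i j : Fin 4) :
    bitangentForm M (O i) (O j) = (((octadNormal.map MvPolynomial.C)ᵀ *
      (baseChange T M).map (MvPolynomial.map (algebraMap ℝ ℂ)) *
        octadNormal.map MvPolynomial.C : Matrix (Fin 4) (Fin 4) (MvPolynomial (Fin 3) ℂ))) i j := by
  have h1 : bitangentForm M (O i) (O j) = ((((Matrix.of O)ᵀ.map MvPolynomial.C)ᵀ *
      M.map (MvPolynomial.map (algebraMap ℝ ℂ)) * (Matrix.of O)ᵀ.map MvPolynomial.C :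
        Matrix (Fin 4) (Fin 4) (MvPolynomial (Fin 3) ℂ))) i j := by
    rw [Matrix.mul_assoc]
    rfl
  have h2 : (T⁻¹.map Complex.ofRealHom).map (MvPolynomial.C (σ := Fin 3)) =
      (T⁻¹.map MvPolynomial.C).map (MvPolynomial.map (algebraMap ℝ ℂ)) := by
    ext1 a b
    simp
  rw [h1, hT.transpose_of_eq, baseChange, Matrix.map_mul, Matrix.map_mul, Matrix.map_mul, h2,
    transpose_mul, transpose_map]
  simp only [Matrix.mul_assoc]

theorem octadNormal_congruence_apply {N : Matrix (Fin 4) (Fin 4) (MvPolynomial (Fin 3) ℂ)}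
    (hN : N.IsSymm) {B : Matrix (Fin 4) (Fin 4) (MvPolynomial (Fin 3) ℂ)}
    (hB : B = (octadNormal.map MvPolynomial.C)ᵀ * N * octadNormal.map MvPolynomial.C) :
    (B 0 0 = N 0 0 - N 1 1 + MvPolynomial.C Complex.I * (2 * N 0 1) ∧
      B 2 2 = N 2 2 - N 3 3 + MvPolynomial.C Complex.I * (2 * N 2 3)) ∧
    (B 0 1 = N 0 0 + N 1 1 ∧ B 2 3 = N 2 2 + N 3 3) ∧
    B 0 2 = N 0 2 - N 1 3 + MvPolynomial.C Complex.I * (N 0 3 + N 1 2) ∧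
    B 1 3 = N 0 2 - N 1 3 - MvPolynomial.C Complex.I * (N 0 3 + N 1 2) ∧
    B 0 3 = N 0 2 + N 1 3 - MvPolynomial.C Complex.I * (N 0 3 - N 1 2) ∧
    B 1 2 = N 0 2 + N 1 3 + MvPolynomial.C Complex.I * (N 0 3 - N 1 2) := by
  have hI : (MvPolynomial.C Complex.I : MvPolynomial (Fin 3) ℂ) ^ 2 = -1 := by
    rw [← map_pow, Complex.I_sq, map_neg, map_one]
  have h01 := hN.apply 0 1
  have h23 := hN.apply 2 3
  subst hB
  simp only [octadNormal, mul_apply, Fin.sum_univ_four, transpose_apply, map_apply, of_apply,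
    cons_val, map_one, map_zero, map_neg, cons_val_zero, cons_val_one]
  generalize (MvPolynomial.C Complex.I : MvPolynomial (Fin 3) ℂ) = J at hI ⊢
  refine ⟨⟨?_, ?_⟩, ⟨?_, ?_⟩, ?_, ?_, ?_, ?_⟩
  · linear_combination J * h01 + N 1 1 * hI
  · linear_combination J * h23 + N 3 3 * hI
  · linear_combination J * h01 - N 1 1 * hI
  · linear_combination J * h23 - N 3 3 * hI
  · linear_combination N 1 3 * hI
  · linear_combination N 1 3 * hI
  · linear_combination -N 1 3 * hI
  · linear_combination -N 1 3 * hI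

theorem MvPolynomial.eq_zero_of_map_add_I_mul_map_eq_zero {p q : MvPolynomial (Fin 3) ℝ}
    (h : MvPolynomial.map (algebraMap ℝ ℂ) p +
      MvPolynomial.C Complex.I * MvPolynomial.map (algebraMap ℝ ℂ) q = 0) : p = 0 ∧ q = 0 := by
  have key : ∀ m, MvPolynomial.coeff m p = 0 ∧ MvPolynomial.coeff m q = 0 := by
    intro m
    have := congrArg (MvPolynomial.coeff m) h
    simp only [MvPolynomial.coeff_add, MvPolynomial.coeff_C_mul, MvPolynomial.coeff_map,
      MvPolynomial.coeff_zero, Complex.coe_algebraMap] at this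
    rw [Complex.ext_iff] at this
    simpa using this
  exact ⟨MvPolynomial.ext _ _ fun m => by simpa using (key m).1,
    MvPolynomial.ext _ _ fun m => by simpa using (key m).2⟩

theorem IsLinearDetRep.bitangentForm_self_eq_zero (hM : IsLinearDetRep F M) {u : Fin 4 → ℂ}
    (hu : IsBasePoint (complexNet (coeffNet M)) u) : bitangentForm M u u = 0 := by
  have h : bitangentForm M u u = ∑ k, MvPolynomial.C (u ⬝ᵥ complexNet (coeffNet M) k *ᵥ u) *
      MvPolynomial.X k := by
    have e : M.map (MvPolynomial.map (algebraMap ℝ ℂ)) =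
        netMember (fun k => (complexNet (coeffNet M) k).map MvPolynomial.C)
          (fun k => (MvPolynomial.X k : MvPolynomial (Fin 3) ℂ)) := by
      ext1 i j
      rw [Matrix.map_apply, (hM.linear i j).eq_sum_coeff_single]
      simp [netMember, Matrix.sum_apply, coeffNet, complexNet, mul_comm]
    rw [bitangentForm, e, dotProduct_netMember_mulVec]
    refine Finset.sum_congr rfl fun k _ => ?_
    rw [mul_comm]
    congr 1
    simp [dotProduct, mulVec]
  rw [h]
  exact Finset.sum_eq_zero fun k _ => by rw [hu.isotropic, map_zero, zero_mul]

theorem IsLinearDetRep.baseChange (hM : IsLinearDetRep F M) (T : Matrix (Fin 4) (Fin 4) ℝ) :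
    IsLinearDetRep (MvPolynomial.C ((T.det ^ 2)⁻¹) * F) (_root_.baseChange T M) := by
  refine ⟨?_, fun i j => ?_, ?_⟩
  · rw [_root_.baseChange, Matrix.IsSymm, transpose_mul, transpose_mul, transpose_transpose,
      hM.isSymm.eq, Matrix.mul_assoc]
  · rw [_root_.baseChange, mul_apply]
    refine MvPolynomial.IsHomogeneous.sum _ _ _ fun k _ => ?_
    rw [mul_apply]
    refine (MvPolynomial.IsHomogeneous.sum _ _ 1 fun l _ => ?_).mul
      (MvPolynomial.isHomogeneous_C _ _) (m := 1) (n := 0)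
    exact (MvPolynomial.isHomogeneous_C _ _).mul (hM.linear l k) (m := 0) (n := 1)
  · have h : (T⁻¹.map (MvPolynomial.C (σ := Fin 3))).det = MvPolynomial.C (T.det⁻¹) := by
      rw [← RingHom.mapMatrix_apply, ← RingHom.map_det, Matrix.det_nonsing_inv,
        Ring.inverse_eq_inv']
    rw [_root_.baseChange, det_mul, det_mul, det_transpose, h, hM.det_eq, ← inv_pow, map_pow]
    ring

theorem IsLinearDetRep.exists_octadEntries (hM : IsLinearDetRep F M)
    (hO : IsConjugateQuadruple M O) (hT : IsOctadBaseChange O T) :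
    ∃ b₁₂ b₃₄ l₁₃ l₁₄ l₂₃ l₂₄ : MvPolynomial (Fin 3) ℝ,
      IsOctadEntries M O b₁₂ b₃₄ l₁₃ l₁₄ l₂₃ l₂₄ ∧
      _root_.baseChange T M = blockForm b₁₂ b₃₄ l₁₃ l₁₄ l₂₃ l₂₄ := by
  have hM' := hM.baseChange T
  set M' := _root_.baseChange T M with hM'def
  obtain ⟨⟨h00, h22⟩, ⟨h01, h23⟩, h02, h13, h03, h12⟩ := octadNormal_congruence_apply
    (hM'.isSymm.map (MvPolynomial.map (algebraMap ℝ ℂ))) rfl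
  simp only [hM'def, ← hT.bitangentForm_eq] at h00 h22 h01 h23 h02 h13 h03 h12
  simp only [← hM'def, Matrix.map_apply] at h00 h22 h01 h23 h02 h13 h03 h12
  have hbase : ∀ i, bitangentForm M (O i) (O i) = 0 := fun i =>
    hM.bitangentForm_self_eq_zero ((mk_mem_cayleyOctad_iff (hO.ne_zero i)).1 (hO.mem_octad i))
  rw [hbase] at h00 h22
  -- The vanishing of $O_1MO_1^t$ splits into real and imaginary parts because $M'$ is real, giving
  -- $M'_{11}=M'_{22}$ and $M'_{12}=0$.
  obtain ⟨h00', h01'⟩ := MvPolynomial.eq_zero_of_map_add_I_mul_map_eq_zero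
    (p := M' 0 0 - M' 1 1) (q := 2 * M' 0 1) (by rw [h00]; simp)
  obtain ⟨h22', h23'⟩ := MvPolynomial.eq_zero_of_map_add_I_mul_map_eq_zero
    (p := M' 2 2 - M' 3 3) (q := 2 * M' 2 3) (by rw [h22]; simp)
  have z01 : M' 0 1 = 0 := by simpa using h01'
  have z23 : M' 2 3 = 0 := by simpa using h23'
  have hhalf : (MvPolynomial.C (1 / 2) : MvPolynomial (Fin 3) ℝ) * 2 = 1 := by
    rw [← map_ofNat (MvPolynomial.C (σ := Fin 3) (R := ℝ)) 2, ← map_mul]; norm_num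
  have hq : (MvPolynomial.C (1 / 4) : MvPolynomial (Fin 3) ℂ) * 4 = 1 := by
    rw [← map_ofNat (MvPolynomial.C (σ := Fin 3) (R := ℂ)) 4, ← map_mul]; norm_num
  have hI : (MvPolynomial.C Complex.I : MvPolynomial (Fin 3) ℂ) ^ 2 = -1 := by
    rw [← map_pow, Complex.I_sq, map_neg, map_one]
  have hIq : (MvPolynomial.C (-(Complex.I / 4)) : MvPolynomial (Fin 3) ℂ) =
      -(MvPolynomial.C Complex.I * MvPolynomial.C (1 / 4)) := by
    rw [← map_mul, ← map_neg]; congr 1; ring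
  have s := fun i j => hM'.isSymm.apply i j
  refine ⟨M' 0 0 + M' 1 1, M' 2 2 + M' 3 3, M' 0 2, M' 0 3, M' 1 2, M' 1 3,
    ⟨?_, ?_, ?_, ?_, ?_, ?_⟩, ?_⟩
  · rw [h01, map_add]
  · rw [h23, map_add]
  · rw [h02, h13, h03, h12]
    linear_combination -MvPolynomial.map (algebraMap ℝ ℂ) (M' 0 2) * hq
  · rw [h02, h13, h03, h12, map_neg]
    linear_combination -MvPolynomial.map (algebraMap ℝ ℂ) (M' 1 3) * hq
  · rw [h02, h13, h03, h12, hIq]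
    generalize (MvPolynomial.C (1 / 4) : MvPolynomial (Fin 3) ℂ) = r at hq ⊢
    linear_combination -MvPolynomial.map (algebraMap ℝ ℂ) (M' 1 2) * hq +
      4 * r * MvPolynomial.map (algebraMap ℝ ℂ) (M' 1 2) * hI
  · rw [h02, h13, h03, h12, hIq]
    generalize (MvPolynomial.C (1 / 4) : MvPolynomial (Fin 3) ℂ) = r at hq ⊢
    linear_combination -MvPolynomial.map (algebraMap ℝ ℂ) (M' 0 3) * hq +
      4 * r * MvPolynomial.map (algebraMap ℝ ℂ) (M' 0 3) * hI
  · have e0 : MvPolynomial.C (1 / 2) * (M' 0 0 + M' 1 1) = M' 0 0 := by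
      linear_combination M' 0 0 * hhalf - MvPolynomial.C (1 / 2) * h00'
    have e2 : MvPolynomial.C (1 / 2) * (M' 2 2 + M' 3 3) = M' 2 2 := by
      linear_combination M' 2 2 * hhalf - MvPolynomial.C (1 / 2) * h22'
    rw [blockForm, e0, e2]
    ext1 i j
    fin_cases i <;> fin_cases j <;> simp [z01, z23, s 0 1, s 2 3, sub_eq_zero.1 h00',
      sub_eq_zero.1 h22', (s 0 1).trans z01, (s 2 3).trans z23, s 0 2, s 0 3, s 1 2, s 1 3]

variable {b₁₂ b₃₄ l₁₃ l₁₄ l₂₃ l₂₄ : MvPolynomial (Fin 3) ℝ}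

theorem C_quarter_eq : (MvPolynomial.C (1 / 4) : MvPolynomial (Fin 3) ℝ) =
    MvPolynomial.C (1 / 2) ^ 2 := by
  rw [← map_pow]; norm_num

theorem adjugate_blockForm_submatrix (b₁₂ b₃₄ l₁₃ l₁₄ l₂₃ l₂₄ : MvPolynomial (Fin 3) ℝ) :
    (blockForm b₁₂ b₃₄ l₁₃ l₁₄ l₂₃ l₂₄).adjugate.submatrix ![0, 1] ![0, 1] =
      (-(MvPolynomial.C (1 / 2) * b₃₄)) • quadMatrix b₁₂ b₃₄ l₁₃ l₁₄ l₂₃ l₂₄ := by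
  rw [blockForm, quadMatrix, C_quarter_eq]
  generalize (MvPolynomial.C (1 / 2) : MvPolynomial (Fin 3) ℝ) = h
  ext1 i j
  rw [submatrix_apply, adjugate_fin_succ_eq_det_submatrix, det_fin_three]
  fin_cases i <;> fin_cases j <;> simp [Fin.succAbove] <;> ring

/-- With scalar diagonal blocks $\beta I$ and $\gamma I$ the determinant is $\det(\beta\gamma
I-LL^t)$; in size two neither the adjugate nor a sign changes it. -/
theorem det_quadMatrix (b₁₂ b₃₄ l₁₃ l₁₄ l₂₃ l₂₄ : MvPolynomial (Fin 3) ℝ) :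
    (quadMatrix b₁₂ b₃₄ l₁₃ l₁₄ l₂₃ l₂₄).det = (blockForm b₁₂ b₃₄ l₁₃ l₁₄ l₂₃ l₂₄).det := by
  rw [blockForm, det_bordered_fin_four, quadMatrix, det_neg, det_fin_two, C_quarter_eq]
  simp
  ring

theorem quadMatrix_isHomogeneous (hb : ∀ i j, (blockForm b₁₂ b₃₄ l₁₃ l₁₄ l₂₃ l₂₄ i j).IsHomogeneous 1)
    (i j : Fin 2) : (quadMatrix b₁₂ b₃₄ l₁₃ l₁₄ l₂₃ l₂₄ i j).IsHomogeneous 2 := by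
  have h0 := hb 0 0
  have h2 := hb 2 2
  have h13 : l₁₃.IsHomogeneous 1 := hb 0 2
  have h14 : l₁₄.IsHomogeneous 1 := hb 0 3
  have h23 : l₂₃.IsHomogeneous 1 := hb 1 2
  have h24 : l₂₄.IsHomogeneous 1 := hb 1 3
  have hp : (MvPolynomial.C (1 / 4) * b₁₂ * b₃₄).IsHomogeneous 2 := by
    have e : MvPolynomial.C (1 / 4) * b₁₂ * b₃₄ =
        (MvPolynomial.C (1 / 2) * b₁₂) * (MvPolynomial.C (1 / 2) * b₃₄) := by
      rw [C_quarter_eq]; ring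
    rw [e]
    exact h0.mul h2
  have hm : (l₁₃ * l₂₃ + l₁₄ * l₂₄).IsHomogeneous 2 := (h13.mul h23).add (h14.mul h24)
  fin_cases i <;> fin_cases j
  · exact ((hp.sub (h23.pow 2)).sub (h24.pow 2)).neg
  · exact hm.neg
  · exact hm.neg
  · exact ((hp.sub (h13.pow 2)).sub (h14.pow 2)).neg

theorem Matrix.PosDef.of_fin_two {A : Matrix (Fin 2) (Fin 2) ℝ} (hA : A.IsSymm) (h0 : 0 < A 0 0)
    (hd : 0 < A.det) : A.PosDef := by
  have hs := hA.apply 0 1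
  rw [det_fin_two, hs] at hd
  refine PosDef.of_dotProduct_mulVec_pos ?_ fun x hx => ?_
  · rw [Matrix.IsHermitian, conjTranspose_eq_transpose_of_trivial, hA.eq]
  · have e : star x ⬝ᵥ A *ᵥ x = A 0 0 * x 0 ^ 2 + 2 * A 0 1 * x 0 * x 1 + A 1 1 * x 1 ^ 2 := by
      simp [dotProduct, mulVec, Fin.sum_univ_two, hs]
      ring
    rw [e]
    refine pos_of_mul_pos_right (a := A 0 0) ?_ h0.le
    have e2 : A 0 0 * (A 0 0 * x 0 ^ 2 + 2 * A 0 1 * x 0 * x 1 + A 1 1 * x 1 ^ 2) =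
      (A 0 0 * x 0 + A 0 1 * x 1) ^ 2 + (A 0 0 * A 1 1 - A 0 1 * A 0 1) * x 1 ^ 2 := by ring
    rw [e2]
    by_cases h1 : x 1 = 0
    · have hx0 : x 0 ≠ 0 := fun h => hx (by ext i; fin_cases i <;> assumption)
      rw [h1]
      have := mul_pos h0 h0
      have := sq_pos_of_ne_zero hx0
      nlinarith
    · positivity

theorem quadMatrix_posDef (hpos : IsPositiveForm (quadMatrix b₁₂ b₃₄ l₁₃ l₁₄ l₂₃ l₂₄).det)
    (hb : (MvPolynomial.C (1 / 2) * b₁₂).IsHomogeneous 1) {a : Fin 3 → ℝ} (ha : a ≠ 0) :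
    ((quadMatrix b₁₂ b₃₄ l₁₃ l₁₄ l₂₃ l₂₄).map (MvPolynomial.eval a)).PosDef := by
  set Q := quadMatrix b₁₂ b₃₄ l₁₃ l₁₄ l₂₃ l₂₄ with hQ
  have hsymm : Q.IsSymm := by
    ext1 i j
    fin_cases i <;> fin_cases j <;> rfl
  have hdet : ∀ c, c ≠ 0 → 0 < (Q.map (MvPolynomial.eval c)).det := fun c hc => by
    have := hpos c hc
    rwa [RingHom.map_det, RingHom.mapMatrix_apply] at this
  -- A zero of the corner entry would leave determinant $-Q_{12}^2\le0$.
  have hne : ∀ c, c ≠ 0 → MvPolynomial.eval c (Q 0 0) ≠ 0 := fun c hc h0 => by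
    have := hdet c hc
    rw [det_fin_two, Matrix.map_apply, h0, zero_mul, Matrix.map_apply, Matrix.map_apply,
      hsymm.apply 0 1] at this
    nlinarith [mul_self_nonneg (MvPolynomial.eval c (Q 0 1))]
  refine Matrix.PosDef.of_fin_two (hsymm.map _) ?_ (hdet a ha)
  -- At a real zero of $b_{12}$ the corner entry is the sum of squares $l_{23}^2+l_{24}^2$. Being
  -- nowhere zero, it keeps this sign on the connected set $\mathbb R^3\setminus\{0\}$.
  obtain ⟨c, hc, hc0, -⟩ := exists_dotProduct_pair_eq_zero
    (fun k => MvPolynomial.coeff (Finsupp.single k 1) (MvPolynomial.C (1 / 2) * b₁₂)) 0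
  have hbc : MvPolynomial.eval c b₁₂ = 0 := by
    have h1 : MvPolynomial.eval c (MvPolynomial.C (1 / 2) * b₁₂) = 0 := by
      rw [hb.eq_sum_coeff_single]
      simpa [dotProduct] using hc0
    simpa using h1
  have hcpos : 0 < MvPolynomial.eval c (Q 0 0) := by
    refine lt_of_le_of_ne ?_ (hne c hc).symm
    have : MvPolynomial.eval c (Q 0 0) =
        MvPolynomial.eval c l₂₃ ^ 2 + MvPolynomial.eval c l₂₄ ^ 2 := by
      simp [hQ, quadMatrix, hbc]
      ring
    rw [this]
    positivity
  have hpre : IsPreconnected ({0}ᶜ : Set (Fin 3 → ℝ)) :=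
    (isConnected_compl_singleton_of_one_lt_rank (by simp) 0).isPreconnected
  rw [Matrix.map_apply]
  by_contra hneg
  obtain ⟨d, hd, hd0⟩ := hpre.intermediate_value ha hc
    (f := fun c => MvPolynomial.eval c (Q 0 0)) (MvPolynomial.continuous_eval _).continuousOn
    ⟨not_lt.1 hneg, hcpos.le⟩
  exact hne d hd hd0

theorem isPositiveQuadraticRep_quadMatrix
    (hpos : IsPositiveForm (quadMatrix b₁₂ b₃₄ l₁₃ l₁₄ l₂₃ l₂₄).det)
    (hb : ∀ i j, (blockForm b₁₂ b₃₄ l₁₃ l₁₄ l₂₃ l₂₄ i j).IsHomogeneous 1) :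
    IsPositiveQuadraticRep (quadMatrix b₁₂ b₃₄ l₁₃ l₁₄ l₂₃ l₂₄).det
      (quadMatrix b₁₂ b₃₄ l₁₃ l₁₄ l₂₃ l₂₄) := by
  refine ⟨?_, quadMatrix_isHomogeneous hb, rfl, fun a => ?_⟩
  · ext1 i j
    fin_cases i <;> fin_cases j <;> rfl
  · by_cases ha : a = 0
    · have : (quadMatrix b₁₂ b₃₄ l₁₃ l₁₄ l₂₃ l₂₄).map (MvPolynomial.eval a) = 0 := by
        ext1 i j
        rw [ha, Matrix.map_apply, Matrix.zero_apply, MvPolynomial.eval_zero,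
          MvPolynomial.constantCoeff_eq]
        exact (quadMatrix_isHomogeneous hb i j).coeff_eq_zero (by simp)
      rw [this]
      exact PosSemidef.zero
    · exact (quadMatrix_posDef hpos (hb 0 0) ha).posSemidef

end

theorem mainTheorem5 (F : MvPolynomial (Fin 3) ℝ) (hF : F.IsHomogeneous 4)
    (hpos : IsPositiveForm F) (hsmooth : IsSmoothCurve F)
    (M : Matrix (Fin 4) (Fin 4) (MvPolynomial (Fin 3) ℝ)) (hM : IsLinearDetRep F M) :
    (∃ (O : Fin 4 → Fin 4 → ℂ) (T : Matrix (Fin 4) (Fin 4) ℝ),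
      IsConjugateQuadruple M O ∧ IsOctadBaseChange O T ∧ T.det ^ 2 = 1) ∧
    ∀ O : Fin 4 → Fin 4 → ℂ, IsConjugateQuadruple M O →
      (∃! T : Matrix (Fin 4) (Fin 4) ℝ, IsOctadBaseChange O T) ∧
      ∀ T : Matrix (Fin 4) (Fin 4) ℝ, IsOctadBaseChange O T →
        ∃ b₁₂ b₃₄ l₁₃ l₁₄ l₂₃ l₂₄ : MvPolynomial (Fin 3) ℝ,
          IsOctadEntries M O b₁₂ b₃₄ l₁₃ l₁₄ l₂₃ l₂₄ ∧
          baseChange T M = blockForm b₁₂ b₃₄ l₁₃ l₁₄ l₂₃ l₂₄ ∧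
          (baseChange T M).adjugate.submatrix ![0, 1] ![0, 1] =
            (-(MvPolynomial.C (1 / 2) * b₃₄)) • quadMatrix b₁₂ b₃₄ l₁₃ l₁₄ l₂₃ l₂₄ ∧
          IsPositiveQuadraticRep (MvPolynomial.C ((T.det ^ 2)⁻¹) * F)
            (quadMatrix b₁₂ b₃₄ l₁₃ l₁₄ l₂₃ l₂₄) ∧
          (T.det ^ 2 = 1 →
            IsPositiveQuadraticRep F (quadMatrix b₁₂ b₃₄ l₁₃ l₁₄ l₂₃ l₂₄)) ∧
          ∀ a : Fin 3 → ℝ, a ≠ 0 →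
            ((quadMatrix b₁₂ b₃₄ l₁₃ l₁₄ l₂₃ l₂₄).map (MvPolynomial.eval a)).PosDef := by
  have hA := hM.isPositiveNet hpos hsmooth
  refine ⟨hA.exists_conjugateQuadruple, fun O hO => ⟨?_, fun T hT => ?_⟩⟩
  · have hiff := isOctadBaseChange_iff hO.conj_first hO.conj_second
      (hO.linearIndependent hA.smooth)
    exact ⟨(realFrame O)⁻¹, (hiff _).2 rfl, fun T hT => (hiff T).1 hT⟩
  · obtain ⟨b₁₂, b₃₄, l₁₃, l₁₄, l₂₃, l₂₄, hentries, hblock⟩ := hM.exists_octadEntries hO hT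
    have hM' := hM.baseChange T
    have hrep := isPositiveQuadraticRep_quadMatrix (b₁₂ := b₁₂) (b₃₄ := b₃₄) (l₁₃ := l₁₃)
      (l₁₄ := l₁₄) (l₂₃ := l₂₃) (l₂₄ := l₂₄)
    have hposdef := quadMatrix_posDef (b₁₂ := b₁₂) (b₃₄ := b₃₄) (l₁₃ := l₁₃)
      (l₁₄ := l₁₄) (l₂₃ := l₂₃) (l₂₄ := l₂₄)
    have hdet := hM'.det_eq
    have hlin := hM'.linear
    rw [hblock] at hdet hlin
    rw [det_quadMatrix, hdet] at hrep hposdef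
    have hF' : IsPositiveForm (MvPolynomial.C ((T.det ^ 2)⁻¹) * F) := fun a ha => by
      have h1 := hpos a ha
      have h2 := hT.isUnit_det.ne_zero
      rw [map_mul, MvPolynomial.eval_C]
      positivity
    refine ⟨b₁₂, b₃₄, l₁₃, l₁₄, l₂₃, l₂₄, hentries, hblock, ?_, hrep hF' hlin, fun h1 => ?_,
      fun a ha => hposdef hF' (hlin 0 0) ha⟩
    · rw [hblock, adjugate_blockForm_submatrix]
    · have := hrep hF' hlin
      rwa [h1, inv_one, map_one, one_mul] at this
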